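/- **Setting.** A stochastic combinatorial semi-bandit consists of a ground set $E=\{1,\dots,L\}$, a non-empty feasible set $\Theta\subseteq 2^E$ and a probability distribution $P$ on $[0,1]^E$. Put $K=\max_{A\in\Theta}|A|$, $f(A,w)=\sum_{e\in A}w(e)$ and $\bar w=\mathbb E_{w\sim P}[w]$. The weights $w_1,w_2,\dots$ are i.i.d. from $P$; in step $t$ an (adaptive, possibly randomized) algorithm chooses $A_t\in\Theta$ and then observes $w_t(e)$ for $e\in A_t$ only. Assume throughout that every item lies in some feasible set and that $A^*=\arg\max_{A\in\Theta}f(A,\bar w)$ is unique. The regret is $R(n)=\mathbb E\sum_{t=1}^n\bigl(f(A^*,w_t)-f(A_t,w_t)\bigr)$, the gap of $A$ is $\Delta_A=f(A^*,\bar w)-f(A,\bar w)$, and for $e\in\tilde E=E\setminus A^*$, $\Delta_{e,\min}=\min\{\Delta_A: A\in\Theta,\ e\in A,\ \Delta_A>0\}$. An algorithm for $\Theta$ is *consistent* if, for every $P$ (with a unique optimal solution), every suboptimal $A\in\Theta$ and every $\alpha>0$, the expected number of times that $A$ is chosen in $n$ steps is $o(n^\alpha)$. **CombUCB1** uses an offline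 oracle that returns an element of $\arg\max_{A\in\Theta}f(A,v)$ for any $v\in[0,\infty)^E$ (ties broken by a fixed measurable rule). *Initialization:* start with $u(e)=1$ for all $e$; while some $u(e)=1$, choose the oracle's answer $A_t$ to $u$ and, for all $e\in A_t$, set $\hat w(e)\leftarrow w_t(e)$ and $u(e)\leftarrow0$. *Afterwards*, starting with $T(e)=1$ for all $e$, choose in each step $t$ the oracle's answer $A_t$ to $U_t(e)=\hat w(e)+\sqrt{1.5\log(t-1)/T(e)}$ and, for $e\in A_t$, set $\hat w(e)\leftarrow(T(e)\hat w(e)+w_t(e))/(T(e)+1)$ and then $T(e)\leftarrow T(e)+1$. **$K$-path problem.** Here $L=mK$ with $m,K\ge1$, $\Theta$ consists of $m$ disjoint paths of $K$ items, and $0<\Delta/K<0.5$. Items of the same path have equal weights, the weights of different paths are independent, and the weight of an item is Bernoulli with mean $0.5$ on the optimal path $j$ and $0.5-\Delta/K$ on the other paths. **Theorem.** CombUCB1 is computationally efficient and sample efficient (regret optimal up to polylogarithmic factors): 1. *(Computation.)* There are a fixed real-RAM program with oracle calls (unit cost for each real arithmetic operation, $\sqrt{\cdot}$, $\log$, comparison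 and memory access) and a polynomial $p$, the same for all problems, such that the program makes the choices of CombUCB1, calls the oracle exactly once in each step, and, if the oracle needs time at most $q$ on each non-negative weight vector, needs time at most $p(L,K)+q$ in each step, and at most $p(L,K)$ before the first step. 2. *(Upper bounds.)* For every semi-bandit and every $n$, the regret of CombUCB1 satisfies $$R(n)\le\sum_{e\in\tilde E}K\frac{534}{\Delta_{e,\min}}\log n+\Bigl(\frac{\pi^2}{3}+1\Bigr)KL \quad\text{and}\quad R(n)\le47\sqrt{KLn\log n}+\Bigl(\frac{\pi^2}{3}+1\Bigr)KL .$$ 3. *(Gap-dependent optimality.)* CombUCB1 is consistent. For every consistent algorithm $\pi$ for the $K$-path problem, every $0<\Delta/K<0.5$ and every optimal path $j$, $$\liminf_{n\to\infty}\frac{R_\pi(n)}{\log n}\ge\frac{(L-K)K}{4\Delta},\qquad \limsup_{n\to\infty}\frac{R_{\mathrm{CombUCB1}}(n)}{\log n}\le 2136\,\liminf_{n\to\infty}\frac{R_\pi(n)}{\log n}.$$ 4. *(Gap-free optimality.)* There is a universal constant $C$ such that for all $m\ge2$, $K\ge1$, $L=mK$ and $n$ there is $\Delta$ with $0<\Delta/K<0.5$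 such that for every algorithm $\pi$ for the $K$-path problem $$\frac1m\sum_{j=1}^m R_{\pi,j}(n)\ge\frac1{20}\min\bigl(\sqrt{KLn},\,Kn\bigr),$$ where $R_{\pi,j}$ is its regret when path $j$ is optimal; moreover, if $n\ge KL$, there is a $j$ such that for every semi-bandit with $L$ items and maximum solution size $K$, $R_{\mathrm{CombUCB1}}(n)\le C\sqrt{\log n}\;R_{\pi,j}(n)$. -/

import Mathlib

open MeasureTheory ProbabilityTheory Filter Topology Asymptotics

noncomputable section

namespace SemiBandit

open Classical in
/-- The weights of the items in `A`; the entries of all other items are erased. -/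
def mask {L : ℕ} (A : Finset (Fin L)) (w : Fin L → ℝ) : Fin L → ℝ :=
  fun e => if e ∈ A then w e else 0

/-- The return `f(A, w)` of solution `A` under the weights `w`. -/
def ret {L : ℕ} (A : Finset (Fin L)) (w : Fin L → ℝ) : ℝ := ∑ e ∈ A, w e

/-- The maximum number `K` of chosen items. -/
def maxSize {L : ℕ} (Θ : Finset (Finset (Fin L))) : ℕ := Θ.sup Finset.card

/-- Every item is contained in at least one feasible solution. -/
def Covers {L : ℕ} (Θ : Finset (Finset (Fin L))) : Prop := ∀ e, ∃ A ∈ Θ, e ∈ A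

/-- A probability distribution of the weights, supported in the unit cube. A stochastic
combinatorial semi-bandit with `L` items is a pair of a (non-empty) feasible set
`Θ : Finset (Finset (Fin L))` and a `WeightLaw L`. -/
structure WeightLaw (L : ℕ) where
  P : Measure (Fin L → ℝ)
  prob : IsProbabilityMeasure P
  cube : ∀ᵐ w ∂P, ∀ e, w e ∈ Set.Icc (0 : ℝ) 1

instance {L : ℕ} (B : WeightLaw L) : IsProbabilityMeasure B.P := B.prob

/-- The expected weights of the items. -/
def WeightLaw.mean {L : ℕ} (B : WeightLaw L) (e : Fin L) : ℝ := ∫ w, w e ∂B.P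

/-- `Astar` is the unique optimal solution. -/
def IsOptimal {L : ℕ} (Θ : Finset (Finset (Fin L))) (B : WeightLaw L)
    (Astar : Finset (Fin L)) : Prop :=
  Astar ∈ Θ ∧ ∀ A ∈ Θ, A ≠ Astar → ret A B.mean < ret Astar B.mean

/-- The gap of solution `A`. -/
def gap {L : ℕ} (B : WeightLaw L) (Astar A : Finset (Fin L)) : ℝ :=
  ret Astar B.mean - ret A B.mean

/-- The minimum gap of a suboptimal solution that contains item `e`. (It is only used for items
`e` outside of the optimal solution, where the set is finite and non-empty.) -/
def minGap {L : ℕ} (Θ : Finset (Finset (Fin L))) (B : WeightLaw L) (Astar : Finset (Fin L))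
    (e : Fin L) : ℝ :=
  sInf {d : ℝ | ∃ A ∈ Θ, e ∈ A ∧ 0 < gap B Astar A ∧ d = gap B Astar A}

/-- A (possibly randomized) online learning algorithm for the feasible set `Θ`. Before the first
step a state is drawn from `start`; it holds the whole internal randomness of the algorithm. At
each step the algorithm chooses the solution `act s ∈ Θ` in the current state `s`, and then moves
to the state `next s o`, where `o` are the observed weights, that is, the weights of the chosen
items only. An algorithm that is given by functions of the random seed and of the past observations
is the special case where the state is the seed together with the list of past observations. -/
structure Algorithm {L : ℕ} (Θ : Finset (Finset (Fin L))) where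
  State : Type
  mState : MeasurableSpace State
  start : Measure State
  start_prob : IsProbabilityMeasure start
  act : State → Finset (Fin L)
  act_mem : ∀ s, act s ∈ Θ
  act_meas : Measurable act
  next : State → (Fin L → ℝ) → State
  next_meas : Measurable (fun x : State × (Fin L → ℝ) => next x.1 x.2)

namespace Algorithm

variable {L : ℕ} {Θ : Finset (Finset (Fin L))}

instance (π : Algorithm Θ) : MeasurableSpace π.State := π.mState

instance (π : Algorithm Θ) : IsProbabilityMeasure π.start := π.start_prob

/-- The state after `t` steps, when the initial state is `s` and the weights in the successive
steps are `w 0, w 1, w 2, …`. -/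
def stateAt (π : Algorithm Θ) (s : π.State) (w : ℕ → Fin L → ℝ) : ℕ → π.State
  | 0 => s
  | t + 1 => π.next (stateAt π s w t) (mask (π.act (stateAt π s w t)) (w t))

/-- The solution chosen in step `t + 1`. -/
def actAt (π : Algorithm Θ) (s : π.State) (w : ℕ → Fin L → ℝ) (t : ℕ) : Finset (Fin L) :=
  π.act (π.stateAt s w t)

/-- The joint law of the random initial state and of the i.i.d. weights of all steps. -/
def law (π : Algorithm Θ) (B : WeightLaw L) : Measure (π.State × (ℕ → Fin L → ℝ)) :=
  π.start.prod (Measure.infinitePi fun _ : ℕ => B.P)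

/-- The expected cumulative regret `R(n)` in `n` steps. -/
def regret (π : Algorithm Θ) (B : WeightLaw L) (Astar : Finset (Fin L)) (n : ℕ) : ℝ :=
  ∫ x, ∑ t ∈ Finset.range n,
    (ret Astar (x.2 t) - ret (π.actAt x.1 x.2 t) (x.2 t)) ∂(π.law B)

open Classical in
/-- The expected number of times that solution `A` is chosen in `n` steps. -/
def expectedPulls (π : Algorithm Θ) (B : WeightLaw L) (A : Finset (Fin L)) (n : ℕ) : ℝ :=
  ∫ x, (((Finset.range n).filter fun t => π.actAt x.1 x.2 t = A).card : ℝ) ∂(π.law B)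

/-- The algorithm is consistent: under any distribution of the weights with a unique optimal
solution, any suboptimal solution is chosen `o(n ^ α)` times in expectation, for any `α > 0`. -/
def Consistent (π : Algorithm Θ) : Prop :=
  ∀ (B : WeightLaw L) (Astar : Finset (Fin L)), IsOptimal Θ B Astar →
    ∀ A ∈ Θ, A ≠ Astar → ∀ α : ℝ, 0 < α →
      (fun n : ℕ => π.expectedPulls B A n) =o[atTop] (fun n : ℕ => (n : ℝ) ^ α)

end Algorithm

/-- An offline optimization oracle: it solves `argmax_{A ∈ Θ} f(A, w)` for any vector `w` of
non-negative weights. -/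
structure Oracle {L : ℕ} (Θ : Finset (Finset (Fin L))) where
  solve : (Fin L → ℝ) → Finset (Fin L)
  solve_mem : ∀ w, solve w ∈ Θ
  solve_opt : ∀ w, (∀ e, 0 ≤ w e) → ∀ A ∈ Θ, ret A w ≤ ret (solve w) w
  solve_meas : Measurable solve

/-! ### CombUCB1 -/

/-- The variables of CombUCB1: the index `time` of the current step (starting with step 1), the
auxiliary weights `u` of the initialization phase, the number `T e` of observations of item `e`
that enter the average `avg e` of its observed weights. -/
structure UCBState (L : ℕ) where
  time : ℕ
  u : Fin L → ℝ
  T : Fin L → ℕ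
  avg : Fin L → ℝ

namespace UCBState

variable {L : ℕ}

def toTuple (s : UCBState L) : ℕ × (Fin L → ℝ) × (Fin L → ℕ) × (Fin L → ℝ) :=
  (s.time, s.u, s.T, s.avg)

instance : MeasurableSpace (UCBState L) := MeasurableSpace.comap toTuple inferInstance

/-- The state before the first step. The counters `T` are not touched by the initialization phase,
at the end of which they have to be equal to one. -/
def first (L : ℕ) : UCBState L := ⟨1, fun _ => 1, fun _ => 1, fun _ => 0⟩

/-- The initialization phase lasts until all auxiliary weights are zero. -/
def Initializing (s : UCBState L) : Prop := ∃ e, s.u e = 1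

/-- The upper confidence bounds on the expected weights of the items. -/
def ucb (s : UCBState L) (e : Fin L) : ℝ :=
  s.avg e + Real.sqrt (1.5 * Real.log ((s.time : ℝ) - 1) / (s.T e : ℝ))

open Classical in
/-- The weight vector that is passed to the oracle in the current step. -/
def query (s : UCBState L) : Fin L → ℝ := if s.Initializing then s.u else s.ucb

open Classical in
/-- The update after solution `A` was chosen and the weights `o e`, `e ∈ A`, were observed. -/
def update (s : UCBState L) (A : Finset (Fin L)) (o : Fin L → ℝ) : UCBState L :=
  if s.Initializing then
    { time := s.time + 1
      u := fun e => if e ∈ A then 0 else s.u e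
      T := s.T
      avg := fun e => if e ∈ A then o e else s.avg e }
  else
    { time := s.time + 1
      u := s.u
      T := fun e => if e ∈ A then s.T e + 1 else s.T e
      avg := fun e =>
        if e ∈ A then ((s.T e : ℝ) * s.avg e + o e) / ((s.T e : ℝ) + 1) else s.avg e }

theorem measurable_toTuple : Measurable (toTuple : UCBState L → _) := comap_measurable _

theorem measurable_time : Measurable (UCBState.time : UCBState L → ℕ) :=
  measurable_toTuple.fst

theorem measurable_u : Measurable (UCBState.u : UCBState L → _) :=
  measurable_toTuple.snd.fst

theorem measurable_T : Measurable (UCBState.T : UCBState L → _) :=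
  measurable_toTuple.snd.snd.fst

theorem measurable_avg : Measurable (UCBState.avg : UCBState L → _) :=
  measurable_toTuple.snd.snd.snd

theorem measurableSet_initializing : MeasurableSet {s : UCBState L | s.Initializing} := by
  have : {s : UCBState L | s.Initializing} = ⋃ e, {s : UCBState L | s.u e = 1} := by
    ext s; simp [Initializing]
  rw [this]
  exact MeasurableSet.iUnion fun e =>
    measurableSet_eq_fun ((measurable_pi_apply e).comp measurable_u) measurable_const

theorem measurable_ucb : Measurable (ucb : UCBState L → _) := by
  refine measurable_pi_lambda _ fun e => ?_
  have ht : Measurable fun s : UCBState L => (s.time : ℝ) :=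
    measurable_from_top.comp measurable_time
  have hT : Measurable fun s : UCBState L => (s.T e : ℝ) :=
    measurable_from_top.comp ((measurable_pi_apply e).comp measurable_T)
  have ha : Measurable fun s : UCBState L => s.avg e :=
    (measurable_pi_apply e).comp measurable_avg
  unfold ucb
  fun_prop

theorem measurable_query : Measurable (query : UCBState L → _) := by
  classical
  exact Measurable.ite measurableSet_initializing measurable_u measurable_ucb

theorem measurable_update {A : UCBState L → Finset (Fin L)} (hA : Measurable A) :
    Measurable fun x : UCBState L × (Fin L → ℝ) => x.1.update (A x.1) x.2 := by
  classical
  have hmem : ∀ e, MeasurableSet {x : UCBState L × (Fin L → ℝ) | e ∈ A x.1} := fun e =>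
    (measurableSet_mem_finset e).preimage (hA.comp measurable_fst)
  have hini : MeasurableSet {x : UCBState L × (Fin L → ℝ) | x.1.Initializing} :=
    measurable_fst measurableSet_initializing
  have ht : Measurable fun x : UCBState L × (Fin L → ℝ) => x.1.time + 1 :=
    (measurable_time.comp measurable_fst).add_const 1
  have hu : ∀ e, Measurable fun x : UCBState L × (Fin L → ℝ) => x.1.u e := fun e =>
    (measurable_pi_apply e).comp (measurable_u.comp measurable_fst)
  have hT : ∀ e, Measurable fun x : UCBState L × (Fin L → ℝ) => x.1.T e := fun e =>
    (measurable_pi_apply e).comp (measurable_T.comp measurable_fst)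
  have hT' : ∀ e, Measurable fun x : UCBState L × (Fin L → ℝ) => (x.1.T e : ℝ) := fun e =>
    measurable_from_top.comp (hT e)
  have ha : ∀ e, Measurable fun x : UCBState L × (Fin L → ℝ) => x.1.avg e := fun e =>
    (measurable_pi_apply e).comp (measurable_avg.comp measurable_fst)
  have ho : ∀ e, Measurable fun x : UCBState L × (Fin L → ℝ) => x.2 e := fun e =>
    (measurable_pi_apply e).comp measurable_snd
  unfold update
  refine Measurable.ite hini ?_ ?_
  · refine measurable_comap_iff.2 (ht.prodMk (Measurable.prodMk ?_ (Measurable.prodMk ?_ ?_)))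
    · exact measurable_pi_lambda _ fun e => Measurable.ite (hmem e) measurable_const (hu e)
    · exact measurable_pi_lambda _ fun e => hT e
    · exact measurable_pi_lambda _ fun e => Measurable.ite (hmem e) (ho e) (ha e)
  · refine measurable_comap_iff.2 (ht.prodMk (Measurable.prodMk ?_ (Measurable.prodMk ?_ ?_)))
    · exact measurable_pi_lambda _ fun e => hu e
    · exact measurable_pi_lambda _ fun e =>
        Measurable.ite (hmem e) ((hT e).add_const 1) (hT e)
    · exact measurable_pi_lambda _ fun e => Measurable.ite (hmem e)
        ((((hT' e).mul (ha e)).add (ho e)).div ((hT' e).add_const 1)) (ha e)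

end UCBState

/-- CombUCB1, run with the given offline optimization oracle. -/
def combUCB1 {L : ℕ} {Θ : Finset (Finset (Fin L))} (O : Oracle Θ) : Algorithm Θ where
  State := UCBState L
  mState := inferInstance
  start := Measure.dirac (UCBState.first L)
  start_prob := inferInstance
  act := fun s => O.solve s.query
  act_mem := fun _ => O.solve_mem _
  act_meas := O.solve_meas.comp UCBState.measurable_query
  next := fun s o => s.update (O.solve s.query) o
  next_meas := UCBState.measurable_update (O.solve_meas.comp UCBState.measurable_query)

/-! ### The `K`-path semi-bandit -/

/-- Path `j` of the `K`-path problem with `L = m * K` items: there are `m = L / K` paths, and path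
`j` consists of the `K` items `j * K, …, j * K + K - 1`. -/
def path {m : ℕ} (K : ℕ) (j : Fin m) : Finset (Fin (m * K)) :=
  Finset.univ.filter fun e : Fin (m * K) => e.divNat = j

/-- The feasible set of the `K`-path problem. -/
def paths (m K : ℕ) : Finset (Finset (Fin (m * K))) :=
  Finset.univ.image fun j : Fin m => path K j

/-- The success probability of path `i` when path `j` is optimal. -/
def pathMean {m : ℕ} (K : ℕ) (Δ : ℝ) (hΔ : 0 < Δ / K ∧ Δ / K < 0.5) (j i : Fin m) :
    unitInterval :=
  if i = j then ⟨0.5, by norm_num, by norm_num⟩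
  else ⟨0.5 - Δ / K, by linarith [hΔ.2], by linarith [hΔ.1]⟩

/-- The weights of the `K`-path problem whose optimal path is `j`: the items of the same path have
the same weight; the weights of different paths are independent Bernoulli variables, with mean
`0.5` for path `j` and `0.5 - Δ / K` for all other paths. -/
def pathLaw {m : ℕ} (K : ℕ) (Δ : ℝ) (hΔ : 0 < Δ / K ∧ Δ / K < 0.5) (j : Fin m) :
    WeightLaw (m * K) where
  P := (Measure.pi fun i : Fin m => bernoulliMeasure (1 : ℝ) 0 (pathMean K Δ hΔ j i)).map
    fun x e => x e.divNat
  prob := Measure.isProbabilityMeasure_map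
    (measurable_pi_lambda _ fun _ => measurable_pi_apply _).aemeasurable
  cube := by
    have hmeas : Measurable fun (x : Fin m → ℝ) (e : Fin (m * K)) => x e.divNat :=
      measurable_pi_lambda _ fun _ => measurable_pi_apply _
    refine (ae_map_iff hmeas.aemeasurable ?_).2 ?_
    · have : {w : Fin (m * K) → ℝ | ∀ e, w e ∈ Set.Icc (0 : ℝ) 1} =
          Set.univ.pi fun _ => Set.Icc (0 : ℝ) 1 := by
        ext; simp only [Set.mem_pi, Set.mem_univ, forall_const, Set.mem_ofPred_eq]
      rw [this]
      exact MeasurableSet.univ_pi fun _ => measurableSet_Icc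
    · have h : ∀ i : Fin m, ∀ᵐ x ∂(Measure.pi fun i : Fin m =>
          bernoulliMeasure (1 : ℝ) 0 (pathMean K Δ hΔ j i)), x i ∈ Set.Icc (0 : ℝ) 1 := by
        intro i
        have h1 : ∀ᵐ y ∂(bernoulliMeasure (1 : ℝ) 0 (pathMean K Δ hΔ j i)),
            y ∈ Set.Icc (0 : ℝ) 1 := by
          rw [ae_iff]
          change bernoulliMeasure (1 : ℝ) 0 (pathMean K Δ hΔ j i) (Set.Icc (0 : ℝ) 1)ᶜ = 0
          classical
          rw [bernoulliMeasure_apply _ measurableSet_Icc.compl]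
          simp
        exact (measurePreserving_eval _ i).quasiMeasurePreserving.ae h1
      filter_upwards [ae_all_iff.2 h] with x hx e using hx _

/-! ### A real RAM with oracle calls -/

/-- Real-valued expressions: rational constants, reading the entry of the array `a` whose index is
held by the register `i`, and the elementary operations. -/
inductive Expr where
  | const (q : ℚ)
  | read (a i : ℕ)
  | add (x y : Expr)
  | sub (x y : Expr)
  | mul (x y : Expr)
  | div (x y : Expr)
  | sqrt (x : Expr)
  | log (x : Expr)

/-- Programs: assigning the value of an expression to the entry of the array `a` whose index is held
by the register `i`, sequencing, branching on a comparison of two reals, a loop over all `L` items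
with the loop index in the register `i`, and a call of the offline oracle on the weights in the
array `src`, which writes the indicator vector of the answer to the array `dst`. -/
inductive Cmd where
  | skip
  | assign (a i : ℕ) (x : Expr)
  | seq (c d : Cmd)
  | ifLe (x y : Expr) (c d : Cmd)
  | forItems (i : ℕ) (c : Cmd)
  | callOracle (src dst : ℕ)

/-- The memory of the machine (real arrays and index registers), together with the number of
time units consumed and the number of oracle calls made so far. Programs can read neither of
the last two. -/
structure Machine where
  arr : ℕ → ℕ → ℝ
  reg : ℕ → ℕ
  time : ℕ
  calls : ℕ

/-- The blank machine. -/
def Machine.blank : Machine := ⟨fun _ _ => 0, fun _ => 0, 0, 0⟩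

/-- The value of an expression. -/
def Expr.eval (m : Machine) : Expr → ℝ
  | const q => (q : ℝ)
  | read a i => m.arr a (m.reg i)
  | add x y => x.eval m + y.eval m
  | sub x y => x.eval m - y.eval m
  | mul x y => x.eval m * y.eval m
  | div x y => x.eval m / y.eval m
  | sqrt x => Real.sqrt (x.eval m)
  | log x => Real.log (x.eval m)

/-- The time for evaluating an expression: one unit for each constant, read and operation. -/
def Expr.cost : Expr → ℕ
  | const _ => 1
  | read _ _ => 1
  | add x y => x.cost + y.cost + 1
  | sub x y => x.cost + y.cost + 1
  | mul x y => x.cost + y.cost + 1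
  | div x y => x.cost + y.cost + 1
  | sqrt x => x.cost + 1
  | log x => x.cost + 1

open Classical in
/-- Execution of a program for `L` items. The oracle is implemented by any subroutine that returns
`solve w` on input `w` in time `τ w`. An oracle call takes the running time `τ w` of the
subroutine, and `2 * L + 1` time units for passing the weights and the answer. -/
def exec {L : ℕ} (solve : (Fin L → ℝ) → Finset (Fin L)) (τ : (Fin L → ℝ) → ℕ) :
    Cmd → Machine → Machine
  | .skip, m => { m with time := m.time + 1 }
  | .assign a i x, m =>
      { m with
        arr := Function.update m.arr a (Function.update (m.arr a) (m.reg i) (x.eval m))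
        time := m.time + x.cost + 1 }
  | .seq c d, m => exec solve τ d (exec solve τ c m)
  | .ifLe x y c d, m =>
      let m' : Machine := { m with time := m.time + x.cost + y.cost + 1 }
      if x.eval m ≤ y.eval m then exec solve τ c m' else exec solve τ d m'
  | .forItems i c, m =>
      (List.range L).foldl
        (fun m' k => exec solve τ c
          { m' with reg := Function.update m'.reg i k, time := m'.time + 1 })
        { m with time := m.time + 1 }
  | .callOracle src dst, m =>
      let w : Fin L → ℝ := fun e => m.arr src e
      { m with
        arr := Function.update m.arr dst fun k =>
          if h : k < L then (if (⟨k, h⟩ : Fin L) ∈ solve w then 1 else 0) else m.arr dst k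
        time := m.time + τ w + 2 * L + 1
        calls := m.calls + 1 }

/-- An implementation of an online learning algorithm: `setup` is executed once; at each step
`select` is executed, which leaves the indicator vector of the chosen solution in array 0, then
the environment writes the observed weights of the chosen items to array 1, and then `update` is
executed. -/
structure Implementation where
  setup : Cmd
  select : Cmd
  update : Cmd

namespace Implementation

variable {L : ℕ}

open Classical in
/-- The solution whose indicator vector is stored in array 0. -/
def chosen (L : ℕ) (m : Machine) : Finset (Fin L) :=
  Finset.univ.filter fun e : Fin L => m.arr 0 e = 1

/-- The interaction with the environment, whose current weights are `w`: `L` time units for the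
output of the chosen solution and `L` time units for the input of the observed weights. -/
def observe (w : Fin L → ℝ) (m : Machine) : Machine :=
  { m with
    arr := Function.update m.arr 1 fun k =>
      if h : k < L then mask (chosen L m) w ⟨k, h⟩ else m.arr 1 k
    time := m.time + 2 * L }

/-- The machine after the setup and `t` steps, where `w 0, w 1, …` are the weights in the
successive steps. -/
def run (I : Implementation) (solve : (Fin L → ℝ) → Finset (Fin L)) (τ : (Fin L → ℝ) → ℕ)
    (w : ℕ → Fin L → ℝ) : ℕ → Machine
  | 0 => exec solve τ I.setup Machine.blank
  | t + 1 => exec solve τ I.update (observe (w t) (exec solve τ I.select (run I solve τ w t)))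

/-- The solution chosen by the implementation in step `t + 1`. -/
def actAt (I : Implementation) (solve : (Fin L → ℝ) → Finset (Fin L)) (τ : (Fin L → ℝ) → ℕ)
    (w : ℕ → Fin L → ℝ) (t : ℕ) : Finset (Fin L) :=
  chosen L (exec solve τ I.select (I.run solve τ w t))

end Implementation

/-- CombUCB1 is computationally efficient: there are an implementation and a polynomial `p`, the
same for all problems, such that the implementation makes exactly the choices of CombUCB1, calls
the oracle exactly once per step, and whenever the oracle needs time at most `q` on each
non-negative weight vector, needs time at most `p(L, K) + q` in each step (and at most `p(L, K)`
for the setup before the first step). -/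
def CombUCB1ComputationallyEfficient : Prop :=
  ∃ (I : Implementation) (p : MvPolynomial (Fin 2) ℕ),
    ∀ (L : ℕ) (Θ : Finset (Finset (Fin L))), Covers Θ →
    ∀ (O : Oracle Θ) (τ : (Fin L → ℝ) → ℕ) (q : ℕ), (∀ v, (∀ e, 0 ≤ v e) → τ v ≤ q) →
    ∀ w : ℕ → Fin L → ℝ, (∀ t e, w t e ∈ Set.Icc (0 : ℝ) 1) →
      (I.run O.solve τ w 0).calls = 0 ∧
      (I.run O.solve τ w 0).time ≤ MvPolynomial.eval ![L, maxSize Θ] p ∧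
      ∀ t : ℕ,
        I.actAt O.solve τ w t = (combUCB1 O).actAt (UCBState.first L) w t ∧
        (I.run O.solve τ w (t + 1)).calls = (I.run O.solve τ w t).calls + 1 ∧
        (I.run O.solve τ w (t + 1)).time ≤
          (I.run O.solve τ w t).time + (MvPolynomial.eval ![L, maxSize Θ] p + q)

end SemiBandit

end

open MeasureTheory ProbabilityTheory Filter Topology Asymptotics

noncomputable section

namespace SemiBandit

/-! Computation. An explicit program keeps the variables of CombUCB1 in arrays. Loop invariants show
that it simulates every step in time linear in `L` plus the time of one oracle call
(`RAM.step_spec`). The state invariants `UCBState.Valid` guarantee that the oracle is queried only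
at non-negative weights.

Upper bounds. While all averages lie within their confidence radii, optimism and the maximality of
the oracle bound the gap of the chosen `A` by `2 ∑ r / √T_e` over the items of `A \ A*`, where `r =
√(1.5 log n)` (`gap_le_of_good`). Doubling this bound and subtracting the gap once, with at most `K`
items in `A` and `Δ_{e,min} ≤ Δ_A`, gives `Δ_A ≤ ∑ (4 r / √T_e - Δ_{e,min} / K)`. After the
initialization an item meets each value of its counter at most once when it is chosen, so item `e`
contributes at most `∑_k max(0, 4 r / √k - d) ≤ (4 r)² / d` with `d = Δ_{e,min} / K`, that is, `24 K
log n / Δ_{e,min}`. Without the subtraction, `∑ 1/√k ≤ 2 √T_e` and Cauchy–Schwarz with `∑ (T_e - 1)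
≤ K n` give the gap-free bound (`sum_gap_good_le`). The initialization lasts at most `L` steps. An
exponential supermartingale bounds the probability that some radius fails after `t` steps by `2 L /
t²`, which sums to `π² L / 3`. Consistency follows, since the numbers of suboptimal choices are
bounded by the regret over the gap.

Lower bounds. The state of an arbitrary algorithm is extended by the number of choices of path `i`
and by the log-likelihood ratio for a change of the mean of path `i` from `p` to `q`. The two laws
of the extended state then have the density `exp l` (`trackLaw_eq_withDensity`), and the mean of `l`
under `p` is minus the divergence of the two Bernoulli laws times the expected number `T` of choices
of the path.

For the asymptotic bound, `q` makes path `i` optimal. A Bretagnolle–Huber inequality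
(`half_mul_exp_le_expectedPulls`) shows that a consistent algorithm must choose path `i` at least `c
log n` times for each `c < 1 / (4 (Δ/K)²)`, since otherwise it errs polynomially often under `p` or
`q`. Summing over the `m - 1` suboptimal paths gives `(L - K) K / (4 Δ)`. The upper bound on the
same problem is `534 K (L - K) / Δ`, larger by the factor 2136.

For the gap-free bound, all paths have mean `1/2 - δ` under the reference law, and raising path `j`
to `1/2` changes its expected number of choices by a Pinsker estimate (`expectedPulls_le_add`).
Averaging over `j`, with `δ` of order `√(m/n)`, leaves a constant fraction of the steps wrong
(`sum_regret_pathLaw_ge`). -/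

/-! ### Recursive sequences driven by i.i.d. noise -/

section Chain

variable {X Ω : Type*} [MeasurableSpace X] [MeasurableSpace Ω]

/-- The sequence `x, step x (w 0), step (step x (w 0)) (w 1), …`. -/
def chain (step : X → Ω → X) (x : X) (w : ℕ → Ω) : ℕ → X
  | 0 => x
  | t + 1 => step (chain step x w t) (w t)

/-- The law of the `t`-th member of the sequence, when the first member has the law `ν` and the
noise is i.i.d. with the law `P`. -/
def chainLaw (step : X → Ω → X) (P : Measure Ω) (ν : Measure X) : ℕ → Measure X
  | 0 => ν
  | t + 1 => ((chainLaw step P ν t).prod P).map (Function.uncurry step)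

variable {step : X → Ω → X} {P : Measure Ω} {ν : Measure X}

theorem isProbabilityMeasure_chainLaw [IsProbabilityMeasure P] [IsProbabilityMeasure ν]
    (hs : Measurable (Function.uncurry step)) (t : ℕ) :
    IsProbabilityMeasure (chainLaw step P ν t) := by
  induction t with
  | zero => assumption
  | succ t ih => exact Measure.isProbabilityMeasure_map hs.aemeasurable

/-- The inverse map, which puts a coordinate in front of a sequence, pulls finite-dimensional boxes
back to boxes, and these determine the infinite product measure. -/
theorem measurePreserving_uncons [IsProbabilityMeasure P] :
    MeasurePreserving (fun w : ℕ → Ω => (w 0, fun k => w (k + 1)))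
      (Measure.infinitePi fun _ => P) (P.prod (Measure.infinitePi fun _ => P)) := by
  have hm : Measurable fun w : ℕ → Ω => (w 0, fun k => w (k + 1)) := by fun_prop
  refine ⟨hm, ?_⟩
  let c : Ω × (ℕ → Ω) → ℕ → Ω := fun x k => Nat.casesOn k x.1 x.2
  have hc : Measurable c := measurable_pi_lambda _ fun k => by
    cases k with
    | zero => exact measurable_fst
    | succ k => exact (measurable_pi_apply k).comp measurable_snd
  have key : (P.prod (Measure.infinitePi fun _ : ℕ => P)).map c = Measure.infinitePi fun _ => P := by
    refine Measure.eq_infinitePi _ fun s t ht => ?_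
    rw [Measure.map_apply hc (MeasurableSet.pi s.countable_toSet fun i _ => ht i)]
    -- Every `k` with `k + 1 ∈ s` lies below `s.sup id`, so this range contains all constrained
    -- coordinates of the tail.
    let s' : Finset ℕ := Finset.range (s.sup id)
    classical
    have hset : c ⁻¹' (Set.pi s t) = (if 0 ∈ s then t 0 else Set.univ) ×ˢ
        Set.pi (s' : Set ℕ) (fun k => if k + 1 ∈ s then t (k + 1) else Set.univ) := by
      ext ⟨x, w⟩
      simp only [Set.mem_preimage, Set.mem_pi, Set.mem_prod, Finset.mem_coe]
      constructor
      · intro h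
        refine ⟨?_, fun k _ => ?_⟩
        · split_ifs with h0
          · exact h 0 h0
          · trivial
        · split_ifs with h0
          · exact h _ h0
          · trivial
      · rintro ⟨h1, h2⟩ k hk
        cases k with
        | zero => rw [if_pos hk] at h1; exact h1
        | succ k =>
          have : k ∈ s' := Finset.mem_range.2 (Finset.le_sup (f := id) hk)
          simpa [hk] using h2 k this
    have hms : ∀ k, MeasurableSet (if k + 1 ∈ s then t (k + 1) else Set.univ) := fun k => by
      split_ifs
      · exact ht _
      · exact MeasurableSet.univ
    have h01 : P (if 0 ∈ s then t 0 else Set.univ) = if 0 ∈ s then P (t 0) else 1 := by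
      split_ifs <;> simp
    have h02 : ∀ k, P (if k + 1 ∈ s then t (k + 1) else Set.univ) =
        if k + 1 ∈ s then P (t (k + 1)) else 1 := fun k => by
      split_ifs <;> simp
    rw [hset, Measure.prod_prod, Measure.infinitePi_pi _ (fun i _ => hms i), h01]
    simp_rw [h02]
    have hsub : s ⊆ Finset.range (s.sup id + 1) := fun k hk =>
      Finset.mem_range.2 (Nat.lt_succ_of_le (Finset.le_sup (f := id) hk))
    calc _ = ∏ k ∈ Finset.range (s.sup id + 1), if k ∈ s then P (t k) else 1 := by
          rw [Finset.prod_range_succ', mul_comm]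
      _ = _ := by
          rw [← Finset.prod_filter, Finset.filter_mem_eq_inter, Finset.inter_eq_right.2 hsub]
  have hid : (fun w : ℕ → Ω => (w 0, fun k => w (k + 1))) ∘ c = id := by
    ext x <;> rfl
  conv_lhs => rw [← key]
  rw [Measure.map_map hm hc, hid, Measure.map_id]

/-- Each step consumes one coordinate of the noise, so the current state is independent of the
unused noise, which is again i.i.d. This independence replaces filtrations and conditional
expectations throughout. -/
theorem measurePreserving_chain [IsProbabilityMeasure P] [IsProbabilityMeasure ν]
    (hs : Measurable (Function.uncurry step)) (t : ℕ) :
    MeasurePreserving (fun x : X × (ℕ → Ω) => (chain step x.1 x.2 t, fun k => x.2 (t + k)))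
      (ν.prod (Measure.infinitePi fun _ => P))
      ((chainLaw step P ν t).prod (Measure.infinitePi fun _ => P)) := by
  induction t with
  | zero =>
    simp only [chain, chainLaw, zero_add]
    exact MeasurePreserving.id _
  | succ t ih =>
    have := isProbabilityMeasure_chainLaw (P := P) (ν := ν) hs t
    have h1 : MeasurePreserving (fun x : X × (ℕ → Ω) => ((x.1, x.2 0), fun k => x.2 (k + 1)))
        ((chainLaw step P ν t).prod (Measure.infinitePi fun _ => P))
        (((chainLaw step P ν t).prod P).prod (Measure.infinitePi fun _ => P)) := by
      have h := ((MeasurePreserving.id (chainLaw step P ν t)).prod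
        (measurePreserving_uncons (P := P)))
      exact (measurePreserving_prodAssoc (chainLaw step P ν t) P
        (Measure.infinitePi fun _ : ℕ => P)).symm.comp h
    have h2 : MeasurePreserving (Function.uncurry step) ((chainLaw step P ν t).prod P)
        (chainLaw step P ν (t + 1)) := ⟨hs, rfl⟩
    have h3 := (h2.prod (MeasurePreserving.id (Measure.infinitePi fun _ : ℕ => P))).comp
      (h1.comp ih)
    convert h3 using 2
    ext x
    · rfl
    · simp [Prod.map, Nat.add_assoc, Nat.add_comm 1]

theorem measurePreserving_chain_pair [IsProbabilityMeasure P] [IsProbabilityMeasure ν]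
    (hs : Measurable (Function.uncurry step)) (t : ℕ) :
    MeasurePreserving (fun x : X × (ℕ → Ω) => (chain step x.1 x.2 t, x.2 t))
      (ν.prod (Measure.infinitePi fun _ => P)) ((chainLaw step P ν t).prod P) := by
  have := isProbabilityMeasure_chainLaw (P := P) (ν := ν) hs t
  exact ((MeasurePreserving.id (chainLaw step P ν t)).prod
    (measurePreserving_eval_infinitePi (fun _ : ℕ => P) 0)).comp (measurePreserving_chain hs t)

theorem measurePreserving_chain_fst [IsProbabilityMeasure P] [IsProbabilityMeasure ν]
    (hs : Measurable (Function.uncurry step)) (t : ℕ) :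
    MeasurePreserving (fun x : X × (ℕ → Ω) => chain step x.1 x.2 t)
      (ν.prod (Measure.infinitePi fun _ => P)) (chainLaw step P ν t) := by
  have := isProbabilityMeasure_chainLaw (P := P) (ν := ν) hs t
  exact measurePreserving_fst.comp (measurePreserving_chain_pair hs t)

theorem lintegral_chainLaw_succ [SFinite P] {f : X → ENNReal} (hf : Measurable f)
    (hs : Measurable (Function.uncurry step)) (t : ℕ) :
    ∫⁻ x, f x ∂(chainLaw step P ν (t + 1)) =
      ∫⁻ x, ∫⁻ w, f (step x w) ∂P ∂(chainLaw step P ν t) := by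
  rw [chainLaw, lintegral_map hf hs, lintegral_prod]
  · rfl
  · exact (hf.comp hs).aemeasurable

/-- A property that holds initially and is preserved almost surely holds almost surely forever. -/
theorem ae_chainLaw [SFinite P] {p : ℕ → X → Prop}
    (hp : ∀ t, MeasurableSet {x | p t x}) (hs : Measurable (Function.uncurry step))
    (h0 : ∀ᵐ x ∂ν, p 0 x) (h1 : ∀ t x, p t x → ∀ᵐ w ∂P, p (t + 1) (step x w)) (t : ℕ) :
    ∀ᵐ x ∂(chainLaw step P ν t), p t x := by
  induction t with
  | zero => exact h0
  | succ t ih =>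
    rw [chainLaw, ae_map_iff hs.aemeasurable (hp _)]
    rw [Measure.ae_prod_iff_ae_ae]
    · filter_upwards [ih] with x hx using h1 t x hx
    · exact hs (hp _)

end Chain

/-! ### Laws of the states of an algorithm -/

theorem measurable_mask_act {L : ℕ} {X : Type*} [MeasurableSpace X] {A : X → Finset (Fin L)}
    (hA : Measurable A) : Measurable fun x : X × (Fin L → ℝ) => mask (A x.1) x.2 := by
  classical
  refine measurable_pi_lambda _ fun e => ?_
  unfold mask
  exact Measurable.ite ((measurableSet_mem_finset e).preimage (hA.comp measurable_fst))
    ((measurable_pi_apply e).comp measurable_snd) measurable_const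

/-! ### Means of the weights and of the returns. -/

namespace WeightLaw

variable {L : ℕ} (B : WeightLaw L)

theorem ae_mem_Icc (e : Fin L) : ∀ᵐ w ∂B.P, w e ∈ Set.Icc (0 : ℝ) 1 := by
  filter_upwards [B.cube] with w hw using hw e

theorem integrable_eval (e : Fin L) : Integrable (fun w : Fin L → ℝ => w e) B.P :=
  Integrable.of_mem_Icc 0 1 (measurable_pi_apply e).aemeasurable (B.ae_mem_Icc e)

theorem mean_mem_Icc (e : Fin L) : B.mean e ∈ Set.Icc (0 : ℝ) 1 := by
  constructor
  · exact integral_nonneg_of_ae ((B.ae_mem_Icc e).mono fun w hw => hw.1)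
  · have := integral_mono_ae (B.integrable_eval e) (integrable_const (1 : ℝ))
      ((B.ae_mem_Icc e).mono fun w hw => hw.2)
    simpa [WeightLaw.mean] using this

theorem integrable_ret (A : Finset (Fin L)) : Integrable (ret A) B.P :=
  integrable_finsetSum _ fun e _ => B.integrable_eval e

theorem integral_ret (A : Finset (Fin L)) : ∫ w, ret A w ∂B.P = ret A B.mean :=
  integral_finsetSum _ fun e _ => B.integrable_eval e

end WeightLaw

/-! ### Elementary bounds on the gaps. -/

section Gap

variable {L : ℕ} {Θ : Finset (Finset (Fin L))} {B : WeightLaw L} {Astar : Finset (Fin L)}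

theorem card_le_maxSize {A : Finset (Fin L)} (hA : A ∈ Θ) : A.card ≤ maxSize Θ :=
  Finset.le_sup hA

theorem ret_mean_nonneg (B : WeightLaw L) (A : Finset (Fin L)) : 0 ≤ ret A B.mean :=
  Finset.sum_nonneg fun e _ => (B.mean_mem_Icc e).1

theorem ret_mean_le (B : WeightLaw L) {A : Finset (Fin L)} (hA : A ∈ Θ) :
    ret A B.mean ≤ maxSize Θ := by
  calc ret A B.mean ≤ ∑ e ∈ A, (1 : ℝ) := Finset.sum_le_sum fun e _ => (B.mean_mem_Icc e).2
    _ = A.card := by simp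
    _ ≤ maxSize Θ := by exact_mod_cast card_le_maxSize hA

theorem gap_le_maxSize (h : IsOptimal Θ B Astar) (A : Finset (Fin L)) :
    gap B Astar A ≤ maxSize Θ := by
  have := ret_mean_le B h.1
  have := ret_mean_nonneg B A
  unfold gap; linarith

theorem gap_self (B : WeightLaw L) (A : Finset (Fin L)) : gap B A A = 0 := sub_self _

theorem gap_pos (h : IsOptimal Θ B Astar) {A : Finset (Fin L)} (hA : A ∈ Θ) (hne : A ≠ Astar) :
    0 < gap B Astar A := sub_pos.2 (h.2 A hA hne)

theorem gap_nonneg (h : IsOptimal Θ B Astar) {A : Finset (Fin L)} (hA : A ∈ Θ) :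
    0 ≤ gap B Astar A := by
  by_cases hne : A = Astar
  · rw [hne, gap_self]
  · exact (gap_pos h hA hne).le

end Gap

namespace Algorithm

variable {L : ℕ} {Θ : Finset (Finset (Fin L))} (π : Algorithm Θ) (B : WeightLaw L)

/-- One step of the algorithm under the weights `w`. -/
def step (s : π.State) (w : Fin L → ℝ) : π.State := π.next s (mask (π.act s) w)

theorem measurable_step : Measurable (Function.uncurry π.step) :=
  π.next_meas.comp (measurable_fst.prodMk (measurable_mask_act π.act_meas))

theorem stateAt_eq_chain (s : π.State) (w : ℕ → Fin L → ℝ) (t : ℕ) :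
    π.stateAt s w t = chain π.step s w t := by
  induction t with
  | zero => rfl
  | succ t ih => simp only [stateAt, chain, step, ih]

/-- The law of the state after `t` steps. -/
def stateLaw (t : ℕ) : Measure π.State := chainLaw π.step B.P π.start t

instance (t : ℕ) : IsProbabilityMeasure (π.stateLaw B t) :=
  isProbabilityMeasure_chainLaw π.measurable_step t

theorem measurePreserving_stateAt_pair (t : ℕ) :
    MeasurePreserving (fun x : π.State × (ℕ → Fin L → ℝ) => (π.stateAt x.1 x.2 t, x.2 t))
      (π.law B) ((π.stateLaw B t).prod B.P) := by
  simp_rw [stateAt_eq_chain]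
  exact measurePreserving_chain_pair π.measurable_step t

theorem measurePreserving_stateAt (t : ℕ) :
    MeasurePreserving (fun x : π.State × (ℕ → Fin L → ℝ) => π.stateAt x.1 x.2 t)
      (π.law B) (π.stateLaw B t) := by
  simp_rw [stateAt_eq_chain]
  exact measurePreserving_chain_fst π.measurable_step t

theorem measurable_comp_act {Y : Type*} [MeasurableSpace Y] (g : Finset (Fin L) → Y) :
    Measurable fun s => g (π.act s) := (Measurable.of_discrete (f := g)).comp π.act_meas

theorem integrable_comp_act (μ : Measure π.State) [IsFiniteMeasure μ] (g : Finset (Fin L) → ℝ) :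
    Integrable (fun s => g (π.act s)) μ := by
  refine Integrable.of_bound (π.measurable_comp_act g).aestronglyMeasurable
    (∑ A, ‖g A‖) (ae_of_all _ fun s => ?_)
  exact Finset.single_le_sum (f := fun A => ‖g A‖) (fun _ _ => norm_nonneg _) (Finset.mem_univ _)

theorem measurable_ret_act :
    Measurable fun x : π.State × (Fin L → ℝ) => ret (π.act x.1) x.2 := by
  classical
  have : (fun x : π.State × (Fin L → ℝ) => ret (π.act x.1) x.2) =
      fun x => ∑ e, mask (π.act x.1) x.2 e := by
    ext x; simp [ret, mask]
  rw [this]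
  exact Finset.measurable_sum _ fun e _ =>
    (measurable_pi_apply e).comp (measurable_mask_act π.act_meas)

theorem integrable_ret_sub (Astar : Finset (Fin L)) (t : ℕ) :
    Integrable (fun x : π.State × (Fin L → ℝ) => ret Astar x.2 - ret (π.act x.1) x.2)
      ((π.stateLaw B t).prod B.P) := by
  have hbound : ∀ A : Finset (Fin L), ∀ w : Fin L → ℝ, (∀ e, w e ∈ Set.Icc (0 : ℝ) 1) →
      0 ≤ ret A w ∧ ret A w ≤ L := by
    intro A w hw
    refine ⟨Finset.sum_nonneg fun e _ => (hw e).1, ?_⟩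
    calc ret A w ≤ ∑ e ∈ A, (1 : ℝ) := Finset.sum_le_sum fun e _ => (hw e).2
      _ = A.card := by simp
      _ ≤ L := by exact_mod_cast (Finset.card_le_univ A).trans_eq (Fintype.card_fin L)
  refine Integrable.of_bound (Measurable.aestronglyMeasurable ?_) (L : ℝ) ?_
  · exact (((Finset.measurable_sum _ fun e _ => measurable_pi_apply e : Measurable (ret Astar))
      |>.comp measurable_snd)).sub π.measurable_ret_act
  · filter_upwards [Measure.quasiMeasurePreserving_snd.ae B.cube] with x hx
    have h1 := hbound Astar x.2 hx
    have h2 := hbound (π.act x.1) x.2 hx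
    rw [Real.norm_eq_abs, abs_le]
    constructor <;> linarith

/-- The state before a step is independent of the weights of that step, so integrating out these
weights first turns the instantaneous regret into a gap. -/
theorem regret_eq (Astar : Finset (Fin L)) (n : ℕ) :
    π.regret B Astar n =
      ∑ t ∈ Finset.range n, ∫ s, gap B Astar (π.act s) ∂(π.stateLaw B t) := by
  have hmp := fun t => π.measurePreserving_stateAt_pair B t
  have hint : ∀ t, Integrable (fun x : π.State × (ℕ → Fin L → ℝ) =>
      ret Astar (x.2 t) - ret (π.actAt x.1 x.2 t) (x.2 t)) (π.law B) := fun t =>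
    (hmp t).integrable_comp_of_integrable (π.integrable_ret_sub B Astar t)
  unfold regret
  rw [integral_finsetSum _ fun t _ => hint t]
  refine Finset.sum_congr rfl fun t _ => ?_
  have h1 := integral_map (μ := π.law B) (hmp t).measurable.aemeasurable
    (f := fun x : π.State × (Fin L → ℝ) => ret Astar x.2 - ret (π.act x.1) x.2)
    (by rw [(hmp t).map_eq]; exact (π.integrable_ret_sub B Astar t).aestronglyMeasurable)
  rw [(hmp t).map_eq, integral_prod _ (π.integrable_ret_sub B Astar t)] at h1
  refine h1.symm.trans (integral_congr_ae (ae_of_all _ fun s => ?_))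
  simp only
  rw [integral_sub (B.integrable_ret _) (B.integrable_ret _), B.integral_ret, B.integral_ret, gap]

open Classical in
theorem expectedPulls_eq (A : Finset (Fin L)) (n : ℕ) :
    π.expectedPulls B A n =
      ∑ t ∈ Finset.range n, ∫ s, (if π.act s = A then 1 else 0 : ℝ) ∂(π.stateLaw B t) := by
  have hint := fun t => π.integrable_comp_act (π.stateLaw B t) fun A' => if A' = A then 1 else 0
  have hmp := fun t => π.measurePreserving_stateAt B t
  unfold expectedPulls
  have : ∀ x : π.State × (ℕ → Fin L → ℝ),
      (((Finset.range n).filter fun t => π.actAt x.1 x.2 t = A).card : ℝ) =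
        ∑ t ∈ Finset.range n, if π.act (π.stateAt x.1 x.2 t) = A then 1 else 0 := fun x => by
    rw [Finset.sum_boole]
    congr!
  simp_rw [this]
  have hint' : ∀ t, Integrable (fun x : π.State × (ℕ → Fin L → ℝ) =>
      if π.act (π.stateAt x.1 x.2 t) = A then (1 : ℝ) else 0) (π.law B) := fun t =>
    (hmp t).integrable_comp_of_integrable (hint t)
  rw [integral_finsetSum _ fun t _ => hint' t]
  refine Finset.sum_congr rfl fun t _ => ?_
  have h1 := integral_map (μ := π.law B) (hmp t).measurable.aemeasurable
    (f := fun s : π.State => if π.act s = A then (1 : ℝ) else 0)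
    (by rw [(hmp t).map_eq]; exact (hint t).aestronglyMeasurable)
  rw [(hmp t).map_eq] at h1
  exact h1.symm

variable {B}

open Classical in
theorem regret_eq_sum_pulls (Astar : Finset (Fin L)) (n : ℕ) :
    π.regret B Astar n = ∑ A ∈ Θ, gap B Astar A * π.expectedPulls B A n := by
  simp_rw [regret_eq, expectedPulls_eq, Finset.mul_sum]
  rw [Finset.sum_comm]
  refine Finset.sum_congr rfl fun t _ => ?_
  simp_rw [← integral_const_mul]
  rw [← integral_finsetSum _ fun A _ => (π.integrable_comp_act (π.stateLaw B t)
    fun A' => gap B Astar A * if A' = A then 1 else 0)]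
  refine integral_congr_ae (ae_of_all _ fun s => ?_)
  simp [π.act_mem s]

theorem expectedPulls_nonneg (A : Finset (Fin L)) (n : ℕ) : 0 ≤ π.expectedPulls B A n :=
  integral_nonneg fun _ => Nat.cast_nonneg _

theorem gap_mul_expectedPulls_le_regret {Astar A : Finset (Fin L)} (h : IsOptimal Θ B Astar)
    (hA : A ∈ Θ) (n : ℕ) : gap B Astar A * π.expectedPulls B A n ≤ π.regret B Astar n := by
  rw [regret_eq_sum_pulls]
  exact Finset.single_le_sum (f := fun A => gap B Astar A * π.expectedPulls B A n)
    (fun A hA => mul_nonneg (gap_nonneg h hA) (π.expectedPulls_nonneg A n)) hA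

end Algorithm

/-! ### An implementation of CombUCB1 on the real RAM -/

section RAM

variable {L : ℕ} {solve : (Fin L → ℝ) → Finset (Fin L)} {τ : (Fin L → ℝ) → ℕ}

theorem exec_forItems_induction (I : ℕ → Machine → Prop) {i : ℕ} {c : Cmd} {m : Machine}
    (h0 : I 0 { m with time := m.time + 1 })
    (h1 : ∀ k < L, ∀ m', I k m' → I (k + 1) (exec solve τ c
      { m' with reg := Function.update m'.reg i k, time := m'.time + 1 })) :
    I L (exec solve τ (.forItems i c) m) := by
  have key : ∀ k ≤ L, I k ((List.range k).foldl
      (fun m' k => exec solve τ c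
          { m' with reg := Function.update m'.reg i k, time := m'.time + 1 })
        { m with time := m.time + 1 }) := by
    intro k
    induction k with
    | zero => exact fun _ => h0
    | succ k ih =>
      intro hk
      rw [List.range_succ, List.foldl_append]
      exact h1 k hk _ (ih (Nat.le_of_succ_le hk))
  exact key L le_rfl

namespace RAM

/-- The upper confidence bound of the item with the index in register 0. -/
def ucbExpr : Expr :=
  .add (.read 4 0) (.sqrt (.div (.mul (.const (3 / 2)) (.log (.sub (.read 6 1) (.const 1))))
    (.read 3 0)))

/-- Only loops change registers and all loops use register 0, so register 1 keeps its initial value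
zero and addresses the scalars in the arrays 6 and 7. The averages in array 4 need no initialization
on the blank machine. -/
def setup : Cmd :=
  .seq (.forItems 0 (.seq (.assign 2 0 (.const 1)) (.assign 3 0 (.const 1))))
    (.assign 6 1 (.const 1))

/-- Stores in array 7 whether the initialization phase lasts. -/
def flagLoop : Cmd := .forItems 0 (.ifLe (.const 1) (.read 2 0) (.assign 7 1 (.const 1)) .skip)

def select : Cmd :=
  .seq (.assign 7 1 (.const 0)) (.seq flagLoop (.seq
    (.ifLe (.const 1) (.read 7 1) (.forItems 0 (.assign 5 0 (.read 2 0)))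
      (.forItems 0 (.assign 5 0 ucbExpr)))
    (.callOracle 5 0)))

def initLoop : Cmd :=
  .forItems 0 (.ifLe (.const 1) (.read 0 0)
    (.seq (.assign 2 0 (.const 0)) (.assign 4 0 (.read 1 0))) .skip)

/-- The average is assigned before the counter because its new value refers to the old counter. -/
def mainLoop : Cmd :=
  .forItems 0 (.ifLe (.const 1) (.read 0 0)
    (.seq (.assign 4 0 (.div (.add (.mul (.read 3 0) (.read 4 0)) (.read 1 0))
        (.add (.read 3 0) (.const 1))))
      (.assign 3 0 (.add (.read 3 0) (.const 1)))) .skip)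

def update : Cmd :=
  .seq (.assign 6 1 (.add (.read 6 1) (.const 1))) (.ifLe (.const 1) (.read 7 1) initLoop mainLoop)

/-- The implementation: array 2 holds the auxiliary weights, array 3 the counters, array 4 the
averages, array 5 the query to the oracle, and the entries 0 of the arrays 6 and 7 hold the index of
the step and the flag of the initialization phase. -/
def impl : Implementation := ⟨setup, select, update⟩

/-- The machine holds the variables of CombUCB1. -/
structure Represents (m : Machine) (s : UCBState L) : Prop where
  reg : m.reg 1 = 0
  u : ∀ e : Fin L, m.arr 2 e = s.u e
  T : ∀ e : Fin L, m.arr 3 e = s.T e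
  avg : ∀ e : Fin L, m.arr 4 e = s.avg e
  time : m.arr 6 0 = s.time

theorem setup_spec : Represents (exec solve τ setup Machine.blank) (UCBState.first L) ∧
    (exec solve τ setup Machine.blank).calls = 0 ∧
    (exec solve τ setup Machine.blank).time ≤ 5 * L + 3 := by
  have h := exec_forItems_induction (L := L) (solve := solve) (τ := τ)
    (fun k m => m.reg 1 = 0 ∧ (∀ e < k, m.arr 2 e = 1 ∧ m.arr 3 e = 1) ∧
      (∀ e, m.arr 4 e = 0) ∧ m.calls = 0 ∧ m.time ≤ 5 * k + 1) (i := 0)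
    (c := .seq (.assign 2 0 (.const 1)) (.assign 3 0 (.const 1))) (m := Machine.blank)
    (by simp [Machine.blank])
    (by
      rintro k hk m ⟨h1, h2, h3, h4, h5⟩
      refine ⟨by simp [exec, h1], fun e he => ?_, by simp [exec, h3], by simp [exec, h4], ?_⟩
      · by_cases hek : e = k
        · simp [exec, hek, Expr.eval]
        · have := h2 e (by omega)
          simp [exec, hek, Expr.eval, this]
      · simp [exec, Expr.cost]; omega)
  set m1 := exec solve τ (.forItems 0 (.seq (.assign 2 0 (.const 1)) (.assign 3 0 (.const 1))))
    Machine.blank with hm1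
  have hfin : exec solve τ setup Machine.blank = exec solve τ (.assign 6 1 (.const 1)) m1 := rfl
  rw [hfin]
  clear_value m1
  obtain ⟨h1, h2, h3, h4, h5⟩ := h
  refine ⟨⟨?_, fun e => ?_, fun e => ?_, fun e => ?_, ?_⟩, ?_, ?_⟩
  · simpa [exec] using h1
  · simpa [exec, UCBState.first] using (h2 e e.2).1
  · simpa [exec, UCBState.first] using (h2 e e.2).2
  · simpa [exec, UCBState.first] using h3 e
  · simp [exec, UCBState.first, Expr.eval, h1]
  · simpa [exec] using h4
  · simp only [exec, Expr.cost] at h5 ⊢; omega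

theorem flagLoop_spec {m : Machine} (hreg : m.reg 1 = 0) (h7 : m.arr 7 0 = 0) :
    (exec solve τ flagLoop m).reg 1 = 0 ∧
    (∀ a, a ≠ 7 → (exec solve τ flagLoop m).arr a = m.arr a) ∧
    ((exec solve τ flagLoop m).arr 7 0 = 1 ∧ (∃ e : Fin L, 1 ≤ m.arr 2 e) ∨
      (exec solve τ flagLoop m).arr 7 0 = 0 ∧ ¬ (∃ e : Fin L, 1 ≤ m.arr 2 e)) ∧
    (exec solve τ flagLoop m).calls = m.calls ∧
    (exec solve τ flagLoop m).time ≤ m.time + (6 * L + 1) := by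
  have h := exec_forItems_induction (L := L) (solve := solve) (τ := τ)
    (fun k m' => m'.reg 1 = 0 ∧ (∀ a, a ≠ 7 → m'.arr a = m.arr a) ∧
      (m'.arr 7 0 = 1 ∧ (∃ e < k, 1 ≤ m.arr 2 e) ∨
        m'.arr 7 0 = 0 ∧ ¬ (∃ e < k, 1 ≤ m.arr 2 e)) ∧
      m'.calls = m.calls ∧ m'.time ≤ m.time + (6 * k + 1)) (i := 0)
    (c := .ifLe (.const 1) (.read 2 0) (.assign 7 1 (.const 1)) .skip) (m := m)
    (by simp [hreg, h7])
    (by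
      rintro k hk m' ⟨h1, h2, h3, h4, h5⟩
      have h2' := h2 2 (by norm_num)
      by_cases hle : 1 ≤ m.arr 2 k
      · simp only [exec, Expr.eval, Expr.cost, Function.update_self, h2', Rat.cast_one, hle,
          if_true]
        refine ⟨by simp [h1], fun a ha => by simp [ha, h2 a ha], Or.inl ⟨by simp [h1], k, ?_⟩,
          h4, by omega⟩
        exact ⟨Nat.lt_succ_self k, hle⟩
      · simp only [exec, Expr.eval, Expr.cost, Function.update_self, h2', Rat.cast_one, hle,
          if_false]
        refine ⟨by simp [h1], h2, ?_, h4, by omega⟩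
        have : (∃ e < k + 1, 1 ≤ m.arr 2 e) ↔ ∃ e < k, 1 ≤ m.arr 2 e := by
          constructor
          · rintro ⟨e, he, he'⟩
            rcases Nat.lt_succ_iff_lt_or_eq.1 he with h | h
            · exact ⟨e, h, he'⟩
            · exact absurd (h ▸ he') hle
          · rintro ⟨e, he, he'⟩
            exact ⟨e, by omega, he'⟩
        rw [this]; exact h3)
  obtain ⟨h1, h2, h3, h4, h5⟩ := h
  have hex : (∃ e < L, 1 ≤ m.arr 2 e) ↔ ∃ e : Fin L, 1 ≤ m.arr 2 e :=
    ⟨fun ⟨e, he, h⟩ => ⟨⟨e, he⟩, h⟩, fun ⟨e, h⟩ => ⟨e, e.2, h⟩⟩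
  rw [hex] at h3
  exact ⟨h1, h2, h3, h4, h5⟩

theorem assignLoop_spec {m : Machine} (hreg : m.reg 1 = 0) (x : Expr) (v : ℕ → ℝ)
    (hx : ∀ k < L, ∀ m' : Machine, m'.reg 0 = k → m'.reg 1 = 0 →
      (∀ a, a ≠ 5 → m'.arr a = m.arr a) → x.eval m' = v k) :
    (exec solve τ (.forItems 0 (.assign 5 0 x)) m).reg 1 = 0 ∧
    (∀ a, a ≠ 5 → (exec solve τ (.forItems 0 (.assign 5 0 x)) m).arr a = m.arr a) ∧
    (∀ e < L, (exec solve τ (.forItems 0 (.assign 5 0 x)) m).arr 5 e = v e) ∧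
    (exec solve τ (.forItems 0 (.assign 5 0 x)) m).calls = m.calls ∧
    (exec solve τ (.forItems 0 (.assign 5 0 x)) m).time ≤ m.time + ((x.cost + 2) * L + 1) := by
  refine exec_forItems_induction (L := L) (solve := solve) (τ := τ)
    (fun k m' => m'.reg 1 = 0 ∧ (∀ a, a ≠ 5 → m'.arr a = m.arr a) ∧
      (∀ e < k, m'.arr 5 e = v e) ∧
      m'.calls = m.calls ∧ m'.time ≤ m.time + ((x.cost + 2) * k + 1)) ?_ ?_
  · simp [hreg]
  · rintro k hk m' ⟨h1, h2, h3, h4, h5⟩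
    have hv := hx k hk
      { m' with reg := Function.update m'.reg 0 k, time := m'.time + 1 } (by simp) (by simp [h1])
      (fun a ha => h2 a ha)
    simp only [exec, Function.update_self, hv]
    refine ⟨by simp [h1], fun a ha => by simp [ha, h2 a ha], fun e he => ?_, h4, ?_⟩
    · by_cases hek : e = k
      · simp [hek]
      · rw [Function.update_of_ne hek]; exact h3 e (by omega)
    · rw [mul_add]; omega

theorem select_spec {m : Machine} {s : UCBState L} (hr : Represents m s)
    (hu : ∀ e, s.u e = 0 ∨ s.u e = 1) :
    Represents (exec solve τ select m) s ∧
    ((exec solve τ select m).arr 7 0 = 1 ∧ s.Initializing ∨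
      (exec solve τ select m).arr 7 0 = 0 ∧ ¬ s.Initializing) ∧
    (∀ e : Fin L, e ∈ solve s.query ∧ (exec solve τ select m).arr 0 e = 1 ∨
      e ∉ solve s.query ∧ (exec solve τ select m).arr 0 e = 0) ∧
    (exec solve τ select m).calls = m.calls + 1 ∧
    (exec solve τ select m).time ≤ m.time + (30 * L + 10 + τ s.query) := by
  obtain ⟨hreg, h2, h3, h4, h6⟩ := hr
  set m1 := exec solve τ (.assign 7 1 (.const 0)) m with hm1
  have a1 : ∀ a, a ≠ 7 → m1.arr a = m.arr a := fun a ha => by simp [hm1, exec, ha]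
  have r1 : m1.reg 1 = 0 := by simp [hm1, exec, hreg]
  have f1 : m1.arr 7 0 = 0 := by simp [hm1, exec, hreg, Expr.eval]
  have t1 : m1.time = m.time + 2 := by simp [hm1, exec, Expr.cost]
  have c1 : m1.calls = m.calls := by simp [hm1, exec]
  obtain ⟨r2, a2, f2, c2, t2⟩ := flagLoop_spec (solve := solve) (τ := τ) r1 f1
  set m2 := exec solve τ flagLoop m1 with hm2
  -- The machine compares only by `≤`. Since the auxiliary weights are zero or one, `1 ≤ u` tests `u
  -- = 1`.
  have hini : (∃ e : Fin L, 1 ≤ m1.arr 2 e) ↔ s.Initializing := by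
    unfold UCBState.Initializing
    refine exists_congr fun e => ?_
    rw [a1 2 (by norm_num), h2]
    rcases hu e with h | h <;> simp [h]
  rw [hini] at f2
  have harr : ∀ a, a ≠ 7 → m2.arr a = m.arr a := fun a ha => (a2 a ha).trans (a1 a ha)
  set m3 := exec solve τ (.ifLe (.const 1) (.read 7 1) (.forItems 0 (.assign 5 0 (.read 2 0)))
      (.forItems 0 (.assign 5 0 ucbExpr))) m2 with hm3
  have key : m3.reg 1 = 0 ∧ (∀ a, a ≠ 5 → m3.arr a = m2.arr a) ∧
      (∀ e : Fin L, m3.arr 5 e = s.query e) ∧ m3.calls = m2.calls ∧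
      m3.time ≤ m2.time + (13 * L + 4) := by
    rcases f2 with ⟨f2, hi⟩ | ⟨f2, hi⟩
    · have := assignLoop_spec (L := L) (solve := solve) (τ := τ)
        (m := { m2 with time := m2.time + 1 + 1 + 1 }) r2 (.read 2 0) (m2.arr 2)
        (fun k hk m' hm' _ ha => by simp [Expr.eval, ha, hm'])
      have hm3' : m3 = exec solve τ (.forItems 0 (.assign 5 0 (.read 2 0)))
          { m2 with time := m2.time + 1 + 1 + 1 } := by
        simp only [hm3, exec.eq_4, Expr.eval, r2, f2, Rat.cast_one, le_refl, if_true, Expr.cost]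
      rw [← hm3'] at this
      obtain ⟨b1, b2, b3, b4, b5⟩ := this
      refine ⟨b1, b2, fun e => ?_, b4, ?_⟩
      · rw [b3 e e.2, harr 2 (by norm_num), h2, UCBState.query, if_pos hi]
      · simp only [Expr.cost] at b5; omega
    · have := assignLoop_spec (L := L) (solve := solve) (τ := τ)
        (m := { m2 with time := m2.time + 1 + 1 + 1 }) r2 ucbExpr
        (fun k => if h : k < L then s.ucb ⟨k, h⟩ else 0)
        (fun k hk m' hm' hm'' ha => by
          have e4 := h4 ⟨k, hk⟩
          have e3 := h3 ⟨k, hk⟩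
          simp only [ucbExpr, Expr.eval, hm', hm'', hk, dif_pos]
          rw [ha 4 (by norm_num), ha 6 (by norm_num), ha 3 (by norm_num)]
          simp only [harr 4 (by norm_num), harr 6 (by norm_num), harr 3 (by norm_num)]
          simp only at e4 e3
          rw [e4, e3, h6, UCBState.ucb]
          norm_num)
      have hm3' : m3 = exec solve τ (.forItems 0 (.assign 5 0 ucbExpr))
          { m2 with time := m2.time + 1 + 1 + 1 } := by
        have : ¬ (1 : ℝ) ≤ 0 := by norm_num
        simp only [hm3, exec.eq_4, Expr.eval, r2, f2, Rat.cast_one, this, if_false, Expr.cost]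
      rw [← hm3'] at this
      obtain ⟨b1, b2, b3, b4, b5⟩ := this
      refine ⟨b1, b2, fun e => ?_, b4, ?_⟩
      · rw [b3 e e.2, UCBState.query, if_neg hi]; simp
      · simp only [Expr.cost, ucbExpr] at b5; omega
  obtain ⟨r3, a3, q3, c3, t3⟩ := key
  have hfin : exec solve τ select m = exec solve τ (.callOracle 5 0) m3 := rfl
  have hq : (fun e : Fin L => m3.arr 5 e) = s.query := funext q3
  rw [hfin]
  simp only [exec, hq]
  have harr3 : ∀ a, a ≠ 7 → a ≠ 5 → m3.arr a = m.arr a := fun a ha hb =>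
    (a3 a hb).trans (harr a ha)
  refine ⟨⟨r3, fun e => ?_, fun e => ?_, fun e => ?_, ?_⟩, ?_, fun e => ?_, ?_, ?_⟩
  · simp [harr3, h2]
  · simp [harr3, h3]
  · simp [harr3, h4]
  · simp [harr3, h6]
  · simpa [a3] using f2
  · by_cases he : e ∈ solve s.query <;> simp [he]
  · rw [c3, c2, c1]
  · omega

theorem initLoop_spec {m : Machine} (hreg : m.reg 1 = 0) :
    (exec solve τ initLoop m).reg 1 = 0 ∧
    (∀ a, a ≠ 2 → a ≠ 4 → (exec solve τ initLoop m).arr a = m.arr a) ∧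
    (∀ e < L, (exec solve τ initLoop m).arr 2 e = if 1 ≤ m.arr 0 e then 0 else m.arr 2 e) ∧
    (∀ e < L, (exec solve τ initLoop m).arr 4 e =
      if 1 ≤ m.arr 0 e then m.arr 1 e else m.arr 4 e) ∧
    (exec solve τ initLoop m).calls = m.calls ∧
    (exec solve τ initLoop m).time ≤ m.time + (10 * L + 1) := by
  have h := exec_forItems_induction (L := L) (solve := solve) (τ := τ)
    (fun k m' => m'.reg 1 = 0 ∧ (∀ a, a ≠ 2 → a ≠ 4 → m'.arr a = m.arr a) ∧
      (∀ e, m'.arr 2 e = if e < k ∧ 1 ≤ m.arr 0 e then 0 else m.arr 2 e) ∧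
      (∀ e, m'.arr 4 e = if e < k ∧ 1 ≤ m.arr 0 e then m.arr 1 e else m.arr 4 e) ∧
      m'.calls = m.calls ∧ m'.time ≤ m.time + (10 * k + 1)) (i := 0)
    (c := .ifLe (.const 1) (.read 0 0)
      (.seq (.assign 2 0 (.const 0)) (.assign 4 0 (.read 1 0))) .skip) (m := m)
    (by simp [hreg])
    (by
      rintro k hk m' ⟨h1, h2, h3, h4, h5, h6⟩
      have h00 := h2 0 (by norm_num) (by norm_num)
      have h01 := h2 1 (by norm_num) (by norm_num)
      have hlt : ∀ e, e ≠ k → (e < k + 1 ↔ e < k) := fun e he => by omega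
      by_cases hle : 1 ≤ m.arr 0 k
      · simp only [exec, Expr.eval, Expr.cost, Function.update_self, h00, Rat.cast_one, hle,
          if_true]
        refine ⟨by simp [h1], fun a ha hb => by simp [ha, hb, h2 a ha hb], fun e => ?_,
          fun e => ?_, h5, by omega⟩
        · by_cases hek : e = k
          · simp [hek, hle]
          · simp [hek, h3, hlt]
        · by_cases hek : e = k
          · simp [hek, hle, h01]
          · simp [hek, h4, hlt]
      · simp only [exec, Expr.eval, Expr.cost, Function.update_self, h00, Rat.cast_one, hle,
          if_false]
        refine ⟨by simp [h1], h2, fun e => ?_, fun e => ?_, h5, by omega⟩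
        · by_cases hek : e = k
          · simp [hek, hle, h3]
          · simp [hek, h3, hlt]
        · by_cases hek : e = k
          · simp [hek, hle, h4]
          · simp [hek, h4, hlt])
  obtain ⟨h1, h2, h3, h4, h5, h6⟩ := h
  exact ⟨h1, h2, fun e he => (h3 e).trans (by simp [he]), fun e he => (h4 e).trans (by simp [he]),
    h5, h6⟩

theorem mainLoop_spec {m : Machine} (hreg : m.reg 1 = 0) :
    (exec solve τ mainLoop m).reg 1 = 0 ∧
    (∀ a, a ≠ 3 → a ≠ 4 → (exec solve τ mainLoop m).arr a = m.arr a) ∧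
    (∀ e < L, (exec solve τ mainLoop m).arr 3 e =
      if 1 ≤ m.arr 0 e then m.arr 3 e + 1 else m.arr 3 e) ∧
    (∀ e < L, (exec solve τ mainLoop m).arr 4 e =
      if 1 ≤ m.arr 0 e then (m.arr 3 e * m.arr 4 e + m.arr 1 e) / (m.arr 3 e + 1)
      else m.arr 4 e) ∧
    (exec solve τ mainLoop m).calls = m.calls ∧
    (exec solve τ mainLoop m).time ≤ m.time + (20 * L + 1) := by
  have h := exec_forItems_induction (L := L) (solve := solve) (τ := τ)
    (fun k m' => m'.reg 1 = 0 ∧ (∀ a, a ≠ 3 → a ≠ 4 → m'.arr a = m.arr a) ∧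
      (∀ e, m'.arr 3 e = if e < k ∧ 1 ≤ m.arr 0 e then m.arr 3 e + 1 else m.arr 3 e) ∧
      (∀ e, m'.arr 4 e = if e < k ∧ 1 ≤ m.arr 0 e then
        (m.arr 3 e * m.arr 4 e + m.arr 1 e) / (m.arr 3 e + 1) else m.arr 4 e) ∧
      m'.calls = m.calls ∧ m'.time ≤ m.time + (20 * k + 1)) (i := 0)
    (c := .ifLe (.const 1) (.read 0 0)
      (.seq (.assign 4 0 (.div (.add (.mul (.read 3 0) (.read 4 0)) (.read 1 0))
        (.add (.read 3 0) (.const 1))))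
      (.assign 3 0 (.add (.read 3 0) (.const 1)))) .skip) (m := m)
    (by simp [hreg])
    (by
      rintro k hk m' ⟨h1, h2, h3, h4, h5, h6⟩
      have h00 := h2 0 (by norm_num) (by norm_num)
      have h01 := h2 1 (by norm_num) (by norm_num)
      have hlt : ∀ e, e ≠ k → (e < k + 1 ↔ e < k) := fun e he => by omega
      by_cases hle : 1 ≤ m.arr 0 k
      · simp only [exec, Expr.eval, Expr.cost, Function.update_self, h00, Rat.cast_one, hle,
          if_true]
        refine ⟨by simp [h1], fun a ha hb => by simp [ha, hb, h2 a ha hb], fun e => ?_,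
          fun e => ?_, h5, by omega⟩
        · by_cases hek : e = k
          · simp [hek, hle, h3]
          · simp [hek, h3, hlt]
        · by_cases hek : e = k
          · simp [hek, hle, h01, h3, h4]
          · simp [hek, h4, hlt]
      · simp only [exec, Expr.eval, Expr.cost, Function.update_self, h00, Rat.cast_one, hle,
          if_false]
        refine ⟨by simp [h1], h2, fun e => ?_, fun e => ?_, h5, by omega⟩
        · by_cases hek : e = k
          · simp [hek, hle, h3]
          · simp [hek, h3, hlt]
        · by_cases hek : e = k
          · simp [hek, hle, h4]
          · simp [hek, h4, hlt])
  obtain ⟨h1, h2, h3, h4, h5, h6⟩ := h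
  exact ⟨h1, h2, fun e he => (h3 e).trans (by simp [he]), fun e he => (h4 e).trans (by simp [he]),
    h5, h6⟩

theorem update_spec {m : Machine} {s : UCBState L} (hr : Represents m s) {A : Finset (Fin L)}
    {o : Fin L → ℝ} (hflag : m.arr 7 0 = 1 ∧ s.Initializing ∨ m.arr 7 0 = 0 ∧ ¬ s.Initializing)
    (hA : ∀ e : Fin L, e ∈ A ∧ m.arr 0 e = 1 ∨ e ∉ A ∧ m.arr 0 e = 0)
    (ho : ∀ e : Fin L, m.arr 1 e = o e) :
    Represents (exec solve τ update m) (s.update A o) ∧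
    (exec solve τ update m).calls = m.calls ∧
    (exec solve τ update m).time ≤ m.time + (20 * L + 10) := by
  obtain ⟨hreg, h2, h3, h4, h6⟩ := hr
  set m1 := exec solve τ (.assign 6 1 (.add (.read 6 1) (.const 1))) m with hm1
  have a1 : ∀ a, a ≠ 6 → m1.arr a = m.arr a := fun a ha => by simp [hm1, exec, ha]
  have r1 : m1.reg 1 = 0 := by simp [hm1, exec, hreg]
  have f1 : m1.arr 6 0 = s.time + 1 := by simp [hm1, exec, hreg, Expr.eval, h6]
  have t1 : m1.time = m.time + 4 := by simp [hm1, exec, Expr.cost]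
  have c1 : m1.calls = m.calls := by simp [hm1, exec]
  have hfin : exec solve τ update m =
      exec solve τ (.ifLe (.const 1) (.read 7 1) initLoop mainLoop) m1 := rfl
  have hmem : ∀ e : Fin L, 1 ≤ m.arr 0 e ↔ e ∈ A := fun e => by
    rcases hA e with ⟨h, h'⟩ | ⟨h, h'⟩ <;> simp [h, h']
  rw [← a1 7 (by norm_num)] at hflag
  classical
  rcases hflag with ⟨hf, hi⟩ | ⟨hf, hi⟩
  · have := initLoop_spec (L := L) (solve := solve) (τ := τ)
      (m := { m1 with time := m1.time + 1 + 1 + 1 }) r1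
    have hfin' : exec solve τ update m = exec solve τ initLoop
        { m1 with time := m1.time + 1 + 1 + 1 } := by
      rw [hfin]
      simp only [exec.eq_4, Expr.eval, r1, hf, Rat.cast_one, le_refl, if_true, Expr.cost]
    rw [← hfin'] at this
    obtain ⟨b1, b2, b3, b4, b5, b6⟩ := this
    refine ⟨⟨b1, fun e => ?_, fun e => ?_, fun e => ?_, ?_⟩, b5.trans c1, by simp at b6; omega⟩
    · rw [b3 e e.2, UCBState.update, if_pos hi]
      simp [hmem, a1, h2]
    · rw [b2 3 (by norm_num) (by norm_num), UCBState.update, if_pos hi]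
      simp [a1, h3]
    · rw [b4 e e.2, UCBState.update, if_pos hi]
      simp [hmem, a1, h4, ho]
    · rw [b2 6 (by norm_num) (by norm_num), UCBState.update, if_pos hi]
      simp [f1]
  · have := mainLoop_spec (L := L) (solve := solve) (τ := τ)
      (m := { m1 with time := m1.time + 1 + 1 + 1 }) r1
    have hfin' : exec solve τ update m = exec solve τ mainLoop
        { m1 with time := m1.time + 1 + 1 + 1 } := by
      have : ¬ (1 : ℝ) ≤ 0 := by norm_num
      rw [hfin]
      simp only [exec.eq_4, Expr.eval, r1, hf, Rat.cast_one, this, if_false, Expr.cost]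
    rw [← hfin'] at this
    obtain ⟨b1, b2, b3, b4, b5, b6⟩ := this
    refine ⟨⟨b1, fun e => ?_, fun e => ?_, fun e => ?_, ?_⟩, b5.trans c1, by simp at b6; omega⟩
    · rw [b2 2 (by norm_num) (by norm_num), UCBState.update, if_neg hi]
      simp [a1, h2]
    · rw [b3 e e.2, UCBState.update, if_neg hi]
      simp only [a1 0 (by norm_num), hmem, a1 3 (by norm_num), h3]
      split_ifs <;> simp
    · rw [b4 e e.2, UCBState.update, if_neg hi]
      simp [hmem, a1, h4, h3, ho]
    · rw [b2 6 (by norm_num) (by norm_num), UCBState.update, if_neg hi]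
      simp [f1]

theorem chosen_eq {m : Machine} {A : Finset (Fin L)}
    (h : ∀ e : Fin L, e ∈ A ∧ m.arr 0 e = 1 ∨ e ∉ A ∧ m.arr 0 e = 0) :
    Implementation.chosen L m = A := by
  ext e
  rcases h e with ⟨h, h'⟩ | ⟨h, h'⟩ <;> simp [Implementation.chosen, h, h']

theorem step_spec {m : Machine} {s : UCBState L} (hr : Represents m s)
    (hu : ∀ e, s.u e = 0 ∨ s.u e = 1) (w : Fin L → ℝ) :
    Implementation.chosen L (exec solve τ select m) = solve s.query ∧
    Represents (exec solve τ update (Implementation.observe w (exec solve τ select m)))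
      (s.update (solve s.query) (mask (solve s.query) w)) ∧
    (exec solve τ update (Implementation.observe w (exec solve τ select m))).calls = m.calls + 1 ∧
    (exec solve τ update (Implementation.observe w (exec solve τ select m))).time ≤
      m.time + (52 * L + 20 + τ s.query) := by
  obtain ⟨h1, h2, h3, h4, h5⟩ := select_spec (solve := solve) (τ := τ) hr hu
  have hc := chosen_eq h3
  set m1 := exec solve τ select m with hm1
  set m2 := Implementation.observe w m1 with hm2
  have ha : ∀ a, a ≠ 1 → m2.arr a = m1.arr a := fun a ha => by
    simp [hm2, Implementation.observe, ha]
  have hr2 : Represents m2 s := ⟨h1.reg, fun e => by rw [ha 2 (by norm_num), h1.u],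
    fun e => by rw [ha 3 (by norm_num), h1.T], fun e => by rw [ha 4 (by norm_num), h1.avg],
    by rw [ha 6 (by norm_num), h1.time]⟩
  obtain ⟨g1, g2, g3⟩ := update_spec (solve := solve) (τ := τ) hr2
    (A := solve s.query) (o := mask (solve s.query) w)
    (by rw [ha 7 (by norm_num)]; exact h2)
    (fun e => by rw [ha 0 (by norm_num)]; exact h3 e)
    (fun e => by simp [hm2, Implementation.observe, hc])
  have ht : m2.time = m1.time + 2 * L := rfl
  have hk : m2.calls = m1.calls := rfl
  exact ⟨hc, g1, by rw [g2, hk, h4], by omega⟩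

end RAM

end RAM

/-! ### Invariants of CombUCB1 -/

namespace UCBState

variable {L : ℕ}

/-- The invariants of the state of CombUCB1 after `t` steps. -/
structure Valid (t : ℕ) (s : UCBState L) : Prop where
  time : s.time = t + 1
  u : ∀ e, s.u e = 0 ∨ s.u e = 1
  u_zero : t = 0 → ∀ e, s.u e = 1
  avg : ∀ e, s.avg e ∈ Set.Icc (0 : ℝ) 1
  one_le_T : ∀ e, 1 ≤ s.T e
  T_init : s.Initializing → ∀ e, s.T e = 1
  T_le : ∀ e, s.T e ≤ max 1 t

theorem valid_first : Valid 0 (first L) := by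
  refine ⟨rfl, fun e => Or.inr rfl, fun _ e => rfl, fun e => ?_, fun e => le_rfl, fun _ e => rfl,
    fun e => le_max_left _ _⟩
  simp [first]

theorem Valid.update {t : ℕ} {s : UCBState L} (h : Valid t s) (A : Finset (Fin L))
    {o : Fin L → ℝ} (ho : ∀ e, o e ∈ Set.Icc (0 : ℝ) 1) : Valid (t + 1) (s.update A o) := by
  obtain ⟨h1, h2, h3, h4, h5, h6, h7⟩ := h
  by_cases hi : s.Initializing
  · rw [UCBState.update, if_pos hi]
    refine ⟨by simp [h1], fun e => ?_, by simp, fun e => ?_, h5, fun _ => h6 hi, fun e => ?_⟩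
    · simp only; split_ifs
      · exact Or.inl rfl
      · exact h2 e
    · simp only; split_ifs
      · exact ho e
      · exact h4 e
    · rw [h6 hi e]; exact le_max_left _ _
  · rw [UCBState.update, if_neg hi]
    refine ⟨by simp [h1], h2, by simp, fun e => ?_, fun e => ?_, fun h => absurd h hi,
      fun e => ?_⟩
    · simp only; split_ifs
      · have hT : (0 : ℝ) ≤ s.T e := Nat.cast_nonneg _
        have := h4 e
        have := ho e
        constructor
        · exact div_nonneg (add_nonneg (mul_nonneg hT (h4 e).1) (ho e).1) (by linarith)
        · rw [div_le_one (by linarith)]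
          nlinarith [mul_le_mul_of_nonneg_left (h4 e).2 hT, (ho e).2]
      · exact h4 e
    · simp only; split_ifs
      · omega
      · exact h5 e
    · have ht : t ≠ 0 := fun h0 => hi ⟨e, h3 h0 e⟩
      have := h7 e
      simp only; split_ifs <;> omega

theorem Valid.query_nonneg {t : ℕ} {s : UCBState L} (h : Valid t s) (e : Fin L) :
    0 ≤ s.query e := by
  unfold query
  split_ifs
  · rcases h.u e with h | h <;> simp [h]
  · exact add_nonneg (h.avg e).1 (Real.sqrt_nonneg _)

end UCBState

theorem mask_mem_Icc {L : ℕ} (A : Finset (Fin L)) {w : Fin L → ℝ}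
    (hw : ∀ e, w e ∈ Set.Icc (0 : ℝ) 1) (e : Fin L) : mask A w e ∈ Set.Icc (0 : ℝ) 1 := by
  unfold mask; split_ifs
  · exact hw e
  · simp

theorem combUCB1_computationallyEfficient : CombUCB1ComputationallyEfficient := by
  -- The loops are linear in `L` and the size `K` plays no role. The coefficients dominate `52 * L +
  -- 20` per step and `5 * L + 3` for the setup.
  refine ⟨RAM.impl, 60 * MvPolynomial.X 0 + 60, fun L Θ _ O τ q hq w hw => ?_⟩
  have hp : MvPolynomial.eval ![L, maxSize Θ] (60 * MvPolynomial.X 0 + 60 : MvPolynomial (Fin 2) ℕ)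
      = 60 * L + 60 := by simp
  rw [hp]
  obtain ⟨s1, s2, s3⟩ := RAM.setup_spec (L := L) (solve := O.solve) (τ := τ)
  have key : ∀ t, RAM.Represents (RAM.impl.run O.solve τ w t)
      ((combUCB1 O).stateAt (UCBState.first L) w t : UCBState L) ∧
      UCBState.Valid t ((combUCB1 O).stateAt (UCBState.first L) w t : UCBState L) := by
    intro t
    induction t with
    | zero => exact ⟨s1, UCBState.valid_first⟩
    | succ t ih =>
      exact ⟨(RAM.step_spec (solve := O.solve) (τ := τ) ih.1 ih.2.u (w t)).2.1,
        ih.2.update _ (mask_mem_Icc _ (hw t))⟩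
  refine ⟨s2, (by show (exec O.solve τ RAM.setup Machine.blank).time ≤ _; omega), fun t => ?_⟩
  obtain ⟨h1, h2⟩ := key t
  obtain ⟨g1, -, g3, g4⟩ := RAM.step_spec (solve := O.solve) (τ := τ) h1 h2.u (w t)
  have := hq _ h2.query_nonneg
  exact ⟨g1, g3, g4.trans (by omega)⟩

/-! ### Sums of confidence radii -/

theorem inv_sqrt_succ_le (n : ℕ) :
    1 / Real.sqrt ((n + 1 : ℕ) : ℝ) ≤ 2 * (Real.sqrt ((n + 1 : ℕ) : ℝ) - Real.sqrt n) := by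
  push_cast
  have h1 : 0 < Real.sqrt ((n : ℝ) + 1) := Real.sqrt_pos.2 (by positivity)
  have h2 := Real.sqrt_nonneg (n : ℝ)
  have h3 := Real.sq_sqrt (show (0 : ℝ) ≤ (n : ℝ) + 1 by positivity)
  have h4 := Real.sq_sqrt (show (0 : ℝ) ≤ (n : ℝ) by positivity)
  rw [div_le_iff₀ h1]
  nlinarith [sq_nonneg (Real.sqrt ((n : ℝ) + 1) - Real.sqrt n)]

theorem sum_inv_sqrt_le (N : ℕ) :
    ∑ k ∈ Finset.range N, 1 / Real.sqrt ((k + 1 : ℕ) : ℝ) ≤ 2 * Real.sqrt N := by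
  induction N with
  | zero => simp
  | succ N ih =>
    rw [Finset.sum_range_succ]
    linarith [inv_sqrt_succ_le N]

/-- The terms decrease in `k`. If the last one vanishes, it can be dropped. Otherwise no term is
truncated, and the sum is at most `2 a x - d x² ≤ a² / d` with `x = √N`. -/
theorem sum_div_sqrt_sub_posPart_le {a d : ℝ} (ha : 0 ≤ a) (hd : 0 < d) (N : ℕ) :
    ∑ k ∈ Finset.range N, max 0 (a / Real.sqrt ((k + 1 : ℕ) : ℝ) - d) ≤ a ^ 2 / d := by
  induction N with
  | zero => simp; positivity
  | succ N ih =>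
    by_cases hN : a / Real.sqrt ((N + 1 : ℕ) : ℝ) ≤ d
    · rw [Finset.sum_range_succ, max_eq_left (by linarith), add_zero]
      exact ih
    · push Not at hN
      have hterm : ∀ k ∈ Finset.range (N + 1), max 0 (a / Real.sqrt ((k + 1 : ℕ) : ℝ) - d) =
          a * (1 / Real.sqrt ((k + 1 : ℕ) : ℝ)) - d := fun k hk => by
        have hk' : ((k + 1 : ℕ) : ℝ) ≤ ((N + 1 : ℕ) : ℝ) := by
          exact_mod_cast Finset.mem_range.1 hk
        have h0 : 0 < Real.sqrt ((k + 1 : ℕ) : ℝ) := Real.sqrt_pos.2 (by positivity)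
        have : a / Real.sqrt ((N + 1 : ℕ) : ℝ) ≤ a / Real.sqrt ((k + 1 : ℕ) : ℝ) :=
          div_le_div_of_nonneg_left ha h0 (Real.sqrt_le_sqrt hk')
        rw [max_eq_right (by linarith)]; ring
      rw [Finset.sum_congr rfl hterm, Finset.sum_sub_distrib, ← Finset.mul_sum]
      have h1 := mul_le_mul_of_nonneg_left (sum_inv_sqrt_le (N + 1)) ha
      have h2 : Real.sqrt ((N + 1 : ℕ) : ℝ) ^ 2 = ((N + 1 : ℕ) : ℝ) :=
        Real.sq_sqrt (by positivity)
      rw [Finset.sum_const, Finset.card_range, nsmul_eq_mul]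
      rw [← h2]
      set x := Real.sqrt ((N + 1 : ℕ) : ℝ)
      rw [le_div_iff₀ hd]
      nlinarith [sq_nonneg (d * x - a)]

/-! ### The minimum gap -/

section MinGap

variable {L : ℕ} {Θ : Finset (Finset (Fin L))} {B : WeightLaw L} {Astar : Finset (Fin L)}

theorem minGap_set_finite (Θ : Finset (Finset (Fin L))) (B : WeightLaw L)
    (Astar : Finset (Fin L)) (e : Fin L) :
    {d : ℝ | ∃ A ∈ Θ, e ∈ A ∧ 0 < gap B Astar A ∧ d = gap B Astar A}.Finite := by
  refine (Θ.finite_toSet.image fun A => gap B Astar A).subset ?_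
  rintro d ⟨A, hA, -, -, rfl⟩
  exact ⟨A, hA, rfl⟩

theorem minGap_le {A : Finset (Fin L)} (hA : A ∈ Θ) {e : Fin L} (he : e ∈ A)
    (hpos : 0 < gap B Astar A) : minGap Θ B Astar e ≤ gap B Astar A :=
  csInf_le (minGap_set_finite Θ B Astar e).bddBelow ⟨A, hA, he, hpos, rfl⟩

theorem exists_minGap_eq (hc : Covers Θ) (h : IsOptimal Θ B Astar) {e : Fin L} (he : e ∉ Astar) :
    ∃ A ∈ Θ, e ∈ A ∧ 0 < gap B Astar A ∧ minGap Θ B Astar e = gap B Astar A := by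
  obtain ⟨A, hA, heA⟩ := hc e
  have hne : A ≠ Astar := fun hh => he (hh ▸ heA)
  have hn : {d : ℝ | ∃ A ∈ Θ, e ∈ A ∧ 0 < gap B Astar A ∧ d = gap B Astar A}.Nonempty :=
    ⟨_, A, hA, heA, gap_pos h hA hne, rfl⟩
  exact hn.csInf_mem (minGap_set_finite Θ B Astar e)

theorem minGap_pos (hc : Covers Θ) (h : IsOptimal Θ B Astar) {e : Fin L} (he : e ∉ Astar) :
    0 < minGap Θ B Astar e := by
  obtain ⟨A, -, -, h1, h2⟩ := exists_minGap_eq hc h he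
  rwa [h2]

theorem maxSize_pos (hc : Covers Θ) (e : Fin L) : 0 < maxSize Θ := by
  obtain ⟨A, hA, heA⟩ := hc e
  exact (Finset.card_pos.2 ⟨e, heA⟩).trans_le (card_le_maxSize hA)

end MinGap

/-! ### The regret of CombUCB1 along a sequence of weights -/

section Path

variable {L : ℕ} {Θ : Finset (Finset (Fin L))} {B : WeightLaw L} {Astar : Finset (Fin L)}

/-- All averages are within their confidence radii after `t` steps. -/
def UCBState.Good (B : WeightLaw L) (t : ℕ) (s : UCBState L) : Prop :=
  ∀ e, |s.avg e - B.mean e| ≤ Real.sqrt (1.5 * Real.log t / s.T e)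

/-- Optimism: the upper confidence bounds dominate the means on `A* \ A` and exceed them by at most
two radii on `A \ A*`. The common items cancel, so only items outside of the optimal solution are
charged. -/
theorem gap_le_of_good (hopt : IsOptimal Θ B Astar) (O : Oracle Θ) {t : ℕ} {s : UCBState L}
    (hv : s.Valid t) (hi : ¬ s.Initializing) (hg : s.Good B t) :
    gap B Astar (O.solve s.query) ≤
      2 * ∑ e ∈ O.solve s.query \ Astar, Real.sqrt (1.5 * Real.log t / s.T e) := by
  classical
  set A := O.solve s.query with hA
  have hucb : ∀ e, s.query e = s.avg e + Real.sqrt (1.5 * Real.log t / s.T e) := fun e => by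
    rw [UCBState.query, if_neg hi, UCBState.ucb, hv.time]; push_cast; simp
  have h1 := O.solve_opt s.query hv.query_nonneg Astar hopt.1
  rw [← hA] at h1
  have split : ∀ (X Y : Finset (Fin L)) (f : Fin L → ℝ),
      ret X f = ∑ e ∈ X \ Y, f e + ∑ e ∈ X ∩ Y, f e := fun X Y f =>
    (Finset.sum_inter_add_sum_sdiff X Y f).symm.trans (add_comm _ _)
  rw [split Astar A, split A Astar, Finset.inter_comm A Astar] at h1
  rw [gap, split Astar A, split A Astar, Finset.inter_comm A Astar]
  have h2 : ∑ e ∈ Astar \ A, B.mean e ≤ ∑ e ∈ Astar \ A, s.query e :=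
    Finset.sum_le_sum fun e _ => by
      have := (abs_le.1 (hg e)).1
      rw [hucb]; linarith
  have h3 : ∑ e ∈ A \ Astar, s.query e ≤ ∑ e ∈ A \ Astar, B.mean e +
      2 * ∑ e ∈ A \ Astar, Real.sqrt (1.5 * Real.log t / s.T e) := by
    rw [Finset.mul_sum, ← Finset.sum_add_distrib]
    refine Finset.sum_le_sum fun e _ => ?_
    have := (abs_le.1 (hg e)).2
    rw [hucb]; linarith
  linarith

variable (O : Oracle Θ) (s : ℕ → UCBState L) (o : ℕ → Fin L → ℝ)

-- The counter of an item starts at one and grows by one exactly when the item is chosen after the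
-- initialization. Hence the counter values at these times are `1, …, T - 1`, each met once.
open Classical in
theorem sum_counters (h0 : s 0 = UCBState.first L)
    (hs : ∀ t, s (t + 1) = (s t).update (O.solve (s t).query) (o t)) (e : Fin L) (φ : ℕ → ℝ)
    (n : ℕ) :
    (∑ t ∈ Finset.range n, if ¬ (s t).Initializing ∧ e ∈ O.solve (s t).query then
      φ ((s t).T e) else 0) = ∑ k ∈ Finset.range ((s n).T e - 1), φ (k + 1) ∧ 1 ≤ (s n).T e := by
  induction n with
  | zero => simp [h0, UCBState.first]
  | succ n ih =>
    rw [Finset.sum_range_succ, ih.1, hs n]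
    by_cases hi : (s n).Initializing
    · simp [UCBState.update, hi, ih.2]
    · by_cases he : e ∈ O.solve (s n).query
      · simp only [UCBState.update, hi, he, if_true, if_false, not_false_eq_true, and_self]
        obtain ⟨k, hk⟩ := Nat.exists_eq_add_of_le' ih.2
        rw [hk]; simp [Finset.sum_range_succ]
      · simp [UCBState.update, hi, he, ih.2]

open Classical in
theorem sum_counters_le (h0 : s 0 = UCBState.first L)
    (hs : ∀ t, s (t + 1) = (s t).update (O.solve (s t).query) (o t)) (n : ℕ) :
    ∑ e, (((s n).T e - 1 : ℕ) : ℝ) ≤ maxSize Θ * n := by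
  have h1 : ∀ e, (((s n).T e - 1 : ℕ) : ℝ) = ∑ t ∈ Finset.range n,
      if ¬ (s t).Initializing ∧ e ∈ O.solve (s t).query then (1 : ℝ) else 0 := fun e => by
    rw [(sum_counters O s o h0 hs e (fun _ => 1) n).1]; simp
  simp_rw [h1]
  rw [Finset.sum_comm]
  calc _ ≤ ∑ t ∈ Finset.range n, (maxSize Θ : ℝ) := Finset.sum_le_sum fun t _ => by
        calc _ ≤ ∑ e, if e ∈ O.solve (s t).query then (1 : ℝ) else 0 :=
              Finset.sum_le_sum fun e _ => by split_ifs <;> simp_all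
          _ = (O.solve (s t).query).card := by simp
          _ ≤ _ := by exact_mod_cast card_le_maxSize (O.solve_mem _)
    _ = _ := by simp [mul_comm]

-- The number of items with auxiliary weight one is a strictly decreasing potential during the
-- initialization. As every item is covered, some solution has a positive value, so the oracle's
-- answer contains an item of weight one, whose weight drops to zero.
open Classical in
theorem card_initializing_le (hc : Covers Θ) (hv : ∀ t, (s t).Valid t)
    (hs : ∀ t, s (t + 1) = (s t).update (O.solve (s t).query) (o t)) (n : ℕ) :
    (∑ t ∈ Finset.range n, if (s t).Initializing then (1 : ℝ) else 0) ≤ L := by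
  have key : (∑ t ∈ Finset.range n, if (s t).Initializing then 1 else 0) +
      (Finset.univ.filter fun e => (s n).u e = 1).card ≤ L := by
    induction n with
    | zero => simpa using Finset.card_le_univ _ |>.trans_eq (Fintype.card_fin L)
    | succ n ih =>
      rw [Finset.sum_range_succ]
      by_cases hi : (s n).Initializing
      · have hq : (s n).query = (s n).u := by rw [UCBState.query, if_pos hi]
        have hex : ∃ e ∈ O.solve (s n).query, (s n).u e = 1 := by
          by_contra hcon
          push Not at hcon
          obtain ⟨e, he⟩ := hi
          obtain ⟨A, hA, heA⟩ := hc e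
          have h1 := O.solve_opt (s n).query (hv n).query_nonneg A hA
          have h2 : ret (O.solve (s n).query) (s n).query = 0 :=
            Finset.sum_eq_zero fun e' he' => by
              rw [hq]
              rcases (hv n).u e' with h | h
              · exact h
              · exact absurd h (hcon e' he')
          have h3 : (s n).query e ≤ ret A (s n).query :=
            Finset.single_le_sum (f := (s n).query) (fun e' _ => (hv n).query_nonneg e') heA
          rw [hq, he] at h3
          rw [hq] at h1 h2
          linarith
        obtain ⟨e, he, heu⟩ := hex
        have hlt : (Finset.univ.filter fun e => (s (n + 1)).u e = 1).card <
            (Finset.univ.filter fun e => (s n).u e = 1).card := by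
          refine Finset.card_lt_card ⟨fun e' he' => ?_, fun hsub => ?_⟩
          · simp only [Finset.mem_filter, Finset.mem_univ, true_and, hs n, UCBState.update,
              if_pos hi] at he' ⊢
            split_ifs at he' with h
            · norm_num at he'
            · exact he'
          · have := hsub (Finset.mem_filter.2 ⟨Finset.mem_univ e, heu⟩)
            simp [hs n, UCBState.update, hi, he] at this
        simp only [hi, if_true]; omega
      · have : (s (n + 1)).u = (s n).u := by rw [hs n, UCBState.update, if_neg hi]
        simp only [hi, if_false, this]; omega
  have : (∑ t ∈ Finset.range n, if (s t).Initializing then 1 else 0) ≤ L := by omega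
  exact_mod_cast this

-- Both bounds are deterministic: they hold for any sequence of observations that keeps the state
-- valid. Each follows from charging the gap of a step to the chosen items outside of `Astar`
-- through a function of their counters, and summing over the counter values.
open Classical in
theorem sum_gap_good_le (hc : Covers Θ) (hopt : IsOptimal Θ B Astar) (hv : ∀ t, (s t).Valid t)
    (h0 : s 0 = UCBState.first L)
    (hs : ∀ t, s (t + 1) = (s t).update (O.solve (s t).query) (o t)) (n : ℕ) :
    (∑ t ∈ Finset.range n, if ¬ (s t).Initializing ∧ (s t).Good B t then
        gap B Astar (O.solve (s t).query) else 0) ≤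
      ∑ e ∈ Finset.univ.filter (fun e => e ∉ Astar),
        (maxSize Θ : ℝ) * (534 / minGap Θ B Astar e) * Real.log n ∧
    (∑ t ∈ Finset.range n, if ¬ (s t).Initializing ∧ (s t).Good B t then
        gap B Astar (O.solve (s t).query) else 0) ≤
      47 * Real.sqrt ((maxSize Θ : ℝ) * L * n * Real.log n) := by
  set E := Finset.univ.filter (fun e => e ∉ Astar) with hE
  set K : ℝ := (maxSize Θ : ℝ) with hK
  have hlogn : 0 ≤ Real.log n := Real.log_natCast_nonneg n
  set r : ℝ := Real.sqrt (1.5 * Real.log n) with hr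
  have hr0 : 0 ≤ r := Real.sqrt_nonneg _
  have hr2 : r ^ 2 = 1.5 * Real.log n := Real.sq_sqrt (by positivity)
  have hstep : ∀ t < n, ¬ (s t).Initializing ∧ (s t).Good B t →
      gap B Astar (O.solve (s t).query) ≤
        2 * ∑ e ∈ O.solve (s t).query \ Astar, r / Real.sqrt ((s t).T e) := by
    rintro t ht ⟨hi, hg⟩
    refine (gap_le_of_good hopt O (hv t) hi hg).trans ?_
    refine mul_le_mul_of_nonneg_left (Finset.sum_le_sum fun e _ => ?_) (by norm_num)
    rw [hr, ← Real.sqrt_div (by positivity)]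
    refine Real.sqrt_le_sqrt (div_le_div_of_nonneg_right ?_ (Nat.cast_nonneg _))
    refine mul_le_mul_of_nonneg_left ?_ (by norm_num)
    -- The case of step zero is harmless because `Real.log 0 = 0`.
    rcases Nat.eq_zero_or_pos t with rfl | hpos
    · simpa using hlogn
    · exact Real.log_le_log (by exact_mod_cast hpos) (by exact_mod_cast ht.le)
  have hrew : ∀ t, ∀ φ : Fin L → ℝ, ¬ (s t).Initializing →
      ∑ e ∈ O.solve (s t).query \ Astar, φ e = ∑ e ∈ E,
        if ¬ (s t).Initializing ∧ e ∈ O.solve (s t).query then φ e else 0 := by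
    intro t φ hi
    rw [← Finset.sum_filter]
    refine Finset.sum_congr ?_ fun _ _ => rfl
    ext e
    simp [hE, hi, and_comm]
  have hsum : ∀ φ : Fin L → ℕ → ℝ, (∀ e k, 0 ≤ φ e k) →
      (∀ t < n, ¬ (s t).Initializing ∧ (s t).Good B t → gap B Astar (O.solve (s t).query) ≤
        ∑ e ∈ O.solve (s t).query \ Astar, φ e ((s t).T e)) →
      (∑ t ∈ Finset.range n, if ¬ (s t).Initializing ∧ (s t).Good B t then
        gap B Astar (O.solve (s t).query) else 0) ≤
        ∑ e ∈ E, ∑ k ∈ Finset.range ((s n).T e - 1), φ e (k + 1) := by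
    intro φ hφ hle
    calc _ ≤ ∑ t ∈ Finset.range n, ∑ e ∈ E,
          (if ¬ (s t).Initializing ∧ e ∈ O.solve (s t).query then φ e ((s t).T e) else 0) := by
          refine Finset.sum_le_sum fun t ht => ?_
          by_cases h : ¬ (s t).Initializing ∧ (s t).Good B t
          · rw [if_pos h, ← hrew t _ h.1]
            exact hle t (Finset.mem_range.1 ht) h
          · rw [if_neg h]
            refine Finset.sum_nonneg fun e _ => ?_
            split_ifs
            · exact hφ _ _
            · exact le_rfl
      _ = _ := by
          rw [Finset.sum_comm]
          exact Finset.sum_congr rfl fun e _ => (sum_counters O s o h0 hs e (φ e) n).1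
  constructor
  · refine (hsum (fun e k => max 0 (4 * r / Real.sqrt k - minGap Θ B Astar e / K))
      (fun _ _ => le_max_left _ _) fun t ht h => ?_).trans (Finset.sum_le_sum fun e he => ?_)
    · have hAmem := O.solve_mem (s t).query
      set A := O.solve (s t).query
      rcases (gap_nonneg hopt hAmem).eq_or_lt with h' | hpos
      · rw [← h']
        exact Finset.sum_nonneg fun _ _ => le_max_left _ _
      have h1 := hstep t ht h
      have hKpos : 0 < K := by
        by_contra hKn
        have hA0 : A = ∅ := by
          have := card_le_maxSize hAmem
          have hz : (maxSize Θ : ℝ) ≤ 0 := not_lt.1 hKn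
          have : maxSize Θ = 0 := by exact_mod_cast le_antisymm hz (Nat.cast_nonneg _)
          exact Finset.card_eq_zero.1 (by omega)
        have h2 := gap_le_maxSize hopt A
        linarith
      have h2 : ∑ e ∈ A \ Astar, minGap Θ B Astar e / K ≤ gap B Astar A := by
        calc _ ≤ ∑ e ∈ A \ Astar, gap B Astar A / K := Finset.sum_le_sum fun e he =>
              div_le_div_of_nonneg_right
                (minGap_le hAmem (Finset.mem_sdiff.1 he).1 hpos) hKpos.le
          _ = (A \ Astar).card * (gap B Astar A / K) := by simp
          _ ≤ K * (gap B Astar A / K) := by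
              refine mul_le_mul_of_nonneg_right ?_ (by positivity)
              exact Nat.cast_le.2 ((Finset.card_le_card Finset.sdiff_subset).trans
                (card_le_maxSize hAmem))
          _ = _ := by field_simp
      calc gap B Astar A ≤ ∑ e ∈ A \ Astar,
            (4 * r / Real.sqrt ((s t).T e) - minGap Θ B Astar e / K) := by
            have h3 : ∑ e ∈ A \ Astar, 4 * r / Real.sqrt ((s t).T e) =
                2 * (2 * ∑ e ∈ A \ Astar, r / Real.sqrt ((s t).T e)) := by
              rw [← mul_assoc, Finset.mul_sum]
              exact Finset.sum_congr rfl fun e _ => by ring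
            rw [Finset.sum_sub_distrib, h3]
            linarith
        _ ≤ _ := Finset.sum_le_sum fun e _ => le_max_right _ _
    · have he' : e ∉ Astar := (Finset.mem_filter.1 he).2
      have hd := minGap_pos hc hopt he'
      have hKpos : 0 < K := Nat.cast_pos.2 (maxSize_pos hc e)
      refine (sum_div_sqrt_sub_posPart_le (by positivity) (by positivity) _).trans ?_
      -- The constant is `16 * 1.5 = 24`, well below 534.
      have : (4 * r) ^ 2 / (minGap Θ B Astar e / K) =
          K * (24 / minGap Θ B Astar e) * Real.log n := by
        rw [mul_pow, hr2]; field_simp; ring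
      rw [this]
      gcongr
      norm_num
  · refine (hsum (fun _ k => 2 * (r / Real.sqrt k)) (fun _ _ => by positivity)
      fun t ht h => ?_).trans ?_
    · rw [← Finset.mul_sum]; exact hstep t ht h
    · have hLn : (0 : ℝ) ≤ L := Nat.cast_nonneg _
      -- Cauchy–Schwarz, together with the fact that each step increases at most `K` counters.
      have hcs : (∑ e, Real.sqrt (((s n).T e - 1 : ℕ) : ℝ)) ≤ Real.sqrt (L * (K * n)) := by
        refine Real.le_sqrt_of_sq_le ?_
        calc _ ≤ (Finset.univ.card : ℝ) * ∑ e : Fin L, Real.sqrt (((s n).T e - 1 : ℕ) : ℝ) ^ 2 :=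
              sq_sum_le_card_mul_sum_sq
          _ = L * ∑ e : Fin L, (((s n).T e - 1 : ℕ) : ℝ) := by
              rw [Finset.card_fin]
              congr 1
              exact Finset.sum_congr rfl fun e _ => Real.sq_sqrt (Nat.cast_nonneg _)
          _ ≤ _ := mul_le_mul_of_nonneg_left (sum_counters_le O s o h0 hs n) hLn
      calc _ ≤ ∑ e ∈ E, 4 * r * Real.sqrt (((s n).T e - 1 : ℕ) : ℝ) := by
            refine Finset.sum_le_sum fun e _ => ?_
            have := mul_le_mul_of_nonneg_left (sum_inv_sqrt_le ((s n).T e - 1))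
              (show 0 ≤ 2 * r by positivity)
            rw [Finset.mul_sum] at this
            calc _ = ∑ k ∈ Finset.range ((s n).T e - 1),
                  2 * r * (1 / Real.sqrt ((k + 1 : ℕ) : ℝ)) :=
                  Finset.sum_congr rfl fun k _ => by ring
              _ ≤ _ := by linarith
        _ ≤ ∑ e, 4 * r * Real.sqrt (((s n).T e - 1 : ℕ) : ℝ) :=
            Finset.sum_le_sum_of_subset_of_nonneg (Finset.subset_univ _)
              fun _ _ _ => by positivity
        _ ≤ 4 * r * Real.sqrt (L * (K * n)) := by
            rw [← Finset.mul_sum]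
            exact mul_le_mul_of_nonneg_left hcs (by positivity)
        _ ≤ 47 * Real.sqrt (K * L * n * Real.log n) := by
            have h5 : r ≤ 2 * Real.sqrt (Real.log n) := by
              rw [hr, show (2 : ℝ) = Real.sqrt 4 by
                rw [show (4 : ℝ) = 2 ^ 2 by norm_num, Real.sqrt_sq (by norm_num)],
                ← Real.sqrt_mul (by norm_num)]
              exact Real.sqrt_le_sqrt (by linarith)
            rw [show K * L * n * Real.log n = (L * (K * n)) * Real.log n by ring,
              Real.sqrt_mul (x := L * (K * n)) (by positivity) (Real.log n)]
            have h6 := Real.sqrt_nonneg ((L : ℝ) * (K * n))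
            have h7 := Real.sqrt_nonneg (Real.log n)
            nlinarith [mul_le_mul_of_nonneg_right h5 h6, mul_nonneg h6 h7]

end Path

/-! ### Concentration of the averages of CombUCB1 -/

/-- Hoeffding's lemma: a variable in `[0, 1]` is sub-Gaussian with variance proxy `1 / 4`. -/
theorem lintegral_exp_hoeffding {L : ℕ} (B : WeightLaw L) (e : Fin L) (l : ℝ) :
    ∫⁻ w, ENNReal.ofReal (Real.exp (l * (w e - B.mean e) - l ^ 2 / 8)) ∂B.P ≤ 1 := by
  have h := hasSubgaussianMGF_of_mem_Icc (measurable_pi_apply e).aemeasurable (B.ae_mem_Icc e)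
  have h1 := h.mgf_le l
  have h2 : (∫ w : Fin L → ℝ, w e ∂B.P) = B.mean e := rfl
  have h3 := h.integrable_exp_mul l
  simp only [mgf, h2] at h1 h3
  have heq : ∀ w : Fin L → ℝ, ENNReal.ofReal (Real.exp (l * (w e - B.mean e) - l ^ 2 / 8)) =
      ENNReal.ofReal (Real.exp (-(l ^ 2 / 8))) *
        ENNReal.ofReal (Real.exp (l * (w e - B.mean e))) := fun w => by
    rw [← ENNReal.ofReal_mul (Real.exp_nonneg _), ← Real.exp_add]
    congr 2; ring
  simp_rw [heq]
  rw [lintegral_const_mul' _ _ ENNReal.ofReal_ne_top,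
    ← ofReal_integral_eq_lintegral_ofReal h3 (ae_of_all _ fun _ => Real.exp_nonneg _),
    ← ENNReal.ofReal_mul (Real.exp_nonneg _), ← ENNReal.ofReal_one]
  refine ENNReal.ofReal_le_ofReal ?_
  calc _ ≤ Real.exp (-(l ^ 2 / 8)) * Real.exp (((‖(1 : ℝ) - 0‖₊ / 2) ^ 2 : NNReal) * l ^ 2 / 2) :=
        mul_le_mul_of_nonneg_left h1 (Real.exp_nonneg _)
    _ = 1 := by
        rw [← Real.exp_add, Real.exp_eq_one_iff]
        simp; ring

section Concentration

variable {L : ℕ} {Θ : Finset (Finset (Fin L))}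

open Classical in
/-- The auxiliary weights of the initialization phase after `t` steps. They do not depend on the
observed weights. -/
def initWeights (O : Oracle Θ) : ℕ → Fin L → ℝ
  | 0 => fun _ => 1
  | t + 1 => if ∃ e, initWeights O t e = 1 then
      fun e => if e ∈ O.solve (initWeights O t) then 0 else initWeights O t e
    else initWeights O t

/-- One step of CombUCB1. -/
def ucbStep (O : Oracle Θ) (s : UCBState L) (w : Fin L → ℝ) : UCBState L :=
  s.update (O.solve s.query) (mask (O.solve s.query) w)

theorem measurable_ucbStep (O : Oracle Θ) : Measurable (Function.uncurry (ucbStep O)) :=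
  (combUCB1 O).measurable_step

/-- The law of the state of CombUCB1 after `t` steps. -/
def ucbLaw (O : Oracle Θ) (B : WeightLaw L) (t : ℕ) : Measure (UCBState L) :=
  chainLaw (ucbStep O) B.P (Measure.dirac (UCBState.first L)) t

instance (O : Oracle Θ) (B : WeightLaw L) (t : ℕ) : IsProbabilityMeasure (ucbLaw O B t) :=
  isProbabilityMeasure_chainLaw (measurable_ucbStep O) t

/-- The queries of the initialization depend only on the auxiliary weights, so its schedule is
deterministic. This matters in `lintegral_expMart_le`, because observations can be overwritten
during the initialization. -/
theorem update_u_eq_initWeights (O : Oracle Θ) {t : ℕ} {s : UCBState L}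
    (h : s.u = initWeights O t) (o : Fin L → ℝ) :
    (s.update (O.solve s.query) o).u = initWeights O (t + 1) := by
  classical
  have hiff : s.Initializing ↔ ∃ e, initWeights O t e = 1 := by rw [UCBState.Initializing, h]
  rw [initWeights, UCBState.update]
  by_cases hi : s.Initializing
  · rw [if_pos hi, if_pos (hiff.1 hi), UCBState.query, if_pos hi, h]
  · rw [if_neg hi, if_neg (fun h' => hi (hiff.2 h'))]
    exact h

theorem measurable_u_apply (e : Fin L) : Measurable fun s : UCBState L => s.u e :=
  (measurable_pi_apply e).comp UCBState.measurable_u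

theorem measurable_T_apply (e : Fin L) : Measurable fun s : UCBState L => s.T e :=
  (measurable_pi_apply e).comp UCBState.measurable_T

theorem measurable_avg_apply (e : Fin L) : Measurable fun s : UCBState L => s.avg e :=
  (measurable_pi_apply e).comp UCBState.measurable_avg

theorem measurableSet_valid (t : ℕ) : MeasurableSet {s : UCBState L | s.Valid t} := by
  have heq : {s : UCBState L | s.Valid t} = {s | s.time = t + 1} ∩ (⋂ e, {s | s.u e = 0} ∪
      {s | s.u e = 1}) ∩ (⋂ e, {s | t = 0} ᶜ ∪ {s | s.u e = 1}) ∩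
      (⋂ e, {s | s.avg e ∈ Set.Icc (0 : ℝ) 1}) ∩ (⋂ e, {s | 1 ≤ s.T e}) ∩
      (⋂ e, {s | s.Initializing}ᶜ ∪ {s | s.T e = 1}) ∩ (⋂ e, {s | s.T e ≤ max 1 t}) := by
    ext s
    simp only [Set.mem_inter_iff, Set.mem_iInter, Set.mem_union, Set.mem_compl_iff,
      Set.mem_ofPred_eq, ← imp_iff_not_or]
    constructor
    · rintro ⟨h1, h2, h3, h4, h5, h6, h7⟩
      exact ⟨⟨⟨⟨⟨⟨h1, h2⟩, fun e h => h3 h e⟩, h4⟩, h5⟩, fun e h => h6 h e⟩, h7⟩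
    · rintro ⟨⟨⟨⟨⟨⟨h1, h2⟩, h3⟩, h4⟩, h5⟩, h6⟩, h7⟩
      exact ⟨h1, h2, fun h e => h3 e h, h4, h5, fun h e => h6 e h, h7⟩
  have hu : ∀ e : Fin L, ∀ c : ℝ, MeasurableSet {s : UCBState L | s.u e = c} := fun e c =>
    measurableSet_eq_fun (measurable_u_apply e) measurable_const
  have hT : ∀ e : Fin L, ∀ S : Set ℕ, MeasurableSet {s : UCBState L | s.T e ∈ S} := fun e S =>
    measurable_T_apply e (MeasurableSet.of_discrete (s := S))
  rw [heq]
  refine MeasurableSet.inter (MeasurableSet.inter (MeasurableSet.inter (MeasurableSet.inter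
    (MeasurableSet.inter (MeasurableSet.inter ?_ ?_) ?_) ?_) ?_) ?_) ?_
  · exact UCBState.measurable_time (MeasurableSet.of_discrete (s := {t + 1}))
  · exact MeasurableSet.iInter fun e => (hu e 0).union (hu e 1)
  · exact MeasurableSet.iInter fun e => (MeasurableSet.const _).compl.union (hu e 1)
  · exact MeasurableSet.iInter fun e => measurable_avg_apply e measurableSet_Icc
  · exact MeasurableSet.iInter fun e => hT e (Set.Ici 1)
  · exact MeasurableSet.iInter fun e =>
      UCBState.measurableSet_initializing.compl.union (hT e {1})
  · exact MeasurableSet.iInter fun e => hT e (Set.Iic (max 1 t))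

theorem ae_valid (O : Oracle Θ) (B : WeightLaw L) (t : ℕ) :
    ∀ᵐ s ∂(ucbLaw O B t), UCBState.Valid t s ∧ UCBState.u s = initWeights O t := by
  refine ae_chainLaw (p := fun t (s : UCBState L) => s.Valid t ∧ s.u = initWeights O t) (fun t => ?_)
    (measurable_ucbStep O) ?_ ?_ t
  · exact (measurableSet_valid t).inter
      (measurableSet_eq_fun UCBState.measurable_u measurable_const)
  · refine (ae_dirac_iff ?_).2 ⟨UCBState.valid_first, rfl⟩
    exact (measurableSet_valid 0).inter
      (measurableSet_eq_fun UCBState.measurable_u measurable_const)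
  · rintro t s ⟨h1, h2⟩
    filter_upwards [B.cube] with w hw
    exact ⟨h1.update _ (mask_mem_Icc _ hw), update_u_eq_initWeights O h2 _⟩

open Classical in
/-- The exponential supermartingale of the observations of the item `e`. -/
def expMart (B : WeightLaw L) (l : ℝ) (e : Fin L) (s : UCBState L) : ENNReal :=
  if s.u e = 1 then 1 else
    ENNReal.ofReal (Real.exp (l * (s.T e * (s.avg e - B.mean e)) - l ^ 2 / 8 * s.T e))

theorem measurable_expMart (B : WeightLaw L) (l : ℝ) (e : Fin L) :
    Measurable (expMart B l e) := by
  classical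
  have h1 := measurable_u_apply e
  have h2 : Measurable fun s : UCBState L => (s.T e : ℝ) :=
    measurable_from_top.comp (measurable_T_apply e)
  have h3 := measurable_avg_apply e
  unfold expMart
  refine Measurable.ite (measurableSet_eq_fun h1 measurable_const) measurable_const ?_
  fun_prop

/-- After the initialization each observation multiplies the process by an independent factor of
mean at most one. During the initialization an average may be overwritten, which is not a
supermartingale step. As it is then overwritten for all states at once, the bound simply starts
afresh. -/
theorem lintegral_expMart_le (O : Oracle Θ) (B : WeightLaw L) (l : ℝ) (e : Fin L) (t : ℕ) :
    ∫⁻ s, expMart B l e s ∂(ucbLaw O B t) ≤ 1 := by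
  induction t with
  | zero =>
    have : ucbLaw O B 0 = Measure.dirac (UCBState.first L) := rfl
    rw [this, lintegral_dirac' _ (measurable_expMart B l e)]
    simp [expMart, UCBState.first]
  | succ t ih =>
    have hsucc := lintegral_chainLaw_succ (P := B.P) (ν := Measure.dirac (UCBState.first L))
      (measurable_expMart B l e) (measurable_ucbStep O) t
    change ∫⁻ s, expMart B l e s ∂(ucbLaw O B (t + 1)) =
      ∫⁻ s, _ ∂(ucbLaw O B t) at hsucc
    rw [hsucc]
    have hae := ae_valid O B t
    have hstep : ∀ s : UCBState L, e ∉ O.solve s.query → ∀ w,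
        expMart B l e (ucbStep O s w) = expMart B l e s := fun s he w => by
      rw [ucbStep, UCBState.update]
      split_ifs <;> simp [expMart, he]
    by_cases hini : (∃ e', initWeights O t e' = 1)
    · by_cases he : e ∈ O.solve (initWeights O t)
      -- The average becomes the current weight with counter one, so the previous value of the
      -- process is irrelevant and the induction hypothesis is not used.
      · calc _ ≤ ∫⁻ s : UCBState L, 1 ∂(ucbLaw O B t) := by
              refine lintegral_mono_ae ?_
              filter_upwards [hae] with s hs
              have hi : s.Initializing := by rw [UCBState.Initializing, hs.2]; exact hini
              have hq : s.query = initWeights O t := by rw [UCBState.query, if_pos hi, hs.2]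
              refine le_trans (lintegral_mono fun w => le_of_eq ?_)
                (lintegral_exp_hoeffding B e l)
              rw [ucbStep, UCBState.update, if_pos hi, hq]
              simp [expMart, he, hs.1.T_init hi e, mask]
          _ = 1 := by simp
      · refine le_trans (lintegral_mono_ae ?_) ih
        filter_upwards [hae] with s hs
        have hi : s.Initializing := by rw [UCBState.Initializing, hs.2]; exact hini
        have hq : s.query = initWeights O t := by rw [UCBState.query, if_pos hi, hs.2]
        simp_rw [hstep s (hq ▸ he)]
        simp
    · refine le_trans (lintegral_mono_ae ?_) ih
      filter_upwards [hae] with s hs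
      have hi : ¬ s.Initializing := by rw [UCBState.Initializing, hs.2]; exact hini
      by_cases he : e ∈ O.solve s.query
      · have hu : s.u e ≠ 1 := fun h => hi ⟨e, h⟩
        have heq : ∀ w, expMart B l e (ucbStep O s w) = expMart B l e s *
            ENNReal.ofReal (Real.exp (l * (w e - B.mean e) - l ^ 2 / 8)) := fun w => by
          rw [ucbStep, UCBState.update, if_neg hi]
          simp only [expMart, hu, he, if_true, if_false, mask]
          rw [← ENNReal.ofReal_mul (Real.exp_nonneg _), ← Real.exp_add]
          congr 2
          have : ((s.T e : ℝ) + 1) ≠ 0 := by positivity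
          push_cast
          field_simp
          ring
        simp_rw [heq]
        rw [lintegral_const_mul _ (by fun_prop)]
        exact mul_le_of_le_one_right' (lintegral_exp_hoeffding B e l)
      · simp_rw [hstep s he]
        simp

/-- Markov's inequality for the exponential process with parameter `4 c`, which maximizes `l c k -
l² k / 8`. The exponent is `2 c² k = 3 log t`. The parameter depends on `k`, so the counter has to
be fixed. The sign `σ` covers both tails. -/
theorem stateLaw_deviation_le (O : Oracle Θ) (B : WeightLaw L) (e : Fin L) {t k : ℕ} (ht : 1 ≤ t)
    (hk : 1 ≤ k) {σ : ℝ} (hσ : σ ^ 2 = 1) :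
    ucbLaw O B t {s : UCBState L | ¬ s.Initializing ∧ s.T e = k ∧
      Real.sqrt (1.5 * Real.log t / k) < σ * (s.avg e - B.mean e)} ≤
        ENNReal.ofReal (1 / (t : ℝ) ^ 3) := by
  set c := Real.sqrt (1.5 * Real.log t / k) with hc
  have ht0 : (0 : ℝ) < t := by exact_mod_cast ht
  have hk0 : (0 : ℝ) < k := by exact_mod_cast hk
  have hlog : 0 ≤ Real.log t := Real.log_natCast_nonneg t
  have hc2 : c ^ 2 = 1.5 * Real.log t / k := Real.sq_sqrt (by positivity)
  have hc0 : 0 ≤ c := Real.sqrt_nonneg _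
  have hsub : {s : UCBState L | ¬ s.Initializing ∧ s.T e = k ∧
      c < σ * (s.avg e - B.mean e)} ⊆
      {s | ENNReal.ofReal ((t : ℝ) ^ 3) ≤ expMart B (4 * c * σ) e s} := by
    rintro s ⟨hi, hT, hdev⟩
    have hu : s.u e ≠ 1 := fun h => hi ⟨e, h⟩
    simp only [Set.mem_ofPred_eq, expMart, hu, if_false, hT]
    refine ENNReal.ofReal_le_ofReal ?_
    rw [← Real.exp_log (show 0 < (t : ℝ) ^ 3 by positivity)]
    refine Real.exp_le_exp.2 ?_
    rw [Real.log_pow]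
    have h1 : 4 * c * σ * (k * (s.avg e - B.mean e)) - (4 * c * σ) ^ 2 / 8 * k =
        4 * c * k * (σ * (s.avg e - B.mean e)) - 2 * (c ^ 2 * k) := by
      rw [mul_pow, mul_pow, hσ]; ring
    have h2 : c ^ 2 * k = 1.5 * Real.log t := by rw [hc2]; field_simp
    rw [h1, h2]
    have h3 : 4 * c * k * c ≤ 4 * c * k * (σ * (s.avg e - B.mean e)) :=
      mul_le_mul_of_nonneg_left hdev.le (by positivity)
    have h4 : 4 * c * k * c = 4 * (c ^ 2 * k) := by ring
    rw [h4, h2] at h3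
    push_cast
    linarith
  refine (measure_mono hsub).trans ?_
  have hne : ENNReal.ofReal ((t : ℝ) ^ 3) ≠ 0 := by
    rw [Ne, ENNReal.ofReal_eq_zero, not_le]; positivity
  refine (meas_ge_le_lintegral_div (measurable_expMart B (4 * c * σ) e).aemeasurable hne
    ENNReal.ofReal_ne_top).trans ?_
  rw [ENNReal.ofReal_div_of_pos (by positivity), ENNReal.ofReal_one]
  exact ENNReal.div_le_div_right (lintegral_expMart_le O B _ e t) _

/-- Union bound over `L` items, at most `t` values of the counter and two tails, each of probability
at most `1 / t³`. -/
theorem stateLaw_not_good_le (O : Oracle Θ) (B : WeightLaw L) (t : ℕ) :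
    ucbLaw O B t {s : UCBState L | ¬ s.Initializing ∧ ¬ s.Good B t} ≤
      ENNReal.ofReal (2 * L / (t : ℝ) ^ 2) := by
  have hae := ae_valid O B t
  rcases Nat.eq_zero_or_pos t with rfl | ht
  -- For `t = 0` division by zero makes the bound zero. The event is null because every item still
  -- has auxiliary weight one.
  · refine le_of_eq_of_le ?_ (zero_le)
    rw [measure_eq_zero_iff_ae_notMem]
    filter_upwards [hae] with s hs
    rintro ⟨h1, h2⟩
    exact h2 fun e => absurd ⟨e, hs.1.u_zero rfl e⟩ h1
  · have hsub : {s : UCBState L | ¬ s.Initializing ∧ ¬ s.Good B t} ⊆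
        {s | ¬ s.Valid t} ∪ ⋃ e ∈ (Finset.univ : Finset (Fin L)), ⋃ k ∈ Finset.Icc 1 t,
          ({s : UCBState L | ¬ s.Initializing ∧ s.T e = k ∧
            Real.sqrt (1.5 * Real.log t / k) < 1 * (s.avg e - B.mean e)} ∪
           {s : UCBState L | ¬ s.Initializing ∧ s.T e = k ∧
            Real.sqrt (1.5 * Real.log t / k) < -1 * (s.avg e - B.mean e)}) := by
      rintro s ⟨hi, hg⟩
      by_cases hv : s.Valid t
      · right
        rw [UCBState.Good] at hg
        push Not at hg
        obtain ⟨e, he⟩ := hg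
        have hT1 := hv.one_le_T e
        have hT2 := hv.T_le e
        rw [max_eq_right ht] at hT2
        simp only [Set.mem_iUnion]
        refine ⟨e, Finset.mem_univ e, s.T e, Finset.mem_Icc.2 ⟨hT1, hT2⟩, ?_⟩
        rcases lt_abs.1 he with h | h
        · exact Or.inl ⟨hi, rfl, by linarith⟩
        · exact Or.inr ⟨hi, rfl, by linarith⟩
      · exact Or.inl hv
    have hnull : ucbLaw O B t {s : UCBState L | ¬ s.Valid t} = 0 :=
      ae_iff.1 (hae.mono fun s hs => hs.1)
    have ht0 : (0 : ℝ) < t := by exact_mod_cast ht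
    calc _ ≤ 0 + ∑ e : Fin L, ∑ k ∈ Finset.Icc 1 t,
          (ENNReal.ofReal (1 / (t : ℝ) ^ 3) + ENNReal.ofReal (1 / (t : ℝ) ^ 3)) := by
          refine (measure_mono hsub).trans ((measure_union_le _ _).trans ?_)
          rw [hnull]
          refine add_le_add le_rfl ((measure_biUnion_finset_le _ _).trans
            (Finset.sum_le_sum fun e _ => (measure_biUnion_finset_le _ _).trans
            (Finset.sum_le_sum fun k hk => (measure_union_le _ _).trans (add_le_add ?_ ?_))))
          · exact stateLaw_deviation_le O B e ht (Finset.mem_Icc.1 hk).1 (by norm_num)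
          · exact stateLaw_deviation_le O B e ht (Finset.mem_Icc.1 hk).1 (by norm_num)
      _ = ENNReal.ofReal (2 * L / (t : ℝ) ^ 2) := by
          rw [zero_add, ← ENNReal.ofReal_add (by positivity) (by positivity)]
          simp only [Finset.sum_const, Nat.card_Icc, Finset.card_univ, Fintype.card_fin]
          rw [nsmul_eq_mul, nsmul_eq_mul, ← ENNReal.ofReal_natCast, ← ENNReal.ofReal_natCast,
            ← ENNReal.ofReal_mul (by positivity), ← ENNReal.ofReal_mul (by positivity)]
          congr 1
          simp only [Nat.add_sub_cancel]
          field_simp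
          ring

end Concentration

/-! ### The regret bounds of CombUCB1 -/

section Regret

variable {L : ℕ} {Θ : Finset (Finset (Fin L))} {B : WeightLaw L} {Astar : Finset (Fin L)}

theorem sum_two_mul_div_sq_le (L n : ℕ) :
    ∑ t ∈ Finset.range n, 2 * (L : ℝ) / (t : ℝ) ^ 2 ≤ Real.pi ^ 2 / 3 * L := by
  have h := sum_le_hasSum (Finset.range n) (fun t _ => by positivity) hasSum_zeta_two
  have h2 := mul_le_mul_of_nonneg_left h (show (0 : ℝ) ≤ 2 * L by positivity)
  rw [Finset.mul_sum] at h2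
  calc _ = ∑ t ∈ Finset.range n, 2 * (L : ℝ) * (1 / (t : ℝ) ^ 2) :=
        Finset.sum_congr rfl fun t _ => by ring
    _ ≤ _ := by linarith

/-- Every step is an initialization step, a step with good averages, or a step with a bad average.
The first kind costs at most `K` in at most `L` steps, the second costs `D` in total, and the third
costs `K` times a probability that is summable in `t`. -/
theorem combUCB1_regret_le_of_pathwise (hc : Covers Θ) (hopt : IsOptimal Θ B Astar)
    (O : Oracle Θ) (n : ℕ) {D : ℝ}
    (hD : ∀ (s : ℕ → UCBState L) (o : ℕ → Fin L → ℝ), (∀ t, (s t).Valid t) →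
      s 0 = UCBState.first L → (∀ t, s (t + 1) = (s t).update (O.solve (s t).query) (o t)) →
      (open Classical in ∑ t ∈ Finset.range n, if ¬ (s t).Initializing ∧ (s t).Good B t then
        gap B Astar (O.solve (s t).query) else 0) ≤ D) :
    (combUCB1 O).regret B Astar n ≤ D + (Real.pi ^ 2 / 3 + 1) * maxSize Θ * L := by
  classical
  set π := combUCB1 O with hπ
  set K : ℝ := (maxSize Θ : ℝ) with hK
  have hK0 : 0 ≤ K := Nat.cast_nonneg _
  set F : ℕ → Set π.State := fun t => {s : UCBState L | ¬ s.Initializing ∧ ¬ s.Good B t} with hF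
  have hFm : ∀ t, MeasurableSet (F t) := fun t => by
    have h2 : {s : UCBState L | s.Good B t} =
        ⋂ e, {s | |s.avg e - B.mean e| ≤ Real.sqrt (1.5 * Real.log t / s.T e)} := by
      ext s; simp [UCBState.Good]
    have h3 : MeasurableSet {s : UCBState L | s.Good B t} := by
      rw [h2]
      refine MeasurableSet.iInter fun e => measurableSet_le ?_ ?_
      · have := measurable_avg_apply e
        fun_prop
      · have h2 : Measurable fun s : UCBState L => (s.T e : ℝ) :=
          measurable_from_top.comp (measurable_T_apply e)
        fun_prop
    exact UCBState.measurableSet_initializing.compl.inter h3.compl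
  have hmp := fun t => π.measurePreserving_stateAt B t
  -- the regret as an integral over the paths
  have hgi : ∀ t, Integrable (fun x : π.State × (ℕ → Fin L → ℝ) =>
      gap B Astar (π.act (π.stateAt x.1 x.2 t))) (π.law B) := fun t =>
    (hmp t).integrable_comp_of_integrable (π.integrable_comp_act (π.stateLaw B t) (gap B Astar))
  have hgeq : ∀ t, ∫ s, gap B Astar (π.act s) ∂(π.stateLaw B t) =
      ∫ x, gap B Astar (π.act (π.stateAt x.1 x.2 t)) ∂(π.law B) := fun t => by
    have h1 := integral_map (μ := π.law B) (hmp t).measurable.aemeasurable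
      (f := fun s : π.State => gap B Astar (π.act s))
      (π.measurable_comp_act (gap B Astar)).aestronglyMeasurable
    rwa [(hmp t).map_eq] at h1
  have hFi : ∀ t, Integrable (fun x : π.State × (ℕ → Fin L → ℝ) =>
      ((fun x : π.State × (ℕ → Fin L → ℝ) => π.stateAt x.1 x.2 t) ⁻¹' (F t)).indicator
        (fun _ => (1 : ℝ)) x) (π.law B) := fun t =>
    (integrable_indicator_iff ((hmp t).measurable (hFm t))).2
      (by
        have : IsProbabilityMeasure (π.law B) := by unfold Algorithm.law; infer_instance
        exact (integrable_const (1 : ℝ)).integrableOn)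
  have hFe : ∀ t, ∫ x, ((fun x : π.State × (ℕ → Fin L → ℝ) => π.stateAt x.1 x.2 t) ⁻¹'
      (F t)).indicator (fun _ => (1 : ℝ)) x ∂(π.law B) ≤ 2 * L / (t : ℝ) ^ 2 := fun t => by
    rw [integral_indicator_const _ ((hmp t).measurable (hFm t)), smul_eq_mul, mul_one,
      measureReal_def, (hmp t).measure_preimage (hFm t).nullMeasurableSet]
    exact ENNReal.toReal_le_of_le_ofReal (by positivity) (stateLaw_not_good_le O B t)
  rw [π.regret_eq]
  simp_rw [hgeq]
  rw [← integral_finsetSum _ fun t _ => hgi t]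
  have hprob : IsProbabilityMeasure (π.law B) := by unfold Algorithm.law; infer_instance
  have hpath : ∀ᵐ x ∂(π.law B), ∑ t ∈ Finset.range n,
      gap B Astar (π.act (π.stateAt x.1 x.2 t)) ≤ (D + K * L) + K * ∑ t ∈ Finset.range n,
        ((fun x : π.State × (ℕ → Fin L → ℝ) => π.stateAt x.1 x.2 t) ⁻¹' (F t)).indicator
          (fun _ => (1 : ℝ)) x := by
    have h1 : ∀ᵐ x ∂(π.law B), (x.1 : UCBState L) = UCBState.first L := by
      have hm : MeasurableSet {s : UCBState L | s = UCBState.first L} := by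
        have : {s : UCBState L | s = UCBState.first L} =
            UCBState.toTuple ⁻¹' {(UCBState.first L).toTuple} := by
          ext s
          simp only [Set.mem_ofPred_eq, Set.mem_preimage, Set.mem_singleton_iff]
          constructor
          · rintro rfl; rfl
          · intro h
            cases s
            simp only [UCBState.toTuple, Prod.mk.injEq, UCBState.first] at h
            obtain ⟨h1, h2, h3, h4⟩ := h
            simp [UCBState.first, h1, h2, h3, h4]
        rw [this]
        exact UCBState.measurable_toTuple (measurableSet_singleton _)
      have hs : ∀ᵐ s ∂π.start, (s : UCBState L) = UCBState.first L :=
        (ae_dirac_iff hm).2 rfl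
      exact Measure.quasiMeasurePreserving_fst.ae hs
    have h2 : ∀ᵐ x ∂(π.law B), ∀ t, ∀ e, x.2 t e ∈ Set.Icc (0 : ℝ) 1 := by
      refine ae_all_iff.2 fun t => ?_
      have hq : MeasurePreserving (fun x : π.State × (ℕ → Fin L → ℝ) => x.2 t)
          (π.law B) B.P := (measurePreserving_eval_infinitePi (fun _ : ℕ => B.P) t).comp
        measurePreserving_snd
      exact hq.quasiMeasurePreserving.ae B.cube
    filter_upwards [h1, h2] with x hx1 hx2
    set s : ℕ → UCBState L := fun t => π.stateAt x.1 x.2 t with hs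
    have hs0 : s 0 = UCBState.first L := hx1
    have hsucc : ∀ t, s (t + 1) = (s t).update (O.solve (s t).query)
        (mask (O.solve (s t).query) (x.2 t)) := fun t => rfl
    have hv : ∀ t, (s t).Valid t := by
      intro t
      induction t with
      | zero => rw [hs0]; exact UCBState.valid_first
      | succ t ih => rw [hsucc]; exact ih.update _ (mask_mem_Icc _ (hx2 t))
    have hA := hD s _ hv hs0 hsucc
    have hB := mul_le_mul_of_nonneg_left (card_initializing_le O s _ hc hv hsucc n) hK0
    have hsplit : ∀ t, gap B Astar (π.act (s t)) ≤
        (if ¬ (s t).Initializing ∧ (s t).Good B t then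
          gap B Astar (O.solve (s t).query) else 0) +
        K * (if (s t).Initializing then (1 : ℝ) else 0) + K *
        ((fun x : π.State × (ℕ → Fin L → ℝ) => π.stateAt x.1 x.2 t) ⁻¹' (F t)).indicator
          (fun _ => (1 : ℝ)) x := fun t => by
      have hle : gap B Astar (π.act (s t)) ≤ K := gap_le_maxSize hopt _
      have hmem : x ∈ ((fun x : π.State × (ℕ → Fin L → ℝ) => π.stateAt x.1 x.2 t) ⁻¹' (F t)) ↔
          ¬ (s t).Initializing ∧ ¬ (s t).Good B t := Iff.rfl
      rw [Set.indicator_apply]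
      simp only [hmem]
      by_cases hi : (s t).Initializing
      · simp only [hi, not_true, false_and, if_false, if_true]; linarith
      · by_cases hg : (s t).Good B t
        · simp only [hi, hg, not_true, and_false, not_false_eq_true, and_self, if_false, if_true]
          have : gap B Astar (π.act (s t)) = gap B Astar (O.solve (s t).query) := rfl
          linarith
        · simp only [hi, hg, and_false, not_false_eq_true, and_self, if_false, if_true]; linarith
    refine (Finset.sum_le_sum fun t _ => hsplit t).trans ?_
    rw [Finset.sum_add_distrib, Finset.sum_add_distrib, ← Finset.mul_sum, ← Finset.mul_sum]
    linarith
  have hGi := (integrable_finsetSum (Finset.range n) fun t _ => hFi t).const_mul K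
  refine (integral_mono_ae (integrable_finsetSum _ fun t _ => hgi t)
    ((integrable_const (D + K * L)).add hGi) hpath).trans ?_
  refine (integral_add (integrable_const (D + K * L)) hGi).le.trans ?_
  rw [integral_const_mul, integral_finsetSum _ fun t _ => hFi t]
  have h3 := (Finset.sum_le_sum fun t (_ : t ∈ Finset.range n) => hFe t).trans
    (sum_two_mul_div_sq_le L n)
  have h4 := mul_le_mul_of_nonneg_left h3 hK0
  simp only [integral_const, probReal_univ, smul_eq_mul, one_mul]
  linarith

theorem combUCB1_regret_le (hc : Covers Θ) (hopt : IsOptimal Θ B Astar) (O : Oracle Θ) (n : ℕ) :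
    (combUCB1 O).regret B Astar n ≤
      (∑ e ∈ Finset.univ.filter (fun e => e ∉ Astar),
        (maxSize Θ : ℝ) * (534 / minGap Θ B Astar e) * Real.log n)
        + (Real.pi ^ 2 / 3 + 1) * maxSize Θ * L ∧
    (combUCB1 O).regret B Astar n ≤
      47 * Real.sqrt ((maxSize Θ : ℝ) * L * n * Real.log n)
        + (Real.pi ^ 2 / 3 + 1) * maxSize Θ * L := by
  constructor
  · refine combUCB1_regret_le_of_pathwise hc hopt O n fun s o hv h0 hs => ?_
    convert (sum_gap_good_le O s o hc hopt hv h0 hs n).1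
  · exact combUCB1_regret_le_of_pathwise hc hopt O n fun s o hv h0 hs =>
      (sum_gap_good_le O s o hc hopt hv h0 hs n).2

/-- The gap times the expected number of choices is bounded by the regret, which is logarithmic and
hence `o(n ^ α)`. -/
theorem combUCB1_consistent (hc : Covers Θ) (O : Oracle Θ) : (combUCB1 O).Consistent := by
  intro B Astar hopt A hA hne α hα
  have hg := gap_pos hopt hA hne
  set c1 := ∑ e ∈ Finset.univ.filter (fun e => e ∉ Astar),
    (maxSize Θ : ℝ) * (534 / minGap Θ B Astar e) with hc1
  set c2 := (Real.pi ^ 2 / 3 + 1) * maxSize Θ * L with hc2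
  have hbound : ∀ n, (combUCB1 O).expectedPulls B A n ≤
      (c1 * Real.log n + c2) / gap B Astar A := fun n => by
    rw [le_div_iff₀ hg, mul_comm, hc1, Finset.sum_mul]
    exact ((combUCB1 O).gap_mul_expectedPulls_le_regret hopt hA n).trans
      (combUCB1_regret_le hc hopt O n).1
  have hlog : (fun n : ℕ => Real.log n) =o[atTop] (fun n : ℕ => (n : ℝ) ^ α) :=
    (isLittleO_log_rpow_atTop hα).comp_tendsto tendsto_natCast_atTop_atTop
  have hone : (fun _ : ℕ => (1 : ℝ)) =o[atTop] (fun n : ℕ => (n : ℝ) ^ α) := by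
    refine (isLittleO_one_left_iff ℝ).2 (tendsto_norm_atTop_atTop.comp ?_)
    exact (tendsto_rpow_atTop hα).comp tendsto_natCast_atTop_atTop
  have hsum : (fun n : ℕ => (c1 * Real.log n + c2) / gap B Astar A) =o[atTop]
      (fun n : ℕ => (n : ℝ) ^ α) := by
    have := ((hlog.const_mul_left c1).add (hone.const_mul_left c2)).const_mul_left
      (gap B Astar A)⁻¹
    refine this.congr_left fun n => ?_
    simp only [mul_one]; rw [div_eq_inv_mul]
  refine IsBigO.trans_isLittleO (IsBigO.of_bound 1 (Eventually.of_forall fun n => ?_)) hsum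
  rw [one_mul, Real.norm_eq_abs, Real.norm_eq_abs,
    abs_of_nonneg ((combUCB1 O).expectedPulls_nonneg A n)]
  exact (hbound n).trans (le_abs_self _)

end Regret

/-! ### The `K`-path problem with general Bernoulli means -/

section Paths

variable {m K : ℕ}

theorem mem_path {i : Fin m} {e : Fin (m * K)} : e ∈ path K i ↔ e.divNat = i := by
  simp [path]

theorem path_eq_map (i : Fin m) : path K i = Finset.univ.map
    ⟨fun k : Fin K => finProdFinEquiv (i, k), fun a b h => by
      simpa using finProdFinEquiv.injective h⟩ := by
  ext e
  rw [mem_path, Finset.mem_map]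
  constructor
  · rintro rfl
    exact ⟨e.modNat, Finset.mem_univ _, finProdFinEquiv.apply_symm_apply e⟩
  · rintro ⟨k, -, rfl⟩
    exact congrArg Prod.fst (finProdFinEquiv.symm_apply_apply (i, k))

theorem card_path (i : Fin m) : (path K i).card = K := by
  rw [path_eq_map, Finset.card_map, Finset.card_univ, Fintype.card_fin]

theorem path_nonempty (hK : 1 ≤ K) (i : Fin m) : (path K i).Nonempty := by
  rw [← Finset.card_pos, card_path]; exact hK

theorem path_injective (hK : 1 ≤ K) : Function.Injective (path K : Fin m → _) := by
  intro i j hij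
  obtain ⟨e, he⟩ := path_nonempty hK i
  have he' := he
  rw [hij] at he'
  exact (mem_path.1 he).symm.trans (mem_path.1 he')

theorem path_mem_paths (i : Fin m) : path K i ∈ paths m K :=
  Finset.mem_image_of_mem _ (Finset.mem_univ i)

theorem mem_paths {A : Finset (Fin (m * K))} : A ∈ paths m K ↔ ∃ i, path K i = A := by
  simp [paths]

theorem covers_paths (m K : ℕ) : Covers (paths m K) := fun e =>
  ⟨path K e.divNat, path_mem_paths _, mem_path.2 rfl⟩

theorem maxSize_paths (hm : 1 ≤ m) (K : ℕ) : maxSize (paths m K) = K := by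
  refine le_antisymm (Finset.sup_le fun A hA => ?_) ?_
  · obtain ⟨i, rfl⟩ := mem_paths.1 hA
    exact (card_path i).le
  · calc K = (path K (⟨0, hm⟩ : Fin m)).card := (card_path _).symm
      _ ≤ _ := card_le_maxSize (path_mem_paths _)

theorem sum_paths (hK : 1 ≤ K) (f : Finset (Fin (m * K)) → ℝ) :
    ∑ A ∈ paths m K, f A = ∑ i, f (path K i) :=
  Finset.sum_image fun _ _ _ _ h => path_injective hK h

/-- The weights of path `k`, when it has the weight `y`, and zero for the other paths. -/
def pathObs (K : ℕ) (k : Fin m) (y : ℝ) : Fin (m * K) → ℝ := mask (path K k) fun _ => y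

/-- The law of weights that are equal on each path and independent Bernoulli variables with the
means `p` on different paths. -/
def bernLaw (K : ℕ) (p : Fin m → unitInterval) : WeightLaw (m * K) where
  P := (Measure.pi fun i : Fin m => bernoulliMeasure (1 : ℝ) 0 (p i)).map fun x e => x e.divNat
  prob := Measure.isProbabilityMeasure_map
    (measurable_pi_lambda _ fun _ => measurable_pi_apply _).aemeasurable
  cube := by
    have hmeas : Measurable fun (x : Fin m → ℝ) (e : Fin (m * K)) => x e.divNat :=
      measurable_pi_lambda _ fun _ => measurable_pi_apply _
    rw [ae_all_iff]
    intro e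
    refine (ae_map_iff hmeas.aemeasurable (measurable_pi_apply e measurableSet_Icc)).2 ?_
    refine (measurePreserving_eval (fun i : Fin m => bernoulliMeasure (1 : ℝ) 0 (p i))
      e.divNat).quasiMeasurePreserving.ae (p := fun y : ℝ =>
      y ∈ Set.Icc (0 : ℝ) 1) ?_
    rw [ae_iff]
    change bernoulliMeasure (1 : ℝ) 0 (p e.divNat) (Set.Icc (0 : ℝ) 1)ᶜ = 0
    classical
    rw [bernoulliMeasure_apply _ measurableSet_Icc.compl]
    simp

theorem pathLaw_eq_bernLaw (Δ : ℝ) (hΔ : 0 < Δ / K ∧ Δ / K < 0.5) (j : Fin m) :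
    pathLaw K Δ hΔ j = bernLaw K (pathMean K Δ hΔ j) := rfl

variable (p : Fin m → unitInterval)

theorem map_eval_bernLaw (e : Fin (m * K)) :
    (bernLaw K p).P.map (fun w => w e) = bernoulliMeasure (1 : ℝ) 0 (p e.divNat) := by
  have hmeas : Measurable fun (x : Fin m → ℝ) (e : Fin (m * K)) => x e.divNat :=
    measurable_pi_lambda _ fun _ => measurable_pi_apply _
  rw [bernLaw, Measure.map_map (measurable_pi_apply e) hmeas]
  exact (measurePreserving_eval (fun i : Fin m => bernoulliMeasure (1 : ℝ) 0 (p i)) e.divNat).map_eq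

theorem mean_bernLaw (e : Fin (m * K)) : (bernLaw K p).mean e = p e.divNat := by
  have h := integral_map (μ := (bernLaw K p).P) (measurable_pi_apply e).aemeasurable
    (f := fun y : ℝ => y) (by fun_prop)
  rw [map_eval_bernLaw, integral_bernoulliMeasure] at h
  rw [WeightLaw.mean, ← h]
  simp

theorem ret_path_bernLaw (i : Fin m) : ret (path K i) (bernLaw K p).mean = K * p i := by
  rw [ret, Finset.sum_congr rfl fun e he => by rw [mean_bernLaw, mem_path.1 he]]
  simp [card_path]

theorem gap_bernLaw (i j : Fin m) :
    gap (bernLaw K p) (path K j) (path K i) = K * (p j - p i) := by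
  rw [gap, ret_path_bernLaw, ret_path_bernLaw]; ring

theorem isOptimal_bernLaw (hK : 1 ≤ K) {j : Fin m} (h : ∀ i, i ≠ j → (p i : ℝ) < p j) :
    IsOptimal (paths m K) (bernLaw K p) (path K j) := by
  refine ⟨path_mem_paths j, fun A hA hne => ?_⟩
  obtain ⟨i, rfl⟩ := mem_paths.1 hA
  rw [ret_path_bernLaw, ret_path_bernLaw]
  have hij : i ≠ j := fun hij => hne (hij ▸ rfl)
  exact mul_lt_mul_of_pos_left (h i hij) (by exact_mod_cast hK)

theorem measurable_mask (A : Finset (Fin (m * K))) : Measurable (mask A) := by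
  refine measurable_pi_lambda _ fun e => ?_
  unfold mask
  by_cases he : e ∈ A
  · simpa [he] using measurable_pi_apply e
  · simp [he]

/-- The law of the observations after choosing path `k`. -/
theorem map_mask_bernLaw (k : Fin m) : (bernLaw K p).P.map (mask (path K k)) =
    bernoulliMeasure (pathObs K k 1) (pathObs K k 0) (p k) := by
  have hmeas : Measurable fun (x : Fin m → ℝ) (e : Fin (m * K)) => x e.divNat :=
    measurable_pi_lambda _ fun _ => measurable_pi_apply _
  have hobs : Measurable (pathObs K k) := by
    refine measurable_pi_lambda _ fun e => ?_
    unfold pathObs mask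
    by_cases he : e ∈ path K k
    · simpa [he] using measurable_id'
    · simp [he]
  have hcomp : mask (path K k) ∘ (fun (x : Fin m → ℝ) (e : Fin (m * K)) => x e.divNat) =
      pathObs K k ∘ fun x => x k := by
    ext x e
    simp only [Function.comp, pathObs, mask]
    split_ifs with he
    · rw [mem_path.1 he]
    · rfl
  rw [bernLaw, Measure.map_map (measurable_mask _) hmeas, hcomp,
    ← Measure.map_map hobs (measurable_pi_apply k),
    (measurePreserving_eval (fun i : Fin m => bernoulliMeasure (1 : ℝ) 0 (p i)) k).map_eq,
    map_bernoulliMeasure' _ _ hobs]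

theorem lintegral_mask_bernLaw (k : Fin m) {f : (Fin (m * K) → ℝ) → ENNReal} (hf : Measurable f) :
    ∫⁻ w, f (mask (path K k) w) ∂(bernLaw K p).P =
      ENNReal.ofReal (p k) * f (pathObs K k 1) + ENNReal.ofReal (1 - p k) * f (pathObs K k 0) := by
  rw [← lintegral_map hf (measurable_mask _), map_mask_bernLaw, bernoulliMeasure_def,
    lintegral_add_measure, lintegral_smul_measure, lintegral_smul_measure, lintegral_dirac' _ hf,
    lintegral_dirac' _ hf]
  have h1 : (unitInterval.toNNReal (p k) : ENNReal) = ENNReal.ofReal (p k) := by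
    rw [ENNReal.ofReal]
    congr 1
    exact NNReal.eq (Real.coe_toNNReal _ (p k).2.1).symm
  have h2 : (unitInterval.toNNReal (unitInterval.symm (p k)) : ENNReal) =
      ENNReal.ofReal (1 - p k) := by
    rw [ENNReal.ofReal]
    congr 1
    exact NNReal.eq (Real.coe_toNNReal _ (sub_nonneg.2 (p k).2.2)).symm
  rw [← h1, ← h2]
  rfl

theorem integral_mask_bernLaw (k : Fin m) {f : (Fin (m * K) → ℝ) → ℝ} (hf : Measurable f) :
    ∫ w, f (mask (path K k) w) ∂(bernLaw K p).P =
      p k * f (pathObs K k 1) + (1 - p k) * f (pathObs K k 0) := by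
  rw [← integral_map (measurable_mask _).aemeasurable hf.aestronglyMeasurable, map_mask_bernLaw,
    integral_bernoulliMeasure]
  rfl

namespace Algorithm

variable (π : Algorithm (paths m K))

theorem sum_expectedPulls (hK : 1 ≤ K) (B : WeightLaw (m * K)) (n : ℕ) :
    ∑ i, π.expectedPulls B (path K i) n = n := by
  classical
  simp_rw [expectedPulls_eq]
  rw [Finset.sum_comm]
  have : ∀ t, ∑ i : Fin m, ∫ s, (if π.act s = path K i then 1 else 0 : ℝ) ∂(π.stateLaw B t) = 1 := by
    intro t
    rw [← integral_finsetSum _ fun i _ => π.integrable_comp_act (π.stateLaw B t)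
      fun A => if A = path K i then 1 else 0]
    have h1 : ∀ s, (∑ i : Fin m, if π.act s = path K i then (1 : ℝ) else 0) = 1 := fun s => by
      obtain ⟨i, hi⟩ := mem_paths.1 (π.act_mem s)
      simp [← hi, (path_injective hK).eq_iff]
    simp [h1]
  simp [this]

end Algorithm

end Paths

/-! ### Change of measure for the `K`-path problem -/

section Track

variable {X Y Ω : Type*} [MeasurableSpace X] [MeasurableSpace Y] [MeasurableSpace Ω]

/-- A map that intertwines two recursions carries one law to the other. It ensures that bookkeeping
added to the state does not change the law of the algorithm. -/
theorem map_chainLaw {stepX : X → Ω → X} {stepY : Y → Ω → Y} {P : Measure Ω}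
    [IsProbabilityMeasure P] {ν : Measure Y} [IsProbabilityMeasure ν]
    (hX : Measurable (Function.uncurry stepX)) (hY : Measurable (Function.uncurry stepY))
    {φ : Y → X} (hφ : Measurable φ) (h : ∀ y w, φ (stepY y w) = stepX (φ y) w) (t : ℕ) :
    (chainLaw stepY P ν t).map φ = chainLaw stepX P (ν.map φ) t := by
  induction t with
  | zero => rfl
  | succ t ih =>
    have := isProbabilityMeasure_chainLaw (P := P) (ν := ν) hY t
    have h1 : MeasurePreserving (Prod.map φ id) ((chainLaw stepY P ν t).prod P)
        ((chainLaw stepX P (ν.map φ) t).prod P) := by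
      rw [← ih]
      have := Measure.isProbabilityMeasure_map (μ := chainLaw stepY P ν t) hφ.aemeasurable
      exact (MeasurePreserving.prod ⟨hφ, rfl⟩ (MeasurePreserving.id P))
    rw [chainLaw, chainLaw, Measure.map_map hφ hY, ← h1.map_eq, Measure.map_map hX h1.measurable]
    congr 1
    ext ⟨y, w⟩
    exact h y w

theorem integral_chainLaw_succ {step : X → Ω → X} {P : Measure Ω} [IsProbabilityMeasure P]
    {ν : Measure X} [IsProbabilityMeasure ν] (hs : Measurable (Function.uncurry step)) {f : X → ℝ}
    (hf : Measurable f) {t : ℕ} (hi : Integrable f (chainLaw step P ν (t + 1))) :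
    ∫ x, f x ∂(chainLaw step P ν (t + 1)) =
      ∫ x, ∫ w, f (step x w) ∂P ∂(chainLaw step P ν t) := by
  have := isProbabilityMeasure_chainLaw (P := P) (ν := ν) hs t
  rw [chainLaw] at hi ⊢
  rw [integral_map hs.aemeasurable hf.aestronglyMeasurable]
  exact integral_prod _ ((integrable_map_measure hf.aestronglyMeasurable hs.aemeasurable).1 hi)

variable {m K : ℕ} (π : Algorithm (paths m K)) (i : Fin m) (e₀ : Fin (m * K)) (a b : ℝ)

open Classical in
/-- The update of the state of the algorithm, of the number of choices of path `i`, and of the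
logarithm of the likelihood ratio, which changes by `a` or `b` when the weight of the item `e₀` of
the chosen path `i` is one or not. -/
def trackNext (z : π.State × ℕ × ℝ) (o : Fin (m * K) → ℝ) : π.State × ℕ × ℝ :=
  (π.next z.1 o, if π.act z.1 = path K i then z.2.1 + 1 else z.2.1,
    if π.act z.1 = path K i then z.2.2 + (if o e₀ = 1 then a else b) else z.2.2)

def trackStep (z : π.State × ℕ × ℝ) (w : Fin (m * K) → ℝ) : π.State × ℕ × ℝ :=
  trackNext π i e₀ a b z (mask (π.act z.1) w)

theorem measurable_trackNext : Measurable (Function.uncurry (trackNext π i e₀ a b)) := by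
  classical
  have hA : MeasurableSet {x : (π.State × ℕ × ℝ) × (Fin (m * K) → ℝ) |
      π.act x.1.1 = path K i} :=
    (π.act_meas.comp (measurable_fst.comp measurable_fst)) (measurableSet_singleton _)
  have ho : MeasurableSet {x : (π.State × ℕ × ℝ) × (Fin (m * K) → ℝ) | x.2 e₀ = 1} :=
    measurableSet_eq_fun ((measurable_pi_apply e₀).comp measurable_snd) measurable_const
  have h1 : Measurable fun x : (π.State × ℕ × ℝ) × (Fin (m * K) → ℝ) => x.1.2.1 := by fun_prop
  have h2 : Measurable fun x : (π.State × ℕ × ℝ) × (Fin (m * K) → ℝ) => x.1.2.2 := by fun_prop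
  refine Measurable.prodMk ?_ (Measurable.prodMk ?_ ?_)
  · exact π.next_meas.comp ((measurable_fst.comp measurable_fst).prodMk measurable_snd)
  · exact Measurable.ite hA (h1.add_const 1) h1
  · exact Measurable.ite hA
      (h2.add (Measurable.ite ho measurable_const measurable_const)) h2

theorem measurable_trackStep : Measurable (Function.uncurry (trackStep π i e₀ a b)) :=
  (measurable_trackNext π i e₀ a b).comp (measurable_fst.prodMk
    (measurable_mask_act (π.act_meas.comp measurable_fst)))

/-- The law of the state, the number of choices of path `i` and the logarithm of the likelihood
ratio after `t` steps. -/
def trackLaw (p : Fin m → unitInterval) (t : ℕ) : Measure (π.State × ℕ × ℝ) :=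
  chainLaw (trackStep π i e₀ a b) (bernLaw K p).P (π.start.map fun s => (s, 0, 0)) t

variable (p : Fin m → unitInterval)

instance : IsProbabilityMeasure (π.start.map fun s => (s, (0 : ℕ), (0 : ℝ))) :=
  Measure.isProbabilityMeasure_map (by fun_prop)

instance (t : ℕ) : IsProbabilityMeasure (trackLaw π i e₀ a b p t) :=
  isProbabilityMeasure_chainLaw (measurable_trackStep π i e₀ a b) t

theorem map_fst_trackLaw (t : ℕ) :
    (trackLaw π i e₀ a b p t).map Prod.fst = π.stateLaw (bernLaw K p) t := by
  rw [trackLaw, map_chainLaw π.measurable_step (measurable_trackStep π i e₀ a b) measurable_fst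
    (fun z w => rfl), Algorithm.stateLaw, Measure.map_map measurable_fst (by fun_prop)]
  congr 1
  exact Measure.map_id

theorem measurableSet_count_logRatio (t : ℕ) (C : ℝ) :
    MeasurableSet {z : π.State × ℕ × ℝ | z.2.1 ≤ t ∧ |z.2.2| ≤ C} := by
  have h1 : Measurable fun z : π.State × ℕ × ℝ => z.2.1 := by fun_prop
  have h2 : Measurable fun z : π.State × ℕ × ℝ => |z.2.2| := by fun_prop
  exact (measurableSet_le h1 measurable_const).inter (measurableSet_le h2 measurable_const)

/-- The increments are bounded, so the count, the log-ratio, the ratio and their products used below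
are almost surely bounded, hence integrable. -/
theorem ae_trackLaw (t : ℕ) : ∀ᵐ z ∂(trackLaw π i e₀ a b p t),
    z.2.1 ≤ t ∧ |z.2.2| ≤ t * (|a| + |b|) := by
  refine ae_chainLaw (p := fun t (z : π.State × ℕ × ℝ) => z.2.1 ≤ t ∧ |z.2.2| ≤ t * (|a| + |b|))
    (fun t => ?_) (measurable_trackStep π i e₀ a b) ?_ (fun t z hz => ae_of_all _ fun w => ?_) t
  · exact measurableSet_count_logRatio π t _
  · rw [ae_map_iff (by fun_prop) (measurableSet_count_logRatio π 0 _)]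
    simp
  · obtain ⟨h1, h2⟩ := hz
    simp only [trackStep, trackNext]
    have ha := abs_nonneg a
    have hb := abs_nonneg b
    push_cast
    constructor
    · split_ifs <;> omega
    · split_ifs
      · exact (abs_add_le _ _).trans (by linarith)
      · exact (abs_add_le _ _).trans (by linarith)
      · linarith

theorem integrable_trackLaw {f : π.State × ℕ × ℝ → ℝ} (hf : Measurable f) {t : ℕ} {C : ℝ}
    (h : ∀ z : π.State × ℕ × ℝ, z.2.1 ≤ t → |z.2.2| ≤ t * (|a| + |b|) → |f z| ≤ C) :
    Integrable f (trackLaw π i e₀ a b p t) := by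
  refine Integrable.of_bound hf.aestronglyMeasurable C ?_
  filter_upwards [ae_trackLaw π i e₀ a b p t] with z hz
  exact h z hz.1 hz.2

theorem measurable_count : Measurable fun z : π.State × ℕ × ℝ => (z.2.1 : ℝ) :=
  measurable_from_top.comp (measurable_fst.comp measurable_snd)

theorem integrable_count (t : ℕ) :
    Integrable (fun z => (z.2.1 : ℝ)) (trackLaw π i e₀ a b p t) :=
  integrable_trackLaw π i e₀ a b p (measurable_count π) (C := t) fun z h _ => by
    rw [abs_of_nonneg (Nat.cast_nonneg _)]; exact_mod_cast h

theorem integrable_logRatio (t : ℕ) :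
    Integrable (fun z => z.2.2) (trackLaw π i e₀ a b p t) :=
  integrable_trackLaw π i e₀ a b p (by fun_prop) fun z _ h => h

theorem integrable_ratio (t : ℕ) :
    Integrable (fun z => Real.exp z.2.2) (trackLaw π i e₀ a b p t) :=
  integrable_trackLaw π i e₀ a b p (by fun_prop) (C := Real.exp (t * (|a| + |b|))) fun z _ h => by
    rw [Real.abs_exp]; exact Real.exp_le_exp.2 ((le_abs_self _).trans h)

theorem integrable_ratio_mul_count (t : ℕ) :
    Integrable (fun z => Real.exp z.2.2 * z.2.1) (trackLaw π i e₀ a b p t) :=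
  integrable_trackLaw π i e₀ a b p ((by fun_prop : Measurable fun z : π.State × ℕ × ℝ =>
    Real.exp z.2.2).mul (measurable_count π)) (C := Real.exp (t * (|a| + |b|)) * t) fun z h1 h => by
    rw [Pi.mul_apply, abs_mul, Real.abs_exp, abs_of_nonneg (Nat.cast_nonneg _)]
    exact mul_le_mul (Real.exp_le_exp.2 ((le_abs_self _).trans h)) (by exact_mod_cast h1)
      (Nat.cast_nonneg _) (Real.exp_nonneg _)

theorem integral_trackLaw_succ {f g : π.State × ℕ × ℝ → ℝ} (hf : Measurable f) {t : ℕ}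
    (hi : Integrable f (trackLaw π i e₀ a b p (t + 1)))
    (hg : ∀ z k, π.act z.1 = path K k → (p k : ℝ) * f (trackNext π i e₀ a b z (pathObs K k 1)) +
      (1 - p k) * f (trackNext π i e₀ a b z (pathObs K k 0)) = g z) :
    ∫ z, f z ∂(trackLaw π i e₀ a b p (t + 1)) = ∫ z, g z ∂(trackLaw π i e₀ a b p t) := by
  refine (integral_chainLaw_succ (measurable_trackStep π i e₀ a b) hf hi).trans
    (integral_congr_ae (ae_of_all _ fun z => ?_))
  obtain ⟨k, hk⟩ := mem_paths.1 (π.act_mem z.1)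
  simp only [trackStep, ← hg z k hk.symm]
  rw [← hk]
  exact integral_mask_bernLaw p k
    (hf.comp ((measurable_trackNext π i e₀ a b).comp measurable_prodMk_left))

theorem lintegral_trackLaw_succ {f g : π.State × ℕ × ℝ → ENNReal} (hf : Measurable f) {t : ℕ}
    (hg : ∀ z k, π.act z.1 = path K k →
      ENNReal.ofReal (p k) * f (trackNext π i e₀ a b z (pathObs K k 1)) +
      ENNReal.ofReal (1 - p k) * f (trackNext π i e₀ a b z (pathObs K k 0)) = g z) :
    ∫⁻ z, f z ∂(trackLaw π i e₀ a b p (t + 1)) = ∫⁻ z, g z ∂(trackLaw π i e₀ a b p t) := by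
  refine (lintegral_chainLaw_succ hf (measurable_trackStep π i e₀ a b) t).trans
    (lintegral_congr fun z => ?_)
  obtain ⟨k, hk⟩ := mem_paths.1 (π.act_mem z.1)
  simp only [trackStep, ← hg z k hk.symm]
  rw [← hk]
  exact lintegral_mask_bernLaw p k
    (hf.comp ((measurable_trackNext π i e₀ a b).comp measurable_prodMk_left))

open Classical in
theorem integral_act_trackLaw (c : ℝ) (t : ℕ) :
    ∫ z, (if π.act z.1 = path K i then c else 0) ∂(trackLaw π i e₀ a b p t) =
      c * ∫ s, (if π.act s = path K i then 1 else 0 : ℝ) ∂(π.stateLaw (bernLaw K p) t) := by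
  rw [← map_fst_trackLaw π i e₀ a b, ← integral_const_mul, integral_map measurable_fst.aemeasurable
    (((π.measurable_comp_act fun A => if A = path K i then (1 : ℝ) else 0)).const_mul
      c).aestronglyMeasurable]
  simp

open Classical in
theorem integrable_act_trackLaw (c : ℝ) (t : ℕ) :
    Integrable (fun z => if π.act z.1 = path K i then c else 0) (trackLaw π i e₀ a b p t) :=
  integrable_trackLaw π i e₀ a b p ((π.measurable_comp_act fun A =>
    if A = path K i then c else 0).comp measurable_fst) (C := |c|) fun z _ _ => by
      simp only [Function.comp]; split_ifs <;> simp

theorem integral_trackLaw_zero {f : π.State × ℕ × ℝ → ℝ} (hf : Measurable f)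
    (h : ∀ s, f (s, 0, 0) = 0) : ∫ z, f z ∂(trackLaw π i e₀ a b p 0) = 0 := by
  rw [trackLaw, chainLaw, integral_map (by fun_prop) hf.aestronglyMeasurable]
  simp [h]

theorem integral_count (n : ℕ) :
    ∫ z, (z.2.1 : ℝ) ∂(trackLaw π i e₀ a b p n) =
      π.expectedPulls (bernLaw K p) (path K i) n := by
  classical
  rw [π.expectedPulls_eq]
  induction n with
  | zero => simpa using integral_trackLaw_zero π i e₀ a b p (measurable_count π) (by simp)
  | succ n ih =>
    rw [integral_trackLaw_succ π i e₀ a b p (measurable_count π)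
      (integrable_count π i e₀ a b p _)
      (g := fun z => z.2.1 + if π.act z.1 = path K i then 1 else 0),
      integral_add (integrable_count π i e₀ a b p n) (integrable_act_trackLaw π i e₀ a b p 1 n),
      ih, integral_act_trackLaw, Finset.sum_range_succ, one_mul]
    intro z k _
    simp only [trackNext]
    split_ifs <;> push_cast <;> ring

variable {e₀}

theorem pathObs_self (he : e₀ ∈ path K i) (y : ℝ) : pathObs K i y e₀ = y := by
  simp [pathObs, mask, he]

/-- Wald's identity: each choice of path `i` adds a fresh increment with mean `p a + (1 - p) b`. For
`a = log (q / p)` and `b = log ((1 - q) / (1 - p))` this mean is minus the Kullback–Leibler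
divergence. -/
theorem integral_logRatio (hK : 1 ≤ K) (he : e₀ ∈ path K i) (n : ℕ) :
    ∫ z, z.2.2 ∂(trackLaw π i e₀ a b p n) =
      (p i * a + (1 - p i) * b) * π.expectedPulls (bernLaw K p) (path K i) n := by
  classical
  rw [π.expectedPulls_eq]
  induction n with
  | zero =>
    rw [Finset.range_zero, Finset.sum_empty, mul_zero]
    exact integral_trackLaw_zero π i e₀ a b p (by fun_prop) fun _ => rfl
  | succ n ih =>
    rw [integral_trackLaw_succ π i e₀ a b p (by fun_prop)
      (integrable_logRatio π i e₀ a b p _)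
      (g := fun z => z.2.2 + if π.act z.1 = path K i then (p i * a + (1 - p i) * b : ℝ) else 0),
      integral_add (integrable_logRatio π i e₀ a b p n) (integrable_act_trackLaw π i e₀ a b p _ n),
      ih, integral_act_trackLaw, Finset.sum_range_succ, mul_add]
    intro z k hk
    simp only [trackNext, hk, (path_injective hK).eq_iff]
    split_ifs with h1 h2 h3 h4 <;> (try subst h1) <;> simp_all [pathObs_self] <;> ring

variable {p} {q : Fin m → unitInterval}

/-- The likelihood ratio of the observations with respect to the change of the mean of path `i`. -/
theorem lintegral_trackLaw_change (hK : 1 ≤ K) (he : e₀ ∈ path K i) (hpq : ∀ k, k ≠ i → q k = p k)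
    (ha : (q i : ℝ) = p i * Real.exp a) (hb : 1 - (q i : ℝ) = (1 - p i) * Real.exp b) (t : ℕ)
    {f : π.State × ℕ × ℝ → ENNReal} (hf : Measurable f) :
    ∫⁻ z, f z ∂(trackLaw π i e₀ a b q t) =
      ∫⁻ z, ENNReal.ofReal (Real.exp z.2.2) * f z ∂(trackLaw π i e₀ a b p t) := by
  induction t generalizing f with
  | zero =>
    rw [trackLaw, trackLaw, chainLaw, chainLaw, lintegral_map (by fun_prop) (by fun_prop),
      lintegral_map (by fun_prop) (by fun_prop)]
    simp
  | succ t ih =>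
    classical
    -- The last step is integrated out under `q`, the induction hypothesis moves the earlier steps
    -- to `p`, and the last step is then restored under `p`.
    let g : π.State × ℕ × ℝ → ENNReal := fun z =>
      ∫⁻ w, f (trackStep π i e₀ a b z w) ∂(bernLaw K q).P
    have hgm : Measurable g := (hf.comp (measurable_trackStep π i e₀ a b)).lintegral_prod_right'
    have hg : ∀ z k, π.act z.1 = path K k →
      ENNReal.ofReal (q k) * f (trackNext π i e₀ a b z (pathObs K k 1)) +
      ENNReal.ofReal (1 - q k) * f (trackNext π i e₀ a b z (pathObs K k 0)) = g z := fun z k hk => by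
      simp only [g, trackStep, hk]
      exact (lintegral_mask_bernLaw q k
        (hf.comp ((measurable_trackNext π i e₀ a b).comp measurable_prodMk_left))).symm
    rw [lintegral_trackLaw_succ π i e₀ a b q hf hg, ih hgm]
    symm
    refine lintegral_trackLaw_succ π i e₀ a b p (by fun_prop) fun z k hk => ?_
    rw [← hg z k hk]
    have hexp : ∀ x y : ℝ, ENNReal.ofReal (Real.exp (x + y)) =
        ENNReal.ofReal (Real.exp x) * ENNReal.ofReal (Real.exp y) := fun x y => by
      rw [Real.exp_add, ENNReal.ofReal_mul (Real.exp_nonneg _)]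
    have hl : ∀ o, (trackNext π i e₀ a b z o).2.2 =
      if π.act z.1 = path K i then z.2.2 + (if o e₀ = 1 then a else b) else z.2.2 := fun o => rfl
    rw [hl, hl]
    -- For the changed path, `exp a` and `exp b` convert the two outcome probabilities of `p` into
    -- those of `q`. The other paths have equal means and leave the ratio alone.
    by_cases hki : k = i
    · subst hki
      rw [if_pos hk, if_pos hk, pathObs_self k he, pathObs_self k he, if_pos rfl,
        if_neg zero_ne_one, hexp, hexp, hb, ha, ENNReal.ofReal_mul (p k).2.1,
        ENNReal.ofReal_mul (sub_nonneg.2 (p k).2.2)]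
      ring
    · have hne : π.act z.1 ≠ path K i := fun h => hki (path_injective hK (hk.symm.trans h))
      rw [if_neg hne, if_neg hne, hpq k hki]
      ring

theorem trackLaw_eq_withDensity (hK : 1 ≤ K) (he : e₀ ∈ path K i) (hpq : ∀ k, k ≠ i → q k = p k)
    (ha : (q i : ℝ) = p i * Real.exp a) (hb : 1 - (q i : ℝ) = (1 - p i) * Real.exp b) (t : ℕ) :
    trackLaw π i e₀ a b q t =
      (trackLaw π i e₀ a b p t).withDensity fun z => ENNReal.ofReal (Real.exp z.2.2) := by
  ext S hS
  rw [withDensity_apply _ hS, ← lintegral_indicator_one hS,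
    lintegral_trackLaw_change π i a b hK he hpq ha hb t (measurable_one.indicator hS),
    ← lintegral_indicator hS]
  refine lintegral_congr fun z => ?_
  by_cases hz : z ∈ S <;> simp [hz]

theorem integral_trackLaw_change (hK : 1 ≤ K) (he : e₀ ∈ path K i) (hpq : ∀ k, k ≠ i → q k = p k)
    (ha : (q i : ℝ) = p i * Real.exp a) (hb : 1 - (q i : ℝ) = (1 - p i) * Real.exp b) (t : ℕ)
    (f : π.State × ℕ × ℝ → ℝ) :
    ∫ z, f z ∂(trackLaw π i e₀ a b q t) =
      ∫ z, Real.exp z.2.2 * f z ∂(trackLaw π i e₀ a b p t) := by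
  rw [trackLaw_eq_withDensity π i a b hK he hpq ha hb,
    integral_withDensity_eq_integral_toReal_smul (by fun_prop) (by simp)]
  refine integral_congr_ae (ae_of_all _ fun z => ?_)
  simp only [ENNReal.toReal_ofReal (Real.exp_nonneg _), smul_eq_mul]

/-- Pointwise form of the Bretagnolle–Huber inequality, which can be integrated without Jensen or
Cauchy–Schwarz. With `x = exp a` and `r = exp (l / 2)`, the tangent of the exponential gives `x² (1
+ l/2 - a) ≤ x r`, and the rest is completing squares. -/
theorem min_one_exp_ge (l a : ℝ) :
    Real.exp (2 * a) * ((1 + l / 2 - a) - (1 + Real.exp l) / 4) ≤ min 1 (Real.exp l) := by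
  have h1 : Real.exp a * (1 + l / 2 - a) ≤ Real.exp (l / 2) := by
    have := Real.add_one_le_exp (l / 2 - a)
    calc _ ≤ Real.exp a * Real.exp (l / 2 - a) :=
          mul_le_mul_of_nonneg_left (by linarith) (Real.exp_nonneg _)
      _ = _ := by rw [← Real.exp_add]; congr 1; ring
  have h2 : Real.exp (2 * a) = Real.exp a ^ 2 := by rw [← Real.exp_nat_mul]; norm_num
  have h3 : Real.exp l = Real.exp (l / 2) ^ 2 := by rw [← Real.exp_nat_mul]; congr 1; ring
  have hx := Real.exp_pos a
  have hr := Real.exp_pos (l / 2)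
  rw [h2, h3]
  set x := Real.exp a
  set r := Real.exp (l / 2)
  have h4 : x ^ 2 * (1 + l / 2 - a) ≤ x * r := by
    calc x ^ 2 * (1 + l / 2 - a) = x * (x * (1 + l / 2 - a)) := by ring
      _ ≤ _ := mul_le_mul_of_nonneg_left h1 hx.le
  refine le_min ?_ ?_
  · nlinarith [sq_nonneg (1 - x * r / 2), sq_nonneg x]
  · nlinarith [sq_nonneg (r - x / 2), sq_nonneg (x * r)]

theorem integral_ratio (hK : 1 ≤ K) (he : e₀ ∈ path K i) (hpq : ∀ k, k ≠ i → q k = p k)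
    (ha : (q i : ℝ) = p i * Real.exp a) (hb : 1 - (q i : ℝ) = (1 - p i) * Real.exp b) (n : ℕ) :
    ∫ z, Real.exp z.2.2 ∂(trackLaw π i e₀ a b p n) = 1 := by
  have := integral_trackLaw_change π i a b hK he hpq ha hb n (fun _ => 1)
  simpa using this.symm

theorem integral_affine (hK : 1 ≤ K) (he : e₀ ∈ path K i) (hpq : ∀ k, k ≠ i → q k = p k)
    (ha : (q i : ℝ) = p i * Real.exp a) (hb : 1 - (q i : ℝ) = (1 - p i) * Real.exp b) (n : ℕ)
    (x y c : ℝ) :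
    ∫ z, (x + (y * z.2.2 + c * Real.exp z.2.2)) ∂(trackLaw π i e₀ a b p n) =
      x + (y * ((p i * a + (1 - p i) * b) * π.expectedPulls (bernLaw K p) (path K i) n) + c) := by
  have i1 := (integrable_ratio π i e₀ a b p n).const_mul c
  have i2 := (integrable_logRatio π i e₀ a b p n).const_mul y
  have h1 : Integrable (fun z => y * z.2.2 + c * Real.exp z.2.2) (trackLaw π i e₀ a b p n) :=
    i2.add i1
  rw [integral_add (integrable_const x) h1, integral_add i2 i1, integral_const_mul,
    integral_const_mul, integral_ratio π i a b hK he hpq ha hb, integral_logRatio π i a b p hK he]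
  simp

/-- A path cannot be chosen rarely under `p` and often under `q`, if the laws are close. -/
theorem half_mul_exp_le_expectedPulls (hK : 1 ≤ K) (he : e₀ ∈ path K i)
    (hpq : ∀ k, k ≠ i → q k = p k)
    (ha : (q i : ℝ) = p i * Real.exp a) (hb : 1 - (q i : ℝ) = (1 - p i) * Real.exp b) (n : ℕ) :
    (n : ℝ) / 2 * Real.exp ((p i * a + (1 - p i) * b) *
      π.expectedPulls (bernLaw K p) (path K i) n) ≤
      π.expectedPulls (bernLaw K p) (path K i) n +
        (n - π.expectedPulls (bernLaw K q) (path K i) n) := by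
  have hone := integral_ratio π i a b hK he hpq ha hb n
  have haff := integral_affine π i a b hK he hpq ha hb n
  have hN := integral_count π i e₀ a b p n
  have hN' := integral_count π i e₀ a b q n
  rw [integral_trackLaw_change π i a b hK he hpq ha hb] at hN'
  have i1 := integrable_ratio π i e₀ a b p n
  have i2 := integrable_logRatio π i e₀ a b p n
  have i3 := integrable_count π i e₀ a b p n
  have i4 := integrable_ratio_mul_count π i e₀ a b p n
  set E := (p i * a + (1 - p i) * b) * π.expectedPulls (bernLaw K p) (path K i) n with hE
  set μ := trackLaw π i e₀ a b p n with hμ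
  -- With the ratio `M` and the count `T ≤ n`, `T + (n - T) M ≥ n min(1, M)`. The count thus serves
  -- as a randomized test between the two laws.
  have hpt : ∀ᵐ z ∂μ, (n : ℝ) * (Real.exp E * ((1 + z.2.2 / 2 - E / 2) -
      (1 + Real.exp z.2.2) / 4)) ≤
      z.2.1 + (n * Real.exp z.2.2 - Real.exp z.2.2 * z.2.1) := by
    filter_upwards [ae_trackLaw π i e₀ a b p n] with z hz
    have h1 := min_one_exp_ge z.2.2 (E / 2)
    rw [show 2 * (E / 2) = E by ring] at h1
    have hn : (z.2.1 : ℝ) ≤ n := by exact_mod_cast hz.1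
    have h0 : (0 : ℝ) ≤ z.2.1 := Nat.cast_nonneg _
    refine (mul_le_mul_of_nonneg_left h1 (Nat.cast_nonneg n)).trans ?_
    rcases le_total 1 (Real.exp z.2.2) with h | h
    · rw [min_eq_left h]; nlinarith
    · rw [min_eq_right h]; nlinarith
  have j1 : Integrable (fun z => n * Real.exp z.2.2 - Real.exp z.2.2 * z.2.1) μ :=
    (i1.const_mul (n : ℝ)).sub i4
  have hI := integral_mono_ae (((((integrable_const (1 : ℝ)).add (i2.div_const 2)).sub
    (integrable_const (E / 2))).sub (((integrable_const (1 : ℝ)).add i1).div_const 4)).const_mul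
      (Real.exp E) |>.const_mul (n : ℝ)) (i3.add j1) hpt
  -- The log-ratio has mean `E` and the ratio has mean one, so the bracket integrates to `1 - 1/2`.
  have e1 : ∫ z, (n : ℝ) * (Real.exp E * ((1 + z.2.2 / 2 - E / 2) -
      (1 + Real.exp z.2.2) / 4)) ∂μ = n * (Real.exp E * (1 / 2)) := by
    rw [integral_const_mul, integral_const_mul, ← show ∫ z, ((3 / 4 - E / 2) + (1 / 2 * z.2.2 +
      -1 / 4 * Real.exp z.2.2)) ∂μ = ∫ z, ((1 + z.2.2 / 2 - E / 2) -
      (1 + Real.exp z.2.2) / 4) ∂μ from integral_congr_ae (ae_of_all _ fun z => by ring), haff]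
    ring
  have e2 : ∫ z, (z.2.1 : ℝ) + (n * Real.exp z.2.2 - Real.exp z.2.2 * z.2.1) ∂μ =
      π.expectedPulls (bernLaw K p) (path K i) n +
        (n - π.expectedPulls (bernLaw K q) (path K i) n) := by
    rw [integral_add i3 j1, integral_sub (i1.const_mul (n : ℝ)) i4,
      integral_const_mul, hone, hN, hN', mul_one]
  have hI' := (e1.symm.le.trans hI).trans e2.le
  linarith

/-- The difference of the two sides vanishes at 1 and its derivative `(x - 1)³ / (x (2 x + 1)²)`
changes sign there. -/
theorem log_le_pade {y : ℝ} (hy : 0 < y) : Real.log y ≤ (y - 1) * (y + 5) / (4 * y + 2) := by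
  let h : ℝ → ℝ := fun y => (y - 1) * (y + 5) / (4 * y + 2) - Real.log y
  have hd : ∀ x : ℝ, 0 < x → HasDerivAt h ((x - 1) ^ 3 / (x * (2 * x + 1) ^ 2)) x := by
    intro x hx
    have h1 : HasDerivAt (fun y : ℝ => (y - 1) * (y + 5)) (1 * (x + 5) + (x - 1) * 1) x :=
      ((hasDerivAt_id x).sub_const 1).mul ((hasDerivAt_id x).add_const 5)
    have h2 : HasDerivAt (fun y : ℝ => 4 * y + 2) (4 * 1) x :=
      ((hasDerivAt_id x).const_mul 4).add_const 2
    have h3 := (h1.div h2 (by positivity)).sub (Real.hasDerivAt_log hx.ne')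
    refine h3.congr_deriv ?_
    have : 4 * x + 2 ≠ 0 := by positivity
    have : 2 * x + 1 ≠ 0 := by positivity
    rw [show 4 * x + 2 = 2 * (2 * x + 1) by ring]
    field_simp
    ring
  have h1 : h 1 = 0 := by simp [h]
  suffices 0 ≤ h y by simpa [h] using this
  rcases le_total 1 y with hy1 | hy1
  · have hm : MonotoneOn h (Set.Icc 1 y) := by
      refine monotoneOn_of_deriv_nonneg (convex_Icc _ _)
        (fun x hx => (hd x (by linarith [hx.1])).continuousAt.continuousWithinAt)
        (fun x hx => ?_) fun x hx => ?_
      · rw [interior_Icc] at hx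
        exact (hd x (by linarith [hx.1])).differentiableAt.differentiableWithinAt
      · rw [interior_Icc] at hx
        have hx0 : 0 < x := by linarith [hx.1]
        have hx1 : 0 ≤ x - 1 := by linarith [hx.1]
        rw [(hd x hx0).deriv]; positivity
    rw [← h1]
    exact hm (Set.left_mem_Icc.2 hy1) (Set.right_mem_Icc.2 hy1) hy1
  · have hm : AntitoneOn h (Set.Icc y 1) := by
      refine antitoneOn_of_deriv_nonpos (convex_Icc _ _)
        (fun x hx => (hd x (by linarith [hx.1])).continuousAt.continuousWithinAt)
        (fun x hx => ?_) fun x hx => ?_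
      · rw [interior_Icc] at hx
        exact (hd x (by linarith [hx.1])).differentiableAt.differentiableWithinAt
      · rw [interior_Icc] at hx
        have hx0 : 0 < x := by linarith [hx.1]
        have hx1 : x - 1 ≤ 0 := by linarith [hx.2]
        rw [(hd x hx0).deriv]
        refine div_nonpos_of_nonpos_of_nonneg ?_ (by positivity)
        exact Odd.pow_nonpos (by decide) hx1
    rw [← h1]
    exact hm (Set.left_mem_Icc.2 hy1) (Set.right_mem_Icc.2 hy1) hy1

/-- Pointwise form of Pinsker's inequality. `log_le_pade` gives `(M - 1)² ≤ X Y` with `X = (2 + 4 M)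
/ 3` and `Y = M - 1 - l`, and the arithmetic-geometric mean inequality splits the product. For a
likelihood ratio `M`, `X` has mean two and `Y` has the divergence as its mean. The free `c` keeps
the bound linear in the divergence, which suits the summation over paths. -/
theorem abs_exp_sub_one_le (l : ℝ) {c : ℝ} (hc : 0 < c) :
    |Real.exp l - 1| ≤
      1 / 2 * (c * ((2 + 4 * Real.exp l) / 3) + (Real.exp l - 1 - l) / c) := by
  have hM := Real.exp_pos l
  have h1 := log_le_pade hM
  rw [Real.log_exp] at h1
  set M := Real.exp l
  have hY : 3 * (M - 1) ^ 2 / (2 + 4 * M) ≤ M - 1 - l := by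
    have : 3 * (M - 1) ^ 2 / (2 + 4 * M) = M - 1 - (M - 1) * (M + 5) / (4 * M + 2) := by
      field_simp; ring
    linarith
  have hX : 0 < (2 + 4 * M) / 3 := by positivity
  have hXY : (M - 1) ^ 2 ≤ (2 + 4 * M) / 3 * (M - 1 - l) := by
    calc (M - 1) ^ 2 = (2 + 4 * M) / 3 * (3 * (M - 1) ^ 2 / (2 + 4 * M)) := by field_simp
      _ ≤ _ := mul_le_mul_of_nonneg_left hY hX.le
  have hY0 : 0 ≤ M - 1 - l := le_trans (by positivity) hY
  set X := (2 + 4 * M) / 3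
  set Y := M - 1 - l
  refine abs_le_of_sq_le_sq (hXY.trans ?_) (by positivity)
  have : X * Y = (c * X) * (Y / c) := by field_simp
  rw [this]
  nlinarith [sq_nonneg (c * X - Y / c)]

/-- The expected number of choices of a path under `q` is not much larger than under `p`, if the
laws are close. -/
theorem expectedPulls_le_add (hK : 1 ≤ K) (he : e₀ ∈ path K i)
    (hpq : ∀ k, k ≠ i → q k = p k)
    (ha : (q i : ℝ) = p i * Real.exp a) (hb : 1 - (q i : ℝ) = (1 - p i) * Real.exp b) (n : ℕ)
    {c : ℝ} (hc : 0 < c) :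
    π.expectedPulls (bernLaw K q) (path K i) n ≤
      π.expectedPulls (bernLaw K p) (path K i) n + n / 2 * (c - (p i * a + (1 - p i) * b) *
        π.expectedPulls (bernLaw K p) (path K i) n / (2 * c)) := by
  have hone := integral_ratio π i a b hK he hpq ha hb n
  have haff := integral_affine π i a b hK he hpq ha hb n
  have hN := integral_count π i e₀ a b p n
  have hN' := integral_count π i e₀ a b q n
  rw [integral_trackLaw_change π i a b hK he hpq ha hb] at hN'
  have i1 := integrable_ratio π i e₀ a b p n
  have i2 := integrable_logRatio π i e₀ a b p n
  have i3 := integrable_count π i e₀ a b p n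
  have i4 := integrable_ratio_mul_count π i e₀ a b p n
  set E := (p i * a + (1 - p i) * b) * π.expectedPulls (bernLaw K p) (path K i) n with hE
  set μ := trackLaw π i e₀ a b p n with hμ
  have hpt : ∀ᵐ z ∂μ, Real.exp z.2.2 * z.2.1 - z.2.1 ≤ (n : ℝ) / 2 * (Real.exp z.2.2 - 1) +
      n / 2 * (1 / 2 * (c * ((2 + 4 * Real.exp z.2.2) / 3) +
        (Real.exp z.2.2 - 1 - z.2.2) / c)) := by
    filter_upwards [ae_trackLaw π i e₀ a b p n] with z hz
    have h1 := abs_exp_sub_one_le z.2.2 hc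
    have hn : (z.2.1 : ℝ) ≤ n := by exact_mod_cast hz.1
    have h0 : (0 : ℝ) ≤ z.2.1 := Nat.cast_nonneg _
    have h2 := mul_le_mul_of_nonneg_left h1 (show (0 : ℝ) ≤ n / 2 by positivity)
    -- Centering the count at `n / 2` halves its range. The correction has mean zero because the
    -- ratio has mean one.
    have h3 : (z.2.1 - n / 2 : ℝ) * (Real.exp z.2.2 - 1) ≤ n / 2 * |Real.exp z.2.2 - 1| := by
      refine (le_abs_self _).trans ?_
      rw [abs_mul]
      exact mul_le_mul_of_nonneg_right (abs_le.2 ⟨by linarith, by linarith⟩) (abs_nonneg _)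
    linarith
  have j1 : Integrable (fun z => (n : ℝ) / 2 * (Real.exp z.2.2 - 1)) μ :=
    (i1.sub (integrable_const 1)).const_mul _
  have j2 : Integrable (fun z => c * ((2 + 4 * Real.exp z.2.2) / 3)) μ :=
    (((integrable_const 2).add (i1.const_mul 4)).div_const 3).const_mul c
  have j3 : Integrable (fun z => (Real.exp z.2.2 - 1 - z.2.2) / c) μ :=
    ((i1.sub (integrable_const 1)).sub i2).div_const c
  have j4 : Integrable (fun z => (n : ℝ) / 2 * (1 / 2 * (c * ((2 + 4 * Real.exp z.2.2) / 3) +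
        (Real.exp z.2.2 - 1 - z.2.2) / c))) μ := ((j2.add j3).const_mul _).const_mul _
  have hI := integral_mono_ae (i4.sub i3) (j1.add j4) hpt
  have e1 : ∫ z, (Real.exp z.2.2 * z.2.1 - z.2.1) ∂μ =
      π.expectedPulls (bernLaw K q) (path K i) n - π.expectedPulls (bernLaw K p) (path K i) n := by
    rw [integral_sub i4 i3, hN, hN']
  have e2 : ∫ z, ((n : ℝ) / 2 * (Real.exp z.2.2 - 1) +
      n / 2 * (1 / 2 * (c * ((2 + 4 * Real.exp z.2.2) / 3) +
        (Real.exp z.2.2 - 1 - z.2.2) / c))) ∂μ = n / 2 * (c - E / (2 * c)) := by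
    rw [← show ∫ z, ((n / 2 * (-1 + c / 3 - 1 / (2 * c))) + (-(n / (4 * c)) * z.2.2 +
      (n / 2 * (1 + 2 * c / 3 + 1 / (2 * c))) * Real.exp z.2.2)) ∂μ = _ from
      integral_congr_ae (ae_of_all _ fun z => by field_simp; ring), haff]
    field_simp
    ring
  have hI' := (e1.symm.le.trans hI).trans e2.le
  linarith

end Track

/-! ### Lower bounds for the `K`-path problem -/

/-- The Kullback–Leibler divergence is at most the chi-square divergence, by `log x ≥ 1 - 1/x`
applied to both ratios. -/
theorem neg_chiSq_le_logRatio {p q : ℝ} (hp : 0 < p) (hp1 : p < 1) (hq : 0 < q) (hq1 : q < 1) :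
    -((p - q) ^ 2 / (q * (1 - q))) ≤
      p * Real.log (q / p) + (1 - p) * Real.log ((1 - q) / (1 - p)) := by
  have hp' : 0 < 1 - p := by linarith
  have hq' : 0 < 1 - q := by linarith
  have h1 := Real.one_sub_inv_le_log_of_pos (div_pos hq hp)
  have h2 := Real.one_sub_inv_le_log_of_pos (div_pos hq' hp')
  have h3 := mul_le_mul_of_nonneg_left h1 hp.le
  have h4 := mul_le_mul_of_nonneg_left h2 hp'.le
  have h5 : p * (1 - (q / p)⁻¹) + (1 - p) * (1 - ((1 - q) / (1 - p))⁻¹) =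
      -((p - q) ^ 2 / (q * (1 - q))) := by
    rw [inv_div, inv_div]
    field_simp
    ring
  linarith

/-- The chi-square bound would give `4 δ²`, too much for the constant `1 / 5` in
`sum_regret_pathLaw_ge`. The sharper logarithm estimate gives `δ² (18 - 16 δ²) / (9 - 16 δ²)`. -/
theorem neg_sq_le_logRatio_half {δ : ℝ} (h0 : 0 < δ) (h1 : δ ≤ 1 / 4) :
    -(2.4 * δ ^ 2) ≤ (1 / 2 - δ) * Real.log (1 / 2 / (1 / 2 - δ)) +
      (1 - (1 / 2 - δ)) * Real.log ((1 - 1 / 2) / (1 - (1 / 2 - δ))) := by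
  have e1 : Real.log (1 / 2 / (1 / 2 - δ)) = - Real.log (1 - 2 * δ) := by
    rw [← Real.log_inv]; congr 1
    have : 1 - 2 * δ ≠ 0 := by linarith
    have : 1 / 2 - δ ≠ 0 := by linarith
    field_simp
  have e2 : Real.log ((1 - 1 / 2) / (1 - (1 / 2 - δ))) = - Real.log (1 + 2 * δ) := by
    rw [← Real.log_inv]; congr 1
    have : 1 + 2 * δ ≠ 0 := by linarith
    rw [show 1 - (1 / 2 - δ) = (1 + 2 * δ) / 2 by ring]
    field_simp
    norm_num
  have l1 := log_le_pade (show 0 < 1 - 2 * δ by linarith)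
  have l2 := log_le_pade (show 0 < 1 + 2 * δ by linarith)
  have m1 := mul_le_mul_of_nonneg_left l1 (show 0 ≤ 1 / 2 - δ by linarith)
  have m2 := mul_le_mul_of_nonneg_left l2 (show 0 ≤ 1 / 2 + δ by linarith)
  rw [e1, e2]
  have key : (1 / 2 - δ) * ((1 - 2 * δ - 1) * (1 - 2 * δ + 5) / (4 * (1 - 2 * δ) + 2)) +
      (1 / 2 + δ) * ((1 + 2 * δ - 1) * (1 + 2 * δ + 5) / (4 * (1 + 2 * δ) + 2)) ≤
      2.4 * δ ^ 2 := by
    have d1 : 0 < 3 - 4 * δ := by linarith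
    have d2 : 0 < 3 + 4 * δ := by linarith
    have heq : (1 / 2 - δ) * ((1 - 2 * δ - 1) * (1 - 2 * δ + 5) / (4 * (1 - 2 * δ) + 2)) +
      (1 / 2 + δ) * ((1 + 2 * δ - 1) * (1 + 2 * δ + 5) / (4 * (1 + 2 * δ) + 2)) =
      δ ^ 2 * ((18 - 16 * δ ^ 2) / ((3 - 4 * δ) * (3 + 4 * δ))) := by
      rw [show 4 * (1 - 2 * δ) + 2 = 2 * (3 - 4 * δ) by ring,
        show 4 * (1 + 2 * δ) + 2 = 2 * (3 + 4 * δ) by ring, mul_div_assoc', mul_div_assoc',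
        mul_div_assoc', div_add_div _ _ (by positivity) (by positivity),
        div_eq_div_iff (by positivity) (by positivity)]
      ring
    rw [heq, mul_comm]
    refine mul_le_mul_of_nonneg_right ?_ (sq_nonneg δ)
    rw [div_le_iff₀ (mul_pos d1 d2)]
    nlinarith
  linarith

/-! ### Asymptotic and finite-time lower bounds, and their comparison with CombUCB1. -/

section

variable {m K : ℕ}

/-- Division by zero yields zero, so positivity of `Δ / K` excludes `K = 0`. -/
theorem one_le_of_gap {Δ : ℝ} (hΔ : 0 < Δ / K ∧ Δ / K < 0.5) : 1 ≤ K := by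
  rcases Nat.eq_zero_or_pos K with rfl | h
  · simp at hΔ
  · exact h

theorem isOptimal_pathLaw (Δ : ℝ) (hΔ : 0 < Δ / K ∧ Δ / K < 0.5) (j : Fin m) :
    IsOptimal (paths m K) (pathLaw K Δ hΔ j) (path K j) := by
  rw [pathLaw_eq_bernLaw]
  refine isOptimal_bernLaw _ (one_le_of_gap hΔ) fun i hi => ?_
  simp only [pathMean, hi, if_false, if_true]
  linarith [hΔ.1]

theorem gap_pathLaw (Δ : ℝ) (hΔ : 0 < Δ / K ∧ Δ / K < 0.5) {i j : Fin m} (h : i ≠ j) :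
    gap (pathLaw K Δ hΔ j) (path K j) (path K i) = Δ := by
  have hK : (K : ℝ) ≠ 0 := by
    have := one_le_of_gap hΔ
    positivity
  rw [pathLaw_eq_bernLaw, gap_bernLaw]
  simp only [pathMean, h, if_false, if_true]
  field_simp
  ring

theorem regret_pathLaw (π : Algorithm (paths m K)) (Δ : ℝ) (hΔ : 0 < Δ / K ∧ Δ / K < 0.5)
    (j : Fin m) (n : ℕ) :
    π.regret (pathLaw K Δ hΔ j) (path K j) n =
      ∑ i ∈ Finset.univ.erase j, Δ * π.expectedPulls (pathLaw K Δ hΔ j) (path K i) n := by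
  rw [π.regret_eq_sum_pulls, sum_paths (one_le_of_gap hΔ),
    ← Finset.add_sum_erase _ _ (Finset.mem_univ j), gap_self, zero_mul, zero_add]
  exact Finset.sum_congr rfl fun i hi => by rw [gap_pathLaw Δ hΔ (Finset.ne_of_mem_erase hi)]

theorem minGap_pathLaw (Δ : ℝ) (hΔ : 0 < Δ / K ∧ Δ / K < 0.5) {j : Fin m} {e : Fin (m * K)}
    (he : e ∉ path K j) : minGap (paths m K) (pathLaw K Δ hΔ j) (path K j) e = Δ := by
  obtain ⟨A, hA, heA, -, h⟩ :=
    exists_minGap_eq (covers_paths m K) (isOptimal_pathLaw Δ hΔ j) he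
  obtain ⟨i, rfl⟩ := mem_paths.1 hA
  rw [h, gap_pathLaw Δ hΔ (by rintro rfl; exact he heA)]

/-- The instance-dependent lower bound on the number of choices of a suboptimal path. -/
theorem eventually_mul_log_le_expectedPulls {π : Algorithm (paths m K)} (hπ : π.Consistent)
    (Δ : ℝ) (hΔ : 0 < Δ / K ∧ Δ / K < 0.5) {i j : Fin m} (hij : i ≠ j) {c : ℝ}
    (hc : 4 * (Δ / K) ^ 2 * c < 1) :
    ∀ᶠ n : ℕ in atTop,
      c * Real.log n ≤ π.expectedPulls (pathLaw K Δ hΔ j) (path K i) n := by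
  have hK := one_le_of_gap hΔ
  rcases le_or_gt c 0 with hc0 | hc0
  · exact Eventually.of_forall fun n =>
      (mul_nonpos_of_nonpos_of_nonneg hc0 (Real.log_natCast_nonneg n)).trans
        (π.expectedPulls_nonneg _ n)
  have hopt := isOptimal_pathLaw Δ hΔ j
  obtain ⟨δ, hδ⟩ : ∃ δ, δ = Δ / K := ⟨_, rfl⟩
  have hδ0 : 0 < δ := hδ ▸ hΔ.1
  have hδ1 : δ < 1 / 2 := by rw [hδ]; linarith [hΔ.2]
  rw [← hδ] at hc
  -- Path `i` is raised slightly above `1 / 2`, since at `1 / 2` it would tie with path `j` and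
  -- consistency would say nothing. As `ε` tends to zero the chi-square divergence tends to `4 δ²`,
  -- so the strict inequality `hc` survives.
  obtain ⟨ε, hε0, hε1, hχ⟩ : ∃ ε : ℝ, 0 < ε ∧ ε < 1 / 2 ∧
      (1 / 2 - δ - (1 / 2 + ε)) ^ 2 / ((1 / 2 + ε) * (1 - (1 / 2 + ε))) * c < 1 := by
    have hcont : ContinuousAt (fun ε : ℝ => (1 / 2 - δ - (1 / 2 + ε)) ^ 2 /
        ((1 / 2 + ε) * (1 - (1 / 2 + ε))) * c) 0 := by
      refine ContinuousAt.mul (ContinuousAt.div (by fun_prop) (by fun_prop) (by norm_num))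
        continuousAt_const
    have h0 : (fun ε : ℝ => (1 / 2 - δ - (1 / 2 + ε)) ^ 2 /
        ((1 / 2 + ε) * (1 - (1 / 2 + ε))) * c) 0 < 1 := by
      have : (1 / 2 - δ - (1 / 2 + 0)) ^ 2 / ((1 / 2 + 0) * (1 - (1 / 2 + 0))) * c =
        4 * δ ^ 2 * c := by ring
      simp only [this]; exact hc
    have h1 := (hcont.eventually_lt_const h0).filter_mono
      (nhdsWithin_le_nhds (s := Set.Ioi (0 : ℝ)))
    have h2 : ∀ᶠ ε : ℝ in 𝓝[>] 0, ε ∈ Set.Ioo (0 : ℝ) (1 / 2) :=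
      Ioo_mem_nhdsGT (by norm_num)
    obtain ⟨ε, h3, h4⟩ := (h1.and h2).exists
    exact ⟨ε, h4.1, h4.2, h3⟩
  set χ := (1 / 2 - δ - (1 / 2 + ε)) ^ 2 / ((1 / 2 + ε) * (1 - (1 / 2 + ε))) with hχdef
  -- Chosen so that `n * n ^ (-(χ c)) = n ^ (2 α)`, which exceeds the `o(n ^ α)` errors allowed by
  -- consistency under both laws.
  set α := (1 - χ * c) / 2 with hα
  have hα0 : 0 < α := by rw [hα]; linarith
  set p := pathMean K Δ hΔ j with hp
  have hpi : (p i : ℝ) = 1 / 2 - δ := by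
    simp only [hp, pathMean, hij, if_false, hδ]; norm_num
  have hpj : ∀ k, (p k : ℝ) ≤ 1 / 2 := fun k => by
    simp only [hp, pathMean]; split_ifs
    · norm_num
    · have := hΔ.1; norm_num; linarith
  let q : Fin m → unitInterval := Function.update p i ⟨1 / 2 + ε, by linarith, by linarith⟩
  have hqi : (q i : ℝ) = 1 / 2 + ε := by simp [q]
  have hpq : ∀ k, k ≠ i → q k = p k := fun k hk => by simp [q, hk]
  have hoptq : IsOptimal (paths m K) (bernLaw K q) (path K i) :=
    isOptimal_bernLaw _ hK fun k hk => by
      rw [hqi, hpq k hk]; linarith [hpj k]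
  obtain ⟨e₀, he⟩ := path_nonempty hK i
  have hp0 : 0 < 1 / 2 - δ := by linarith
  have hp1 : 1 / 2 - δ < 1 := by linarith
  have hκ := neg_chiSq_le_logRatio hp0 hp1 (q := 1 / 2 + ε) (by linarith) (by linarith)
  rw [← hχdef] at hκ
  have hmain := half_mul_exp_le_expectedPulls π i
    (Real.log ((1 / 2 + ε) / (1 / 2 - δ))) (Real.log ((1 - (1 / 2 + ε)) / (1 - (1 / 2 - δ))))
    (p := p) (q := q) hK he hpq
    (by
      rw [Real.exp_log (div_pos (by linarith) hp0), hqi, hpi, mul_div_cancel₀ _ hp0.ne'])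
    (by
      have : 0 < 1 - (1 / 2 - δ) := by linarith
      rw [Real.exp_log (div_pos (by linarith) this), hqi, hpi, mul_div_cancel₀ _ this.ne'])
  rw [hpi] at hmain
  have hT : (fun n : ℕ => π.expectedPulls (bernLaw K p) (path K i) n) =o[atTop]
      (fun n : ℕ => (n : ℝ) ^ α) :=
    hπ _ _ hopt _ (path_mem_paths i) (fun h => hij (path_injective hK h)) α hα0
  have hS : (fun n : ℕ => (n : ℝ) - π.expectedPulls (bernLaw K q) (path K i) n) =o[atTop]
      (fun n : ℕ => (n : ℝ) ^ α) := by
    have : ∀ n : ℕ, (n : ℝ) - π.expectedPulls (bernLaw K q) (path K i) n =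
        ∑ k ∈ Finset.univ.erase i, π.expectedPulls (bernLaw K q) (path K k) n := fun n => by
      rw [← π.sum_expectedPulls hK (bernLaw K q) n,
        ← Finset.add_sum_erase _ _ (Finset.mem_univ i)]
      ring
    simp_rw [this]
    exact IsLittleO.fun_sum fun k hk => hπ _ _ hoptq _ (path_mem_paths k)
      (fun h => Finset.ne_of_mem_erase hk (path_injective hK h)) α hα0
  have hTS := (hT.add hS).def one_pos
  have hbig : ∀ᶠ n : ℕ in atTop, 2 < (n : ℝ) ^ α :=
    ((tendsto_rpow_atTop hα0).comp tendsto_natCast_atTop_atTop).eventually_gt_atTop 2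
  filter_upwards [hTS, hbig, eventually_ge_atTop 1] with n h1 h2 h3
  have hn : (0 : ℝ) < n := by exact_mod_cast h3
  by_contra! hcon
  have hcon' : π.expectedPulls (bernLaw K p) (path K i) n < c * Real.log n := hcon
  have hχ0 : 0 ≤ χ := by
    have : 0 < 1 - (1 / 2 + ε) := by linarith
    positivity
  have hT0 := π.expectedPulls_nonneg (B := bernLaw K p) (path K i) n
  rw [one_mul, Real.norm_eq_abs, Real.norm_eq_abs, 
    abs_of_nonneg (Real.rpow_nonneg hn.le α)] at h1
  have h4 := (hmain n).trans ((le_abs_self _).trans h1)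
  have h5 : (n : ℝ) ^ (-(χ * c)) ≤ Real.exp (((1 / 2 - δ) *
      Real.log ((1 / 2 + ε) / (1 / 2 - δ)) + (1 - (1 / 2 - δ)) *
      Real.log ((1 - (1 / 2 + ε)) / (1 - (1 / 2 - δ)))) *
      π.expectedPulls (bernLaw K p) (path K i) n) := by
    rw [Real.rpow_def_of_pos hn]
    refine Real.exp_le_exp.2 ?_
    have h6 := mul_le_mul_of_nonneg_right hκ hT0
    have h7 := mul_le_mul_of_nonneg_left hcon'.le hχ0
    linarith
  have h6 := (mul_le_mul_of_nonneg_left h5 (show (0 : ℝ) ≤ n / 2 by positivity)).trans h4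
  -- Together with `h6` this forces `n ^ α ≤ 2`, against `h2`.
  have h7 : (n : ℝ) * (n : ℝ) ^ (-(χ * c)) = (n : ℝ) ^ α * (n : ℝ) ^ α := by
    rw [← Real.rpow_add hn]
    nth_rewrite 1 [← Real.rpow_one (n : ℝ)]
    rw [← Real.rpow_add hn]
    congr 1; rw [hα]; ring
  nlinarith

theorem le_liminf_regret {π : Algorithm (paths m K)} (hπ : π.Consistent)
    (Δ : ℝ) (hΔ : 0 < Δ / K ∧ Δ / K < 0.5) (j : Fin m) :
    (((((m * K : ℕ) : ℝ) - K) * K / (4 * Δ) : ℝ) : EReal) ≤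
      Filter.liminf (fun n : ℕ =>
        ((π.regret (pathLaw K Δ hΔ j) (path K j) n / Real.log n : ℝ) : EReal)) Filter.atTop := by
  have hK := one_le_of_gap hΔ
  have hK0 : (0 : ℝ) < K := by exact_mod_cast hK
  have hΔ0 : 0 < Δ := by
    have := mul_pos hΔ.1 hK0
    rwa [div_mul_cancel₀ _ hK0.ne'] at this
  have key : ∀ c : ℝ, 4 * (Δ / K) ^ 2 * c < 1 → ((((m : ℝ) - 1) * Δ * c : ℝ) : EReal) ≤
      Filter.liminf (fun n : ℕ =>
        ((π.regret (pathLaw K Δ hΔ j) (path K j) n / Real.log n : ℝ) : EReal)) Filter.atTop := by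
    intro c hc
    refine Filter.le_liminf_of_le (by isBoundedDefault) ?_
    have h1 : ∀ᶠ n : ℕ in atTop, ∀ i ∈ Finset.univ.erase j,
        c * Real.log n ≤ π.expectedPulls (pathLaw K Δ hΔ j) (path K i) n :=
      (Finset.eventually_all _).2 fun i hi =>
        eventually_mul_log_le_expectedPulls hπ Δ hΔ (Finset.ne_of_mem_erase hi) hc
    filter_upwards [h1, eventually_ge_atTop 2] with n h2 h3
    have hlog : 0 < Real.log n := Real.log_pos (by exact_mod_cast h3)
    refine EReal.coe_le_coe_iff.2 ?_
    rw [le_div_iff₀ hlog, regret_pathLaw]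
    have hcard : ((Finset.univ.erase j).card : ℝ) = m - 1 := by
      rw [Finset.card_erase_of_mem (Finset.mem_univ j), Finset.card_univ, Fintype.card_fin,
        Nat.cast_sub (by have := j.2; omega)]
      simp
    calc ((m : ℝ) - 1) * Δ * c * Real.log n =
        ∑ i ∈ Finset.univ.erase j, Δ * (c * Real.log n) := by
          rw [Finset.sum_const, nsmul_eq_mul, hcard]; ring
      _ ≤ _ := Finset.sum_le_sum fun i hi => mul_le_mul_of_nonneg_left (h2 i hi) hΔ0.le
  -- The bound on the choices holds only for `c` strictly below `1 / (4 (Δ/K)²)`, so the sharp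
  -- constant is reached along a sequence.
  have hlim : Tendsto (fun k : ℕ => ((((m : ℝ) - 1) * Δ *
      ((1 - 1 / ((k : ℝ) + 1)) / (4 * (Δ / K) ^ 2)) : ℝ) : EReal)) atTop
      (𝓝 (((((m * K : ℕ) : ℝ) - K) * K / (4 * Δ) : ℝ) : EReal)) := by
    refine EReal.tendsto_coe.2 ?_
    have h1 := ((tendsto_one_div_add_atTop_nhds_zero_nat (𝕜 := ℝ)).const_sub 1).div_const
      (4 * (Δ / K) ^ 2) |>.const_mul (((m : ℝ) - 1) * Δ)
    convert h1 using 2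
    push_cast
    field_simp
    ring
  refine le_of_tendsto' hlim fun k => key _ ?_
  have : 4 * (Δ / K) ^ 2 ≠ 0 := by positivity
  rw [mul_div_cancel₀ _ this]
  have : 0 < 1 / ((k : ℝ) + 1) := by positivity
  linarith

/-- All `L - K` items outside of the optimal path have minimum gap `Δ`, so the leading constant is
`534 K (L - K) / Δ`, and `534 * 4 = 2136`. The additive term vanishes after division by `log n`. -/
theorem limsup_combUCB1_regret_le (Δ : ℝ) (hΔ : 0 < Δ / K ∧ Δ / K < 0.5) (j : Fin m)
    (O : Oracle (paths m K)) :
    Filter.limsup (fun n : ℕ =>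
      (((combUCB1 O).regret (pathLaw K Δ hΔ j) (path K j) n / Real.log n : ℝ) : EReal))
      Filter.atTop ≤ ((2136 * ((((m * K : ℕ) : ℝ) - K) * K / (4 * Δ)) : ℝ) : EReal) := by
  have hK := one_le_of_gap hΔ
  set D : ℝ := 2136 * ((((m * K : ℕ) : ℝ) - K) * K / (4 * Δ)) with hD
  set c2 := (Real.pi ^ 2 / 3 + 1) * maxSize (paths m K) * (m * K : ℕ) with hc2
  have hsum : ∀ n : ℕ, (∑ e ∈ Finset.univ.filter (fun e => e ∉ path K j),
      (maxSize (paths m K) : ℝ) * (534 / minGap (paths m K) (pathLaw K Δ hΔ j) (path K j) e) *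
        Real.log n) = D * Real.log n := fun n => by
    have hcard : ((Finset.univ.filter (fun e => e ∉ path K j)).card : ℝ) = (m * K : ℕ) - K := by
      have h := Finset.card_compl (path K j)
      have hle : K ≤ m * K := Nat.le_mul_of_pos_left K (by have := j.2; omega)
      rw [card_path, Fintype.card_fin] at h
      rw [← Nat.cast_sub hle, ← h]
      congr 2
      ext e; simp
    rw [Finset.sum_congr rfl fun e he => by
      rw [minGap_pathLaw Δ hΔ (Finset.mem_filter.1 he).2,
        maxSize_paths (by have := j.2; omega) K]]
    rw [Finset.sum_const, nsmul_eq_mul, hcard, hD]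
    ring
  have hle : ∀ᶠ n : ℕ in atTop,
      (((combUCB1 O).regret (pathLaw K Δ hΔ j) (path K j) n / Real.log n : ℝ) : EReal) ≤
        ((D + c2 / Real.log n : ℝ) : EReal) := by
    filter_upwards [eventually_ge_atTop 2] with n h3
    have hlog : 0 < Real.log n := Real.log_pos (by exact_mod_cast h3)
    refine EReal.coe_le_coe_iff.2 ?_
    have h := (combUCB1_regret_le (covers_paths m K) (isOptimal_pathLaw Δ hΔ j) O n).1
    rw [hsum] at h
    rw [div_le_iff₀ hlog, add_mul, div_mul_cancel₀ _ hlog.ne']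
    exact h
  have hlim : Tendsto (fun n : ℕ => ((D + c2 / Real.log n : ℝ) : EReal)) atTop
      (𝓝 (D : EReal)) := by
    refine EReal.tendsto_coe.2 ?_
    have := ((Real.tendsto_log_atTop.comp tendsto_natCast_atTop_atTop).const_div_atTop c2).const_add
      D
    simpa using this
  exact (Filter.limsup_le_limsup hle).trans hlim.limsup_eq.le

/-- The average regret over the position of the optimal path. -/
theorem sum_regret_pathLaw_ge (hm : 2 ≤ m) (Δ : ℝ) (hΔ : 0 < Δ / K ∧ Δ / K < 0.5)
    (h4 : Δ / K ≤ 1 / 4) {n : ℕ} (hn : (Δ / K) ^ 2 * n ≤ m / 16) (π : Algorithm (paths m K)) :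
    (1 / 5 : ℝ) * (Δ * n) * m ≤ ∑ j : Fin m, π.regret (pathLaw K Δ hΔ j) (path K j) n := by
  have hK := one_le_of_gap hΔ
  have hK0 : (0 : ℝ) < K := by exact_mod_cast hK
  have hΔ0 : 0 < Δ := by
    have := mul_pos hΔ.1 hK0
    rwa [div_mul_cancel₀ _ hK0.ne'] at this
  obtain ⟨δ, hδ⟩ : ∃ δ, δ = Δ / K := ⟨_, rfl⟩
  have hδ0 : 0 < δ := hδ ▸ hΔ.1
  rw [← hδ] at h4 hn
  -- A reference law without an optimal path. It differs from each problem only in the mean of path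
  -- `j`, and its choices sum to `n` over all `j`.
  let p : Fin m → unitInterval := fun _ => ⟨1 / 2 - δ, by linarith, by linarith⟩
  set T : Fin m → ℝ := fun j => π.expectedPulls (bernLaw K p) (path K j) n with hT
  have hreg : ∀ j, π.regret (pathLaw K Δ hΔ j) (path K j) n =
      Δ * (n - π.expectedPulls (pathLaw K Δ hΔ j) (path K j) n) := fun j => by
    have h := π.sum_expectedPulls hK (pathLaw K Δ hΔ j) n
    rw [← Finset.add_sum_erase _ _ (Finset.mem_univ j)] at h
    rw [regret_pathLaw, ← Finset.mul_sum, ← h]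
    ring
  have hp0 : 0 < 1 / 2 - δ := by linarith
  have hpulls : ∀ j, π.expectedPulls (pathLaw K Δ hΔ j) (path K j) n ≤
      T j + n / 2 * (1 / 4 + 4.8 * δ ^ 2 * T j) := fun j => by
    obtain ⟨e₀, he⟩ := path_nonempty hK j
    have hpj : (p j : ℝ) = 1 / 2 - δ := rfl
    have hqj : (pathMean K Δ hΔ j j : ℝ) = 1 / 2 := by
      simp only [pathMean, if_true]; norm_num
    have h := expectedPulls_le_add π j
      (Real.log (1 / 2 / (1 / 2 - δ))) (Real.log ((1 - 1 / 2) / (1 - (1 / 2 - δ))))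
      (p := p) (q := pathMean K Δ hΔ j) hK he
      (fun k hk => by
        simp only [pathMean, hk, if_false, p]
        ext; norm_num [hδ])
      (by
        rw [Real.exp_log (div_pos (by norm_num) hp0), hqj, hpj, mul_div_cancel₀ _ hp0.ne'])
      (by
        have : 0 < 1 - (1 / 2 - δ) := by linarith
        rw [Real.exp_log (div_pos (by norm_num) this), hqj, hpj, mul_div_cancel₀ _ this.ne'])
      n (c := 1 / 4) (by norm_num)
    rw [hpj] at h
    rw [pathLaw_eq_bernLaw]
    refine h.trans ?_
    have hκ := neg_sq_le_logRatio_half hδ0 h4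
    have hT0 : 0 ≤ T j := π.expectedPulls_nonneg _ n
    have h6 := mul_le_mul_of_nonneg_right hκ hT0
    have hn0 : (0 : ℝ) ≤ n / 2 := by positivity
    have h7 : (1 / 4 : ℝ) - ((1 / 2 - δ) * Real.log (1 / 2 / (1 / 2 - δ)) +
        (1 - (1 / 2 - δ)) * Real.log ((1 - 1 / 2) / (1 - (1 / 2 - δ)))) * T j / (2 * (1 / 4)) ≤
        1 / 4 + 4.8 * δ ^ 2 * T j := by
      rw [show (2 : ℝ) * (1 / 4) = 1 / 2 by norm_num]
      linarith
    have h8 := mul_le_mul_of_nonneg_left h7 hn0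
    linarith
  have hsumT : ∑ j, T j = n := π.sum_expectedPulls hK _ n
  have hsum : ∑ j : Fin m, π.expectedPulls (pathLaw K Δ hΔ j) (path K j) n ≤
      n + n / 2 * (m / 4 + 4.8 * δ ^ 2 * n) := by
    refine (Finset.sum_le_sum fun j _ => hpulls j).trans (le_of_eq ?_)
    rw [Finset.sum_add_distrib, ← Finset.mul_sum, Finset.sum_add_distrib, ← Finset.mul_sum, hsumT]
    simp only [Finset.sum_const, Finset.card_univ, Fintype.card_fin, nsmul_eq_mul]
    ring
  simp_rw [hreg]
  rw [← Finset.mul_sum, Finset.sum_sub_distrib]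
  simp only [Finset.sum_const, Finset.card_univ, Fintype.card_fin, nsmul_eq_mul]
  have hn0 : (0 : ℝ) ≤ n := Nat.cast_nonneg n
  have hm' : (2 : ℝ) ≤ m := by exact_mod_cast hm
  have h1 := mul_le_mul_of_nonneg_left hn hn0
  have h2 := mul_le_mul_of_nonneg_right hm' hn0
  -- The subtracted sum is at most `n + n m (1/8 + 2.4/16)`. As `n ≤ n m / 2`, at least `0.225 n m`
  -- remains.
  have h3 : (1 / 5 : ℝ) * n * m ≤ m * n - ∑ j : Fin m,
      π.expectedPulls (pathLaw K Δ hΔ j) (path K j) n := by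
    nlinarith
  calc (1 / 5 : ℝ) * (Δ * n) * m = Δ * ((1 / 5 : ℝ) * n * m) := by ring
    _ ≤ _ := mul_le_mul_of_nonneg_left h3 hΔ0.le

/-- The gap per item is `√(m / n) / 4`, the largest with `δ² n ≤ m / 16`, or `1 / 4` if `n ≤ m`. In
the first case `4 δ n = √(m n)`, in the second `4 δ n = n`. -/
theorem exists_gap_sum_regret_ge (n : ℕ) (hm : 2 ≤ m) (hK : 1 ≤ K) :
    ∃ (Δ : ℝ) (hΔ : 0 < Δ / K ∧ Δ / K < 0.5), ∀ π : Algorithm (paths m K),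
      (1 / 20 : ℝ) * min (Real.sqrt ((K : ℝ) * (m * K : ℕ) * n)) ((K : ℝ) * n) ≤
        (∑ j : Fin m, π.regret (pathLaw K Δ hΔ j) (path K j) n) / m := by
  have hK0 : (0 : ℝ) < K := by exact_mod_cast hK
  have hm0 : (0 : ℝ) < m := by positivity
  have hsq : Real.sqrt ((K : ℝ) * (m * K : ℕ) * n) = K * Real.sqrt (m * n) := by
    rw [show (K : ℝ) * (m * K : ℕ) * n = K ^ 2 * (m * n) by push_cast; ring,
      Real.sqrt_mul (by positivity), Real.sqrt_sq hK0.le]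
  suffices h : ∃ δ : ℝ, 0 < δ ∧ δ ≤ 1 / 4 ∧ δ ^ 2 * n ≤ m / 16 ∧
      min (Real.sqrt (m * n)) n ≤ 4 * δ * n by
    obtain ⟨δ, h1, h2, h3, h4⟩ := h
    have hdiv : (K : ℝ) * δ / K = δ := by field_simp
    have hΔ : 0 < (K : ℝ) * δ / K ∧ (K : ℝ) * δ / K < 0.5 := by
      rw [hdiv]; exact ⟨h1, by norm_num; linarith⟩
    refine ⟨K * δ, hΔ, fun π => ?_⟩
    have h5 := sum_regret_pathLaw_ge hm (K * δ) hΔ (by rw [hdiv]; exact h2)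
      (by rw [hdiv]; exact h3) π
    rw [le_div_iff₀ hm0]
    refine le_trans ?_ h5
    refine mul_le_mul_of_nonneg_right ?_ hm0.le
    rw [hsq, ← mul_min_of_nonneg _ _ hK0.le]
    have := mul_le_mul_of_nonneg_left h4 hK0.le
    linarith
  rcases le_or_gt n m with hnm | hnm
  · have : (n : ℝ) ≤ m := by exact_mod_cast hnm
    refine ⟨1 / 4, by norm_num, le_rfl, by linarith, (min_le_right _ _).trans (by linarith)⟩
  · have hmn : (m : ℝ) ≤ n := by exact_mod_cast hnm.le
    have hn0 : (0 : ℝ) < n := hm0.trans_le hmn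
    refine ⟨Real.sqrt (m / n) / 4, by positivity, ?_, ?_, (min_le_left _ _).trans (le_of_eq ?_)⟩
    · have : Real.sqrt (m / n) ≤ 1 := Real.sqrt_le_one.2 ((div_le_one hn0).2 hmn)
      linarith
    · rw [div_pow, Real.sq_sqrt (by positivity)]
      refine le_of_eq ?_
      field_simp
      norm_num
    · rw [show (m : ℝ) * n = m / n * n ^ 2 by field_simp, Real.sqrt_mul (by positivity),
        Real.sqrt_sq hn0.le]
      ring

/-- Some `j` has at least the average regret, and it depends only on `R`, not on the semi-bandit.
Since `K L ≤ n`, the minimum is `s = √(K L n)` and the additive term is at most `5 s`. As `√(log n)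
≥ 1/2`, CombUCB1 has regret at most `57 s √(log n)`, and `s ≤ 20 R j`. -/
theorem exists_combUCB1_regret_le {n : ℕ} (hm : 2 ≤ m) (hK : 1 ≤ K) (hn : K * (m * K) ≤ n)
    {R : Fin m → ℝ}
    (hR : (1 / 20 : ℝ) * min (Real.sqrt ((K : ℝ) * (m * K : ℕ) * n)) ((K : ℝ) * n) ≤
      (∑ j : Fin m, R j) / m) :
    ∃ j : Fin m, ∀ Θ : Finset (Finset (Fin (m * K))), Covers Θ → maxSize Θ = K →
      ∀ (B : WeightLaw (m * K)) (Astar : Finset (Fin (m * K))), IsOptimal Θ B Astar →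
      ∀ O : Oracle Θ,
        (combUCB1 O).regret B Astar n ≤ 2000 * Real.sqrt (Real.log n) * R j := by
  have hK0 : (1 : ℝ) ≤ K := by exact_mod_cast hK
  have hm0 : (0 : ℝ) < m := by positivity
  have hn' : (K : ℝ) * (m * K : ℕ) ≤ n := by exact_mod_cast hn
  have hKL0 : (0 : ℝ) ≤ (K : ℝ) * (m * K : ℕ) := by positivity
  set s := Real.sqrt ((K : ℝ) * (m * K : ℕ) * n) with hs
  have hs0 : 0 ≤ s := Real.sqrt_nonneg _
  have hmin : min s ((K : ℝ) * n) = s := by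
    refine min_eq_left (Real.sqrt_le_iff.2 ⟨by positivity, ?_⟩)
    have hn0 : (0 : ℝ) ≤ n := Nat.cast_nonneg n
    calc (K : ℝ) * (m * K : ℕ) * n ≤ n * n := mul_le_mul_of_nonneg_right hn' hn0
      _ ≤ (K * n) ^ 2 := by
        rw [sq]
        have := le_mul_of_one_le_left hn0 hK0
        exact mul_self_le_mul_self hn0 this
  rw [hmin, le_div_iff₀ hm0] at hR
  obtain ⟨j, -, hj⟩ := Finset.exists_le_of_sum_le (s := (Finset.univ : Finset (Fin m)))
    ⟨⟨0, by omega⟩, Finset.mem_univ _⟩ (f := fun _ => (1 / 20 : ℝ) * s) (g := R)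
    (by
      simp only [Finset.sum_const, Finset.card_univ, Fintype.card_fin, nsmul_eq_mul]
      linarith)
  refine ⟨j, fun Θ hc hmax B Astar hopt O => ?_⟩
  have h := (combUCB1_regret_le hc hopt O n).2
  rw [hmax] at h
  have hn2 : (2 : ℝ) ≤ n := by
    have : 2 ≤ K * (m * K) :=
      hm.trans ((Nat.le_mul_of_pos_right m hK).trans (Nat.le_mul_of_pos_left _ hK))
    exact_mod_cast this.trans hn
  set l := Real.sqrt (Real.log n) with hl
  have hl0 : 1 / 2 ≤ l := by
    refine Real.le_sqrt_of_sq_le ?_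
    have := Real.log_two_gt_d9
    have := Real.log_le_log (by norm_num) hn2
    norm_num at *
    linarith
  rw [Real.sqrt_mul (by positivity), ← hs, ← hl] at h
  have hKs : (K : ℝ) * (m * K : ℕ) ≤ s := by
    refine Real.le_sqrt_of_sq_le ?_
    rw [sq]
    exact mul_le_mul_of_nonneg_left hn' hKL0
  have hpi : Real.pi ^ 2 / 3 + 1 ≤ 5 := by nlinarith [Real.pi_lt_d2, Real.pi_pos]
  have h1 : (Real.pi ^ 2 / 3 + 1) * K * (m * K : ℕ) ≤ 5 * s := by
    rw [mul_assoc]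
    exact mul_le_mul hpi hKs hKL0 (by norm_num)
  have h2 : s ≤ 2 * (s * l) := by nlinarith
  have h3 : l * s ≤ 20 * (l * R j) := by nlinarith
  nlinarith

end

end SemiBandit

end

open SemiBandit in
theorem mainTheorem8 :
    -- computational efficiency
    CombUCB1ComputationallyEfficient ∧
    -- gap-dependent and gap-free upper bounds on the regret of CombUCB1
    (∀ (L : ℕ) (Θ : Finset (Finset (Fin L))), Covers Θ →
      ∀ (B : WeightLaw L) (Astar : Finset (Fin L)), IsOptimal Θ B Astar →
      ∀ (O : Oracle Θ) (n : ℕ),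
        (combUCB1 O).regret B Astar n ≤
          (∑ e ∈ Finset.univ.filter (fun e => e ∉ Astar),
            (maxSize Θ : ℝ) * (534 / minGap Θ B Astar e) * Real.log n)
            + (Real.pi ^ 2 / 3 + 1) * maxSize Θ * L ∧
        (combUCB1 O).regret B Astar n ≤
          47 * Real.sqrt ((maxSize Θ : ℝ) * L * n * Real.log n)
            + (Real.pi ^ 2 / 3 + 1) * maxSize Θ * L) ∧
    -- CombUCB1 is consistent
    (∀ (L : ℕ) (Θ : Finset (Finset (Fin L))), Covers Θ →
      ∀ O : Oracle Θ, (combUCB1 O).Consistent) ∧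
    -- gap-dependent lower bound for consistent algorithms, and its match with CombUCB1
    (∀ (m K : ℕ) (Δ : ℝ) (hΔ : 0 < Δ / K ∧ Δ / K < 0.5) (j : Fin m)
      (π : Algorithm (paths m K)), π.Consistent →
        (((((m * K : ℕ) : ℝ) - K) * K / (4 * Δ) : ℝ) : EReal) ≤
          Filter.liminf (fun n : ℕ =>
            ((π.regret (pathLaw K Δ hΔ j) (path K j) n / Real.log n : ℝ) : EReal))
            Filter.atTop ∧
        ∀ O : Oracle (paths m K),
          Filter.limsup (fun n : ℕ =>
            (((combUCB1 O).regret (pathLaw K Δ hΔ j) (path K j) n / Real.log n : ℝ) : EReal))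
            Filter.atTop ≤
          2136 * Filter.liminf (fun n : ℕ =>
            ((π.regret (pathLaw K Δ hΔ j) (path K j) n / Real.log n : ℝ) : EReal))
            Filter.atTop) ∧
    -- gap-free lower bound for all algorithms, and its match with CombUCB1 up to `√(log n)`
    (∃ C : ℝ, ∀ (m K n : ℕ), 2 ≤ m → 1 ≤ K →
      ∃ (Δ : ℝ) (hΔ : 0 < Δ / K ∧ Δ / K < 0.5), ∀ π : Algorithm (paths m K),
        (1 / 20 : ℝ) * min (Real.sqrt ((K : ℝ) * (m * K : ℕ) * n)) ((K : ℝ) * n) ≤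
          (∑ j : Fin m, π.regret (pathLaw K Δ hΔ j) (path K j) n) / m ∧
        (K * (m * K) ≤ n →
          ∃ j : Fin m, ∀ Θ : Finset (Finset (Fin (m * K))), Covers Θ → maxSize Θ = K →
            ∀ (B : WeightLaw (m * K)) (Astar : Finset (Fin (m * K))), IsOptimal Θ B Astar →
            ∀ O : Oracle Θ,
              (combUCB1 O).regret B Astar n ≤
                C * Real.sqrt (Real.log n) *
                  π.regret (pathLaw K Δ hΔ j) (path K j) n)) := by
  refine ⟨combUCB1_computationallyEfficient,
    fun L Θ hc B Astar hopt O n => combUCB1_regret_le hc hopt O n,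
    fun L Θ hc O => combUCB1_consistent hc O,
    fun m K Δ hΔ j π hπ => ⟨le_liminf_regret hπ Δ hΔ j,
      fun O => (limsup_combUCB1_regret_le Δ hΔ j O).trans ?_⟩,
    2000, fun m K n hm hK => ?_⟩
  · rw [EReal.coe_mul]
    exact mul_le_mul_of_nonneg_left (le_liminf_regret hπ Δ hΔ j) (by norm_num)
  · obtain ⟨Δ, hΔ, h⟩ := exists_gap_sum_regret_ge n hm hK
    exact ⟨Δ, hΔ, fun π => ⟨h π, fun hn => exists_combUCB1_regret_le hm hK hn (h π)⟩⟩
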